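/- Let $N$ be a compact smooth manifold without boundary with a riemannian metric, and let $C$ be a vectorial gerbe on $N$ whose typical fibre $V$ is a finite-dimensional real vector space: a sheaf of categories on $N$ whose objects over an open set $U$ are smooth vector bundles over $U$ with fibre $V$, whose arrows are isomorphisms of vector bundles, which has objects locally, in which any two objects over the same open set are locally isomorphic, and whose automorphism groups are given by a sheaf of commutative groups on $N$ (the band). Suppose that $C$ is riemannian: every object carries a riemannian metric and a smooth metric connection $\nabla$, both compatible with restriction to smaller open sets, and every arrow is isometric. Let $\Delta=\nabla^*\nabla$ be the connection laplacian of each object and suppose that all arrows of $C$ commute with $\Delta$. Let $(U_i)_{i\in I}$ be an open covering of $N$, let $e_i$ be an object of $C(U_i)$, and let $g_{ij}:e_j|_{U_i\cap U_j}\to e_i|_{U_i\cap U_j}$ be arrows of $C(U_i\cap U_j)$. Let $S(g_{ij})$ be the real vector space of families $u=(u_i)_{i\in I}$ of smooth sections $u_i$ of $e_i$ with $u_i=g_{ij}(u_j)$ on $U_i\cap U_j$ for all $i,j$; the laplacian acts on it by $(\Delta u)_i=\Delta(u_i)$. Fix a smooth partition of unity $(f_i)$ subordinate to $(U_i)$,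 and let $\langle u,v\rangle=\sum_i\int_N f_i\langle u_i,v_i\rangle$, where $N$ carries its riemannian volume; let $L^2(S(g_{ij}))$ be the corresponding Hilbert completion. For a real number $s$ let $H_s(S(g_{ij}))$ be the Hilbert completion of $S(g_{ij})$ for the scalar product $$\langle u,v\rangle_s=\langle(1+\Delta)^{s}u,v\rangle=\langle(1+\Delta)^{s/2}u,(1+\Delta)^{s/2}v\rangle .$$ (When $s/2$ is not a natural number, $(1+\Delta)^{s/2}u$ means $B^{k-s/2}(1+\Delta)^k u$ for the least natural number $k\ge s/2$, where $B=(1+\Delta)^{-1}$ is the bounded positive operator of $L^2(S(g_{ij}))$ that comes from the form $\langle u,v\rangle+\sum_i\int_N f_i\langle\nabla u_i,\nabla v_i\rangle$ on $S(g_{ij})$, closed in $L^2(S(g_{ij}))$. If $s$ is a natural number, this is the differential operator expression $\sum_i\int_N f_i\langle(1+\Delta)^s u_i,v_i\rangle$.) Write $\|\cdot\|_s$ for the norm of $H_s(S(g_{ij}))$. Let $t<s$ be real numbers. Then the identity of $S(g_{ij})$ extends to a continuous injective linear map $H_s(S(g_{ij}))\to H_t(S(g_{ij}))$, the inclusion.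 If $(h_k)_{k\in\mathbb N}$ is a sequence in $H_s(S(g_{ij}))$ and $L$ is a constant with $\|h_k\|_s<L$ for all $k$, then some subsequence of $(h_k)$ converges in $H_t(S(g_{ij}))$. Consequently the inclusion $H_s(S(g_{ij}))\to H_t(S(g_{ij}))$ is a compact operator. -/

import Mathlib

open Bundle TopologicalSpace MeasureTheory Filter Set
open scoped Manifold ContDiff Topology

universe u v w

noncomputable section

namespace GerbeRellich

/-- The model space `ℝⁿ`. -/
abbrev Euc (n : ℕ) : Type := EuclideanSpace ℝ (Fin n)

/-! ### Hilbert completions of prehilbertian structures -/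

section HilbertCompletion

variable {X : Type*} [AddCommGroup X] [Module ℝ X]

/-- A real vector space regarded with a given (semi-definite) scalar product. -/
def PreHilbert (_cd : PreInnerProductSpace.Core ℝ X) : Type _ := X

variable (cd : PreInnerProductSpace.Core ℝ X)

instance : SeminormedAddCommGroup (PreHilbert cd) :=
  @InnerProductSpace.Core.toSeminormedAddCommGroup ℝ X _ _ _ cd

instance : InnerProductSpace ℝ (PreHilbert cd) :=
  @InnerProductSpace.ofCore ℝ X _ _ _ cd

/-- The Hilbert completion of a vector space with a scalar product. -/
abbrev HilbertCompletion : Type _ := UniformSpace.Completion (PreHilbert cd)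

/-- The canonical map from a prehilbertian space to its Hilbert completion. -/
def toHilbert : X →ₗ[ℝ] HilbertCompletion cd where
  toFun u := ((show PreHilbert cd from u : PreHilbert cd) : UniformSpace.Completion (PreHilbert cd))
  map_add' u v := UniformSpace.Completion.coe_add (α := PreHilbert cd) u v
  map_smul' r u := UniformSpace.Completion.coe_smul (X := PreHilbert cd) r u

theorem norm_preHilbert (u : PreHilbert cd) : ‖u‖ = Real.sqrt (cd.inner u u) := rfl

/-- If the first scalar product dominates the second one, then the identity extends to a
continuous linear map between the Hilbert completions. -/
def completionMap (cd cd' : PreInnerProductSpace.Core ℝ X)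
    (h : ∀ u, cd'.inner u u ≤ cd.inner u u) :
    HilbertCompletion cd →L[ℝ] HilbertCompletion cd' :=
  (LinearMap.mkContinuous
    ({ toFun := fun u => u, map_add' := fun _ _ => rfl, map_smul' := fun _ _ => rfl } :
      PreHilbert cd →ₗ[ℝ] PreHilbert cd') 1
    (fun u => by
      rw [one_mul]
      exact Real.sqrt_le_sqrt (h u))).completion

/-- The scalar product `(u, v) ↦ ⟨T u, T v⟩` induced by a linear map into a Hilbert space. -/
abbrev inducedCore {H : Type*} [NormedAddCommGroup H] [InnerProductSpace ℝ H] (T : X →ₗ[ℝ] H) :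
    PreInnerProductSpace.Core ℝ X where
  inner u v := inner ℝ (T u) (T v)
  conj_inner_symm u v := by simp [real_inner_comm]
  re_inner_nonneg u := by simp
  add_left u v w := by simp [inner_add_left]
  smul_left u v r := by simp [inner_smul_left]

/-- The power `Bʳ`, `r ≥ 0`, of a self-adjoint operator `0 ≤ B ≤ 1`, through the binomial series
`Bʳ = (1 - (1 - B))ʳ = ∑ₖ (-1)ᵏ (r choose k) (1 - B)ᵏ`, which converges in operator norm. -/
def realPower {H : Type*} [NormedAddCommGroup H] [NormedSpace ℝ H] (B : H →L[ℝ] H) (r : ℝ) :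
    H →L[ℝ] H :=
  ∑' k : ℕ, ((-1 : ℝ) ^ k * Ring.choose r k) • (1 - B) ^ k

end HilbertCompletion

/-! ### Smooth vector bundles over open subsets -/

section Bundles

variable {n : ℕ} {N : Type u} [TopologicalSpace N] [ChartedSpace (Euc n) N]
  {V : Type v} [NormedAddCommGroup V] [NormedSpace ℝ V]

/-- A smooth vector bundle over the open subset `U` of `N`, with typical fibre `V`. -/
structure VectBundle (n : ℕ) {N : Type u} [TopologicalSpace N] [ChartedSpace (Euc n) N]
    (V : Type v) [NormedAddCommGroup V] [NormedSpace ℝ V] (U : Opens N) where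
  /-- The fibres. -/
  Fib : U → Type v
  [acg : ∀ x, AddCommGroup (Fib x)]
  [mod : ∀ x, Module ℝ (Fib x)]
  [top : ∀ x, TopologicalSpace (Fib x)]
  [tag : ∀ x, IsTopologicalAddGroup (Fib x)]
  [cts : ∀ x, ContinuousSMul ℝ (Fib x)]
  [topTot : TopologicalSpace (TotalSpace V Fib)]
  [fiberBundle : FiberBundle V Fib]
  [vectorBundle : VectorBundle ℝ V Fib]
  [smoothBundle : ContMDiffVectorBundle ∞ V Fib (𝓡 n)]

attribute [instance] VectBundle.acg VectBundle.mod VectBundle.top VectBundle.tag VectBundle.cts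
  VectBundle.topTot VectBundle.fiberBundle VectBundle.vectorBundle VectBundle.smoothBundle

/-- The smooth sections of a vector bundle over `U`. -/
abbrev VectBundle.Sec {U : Opens N} (E : VectBundle n V U) : Type _ :=
  ContMDiffSection (𝓡 n) V ∞ E.Fib

/-- Isomorphisms of smooth vector bundles over `U` (covering the identity of `U`). -/
structure BundleIso {U : Opens N} (E F : VectBundle n V U) where
  map : ∀ x, E.Fib x ≃L[ℝ] F.Fib x
  smooth : ContMDiff ((𝓡 n).prod 𝓘(ℝ, V)) ((𝓡 n).prod 𝓘(ℝ, V)) ∞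
    (fun p : TotalSpace V E.Fib => (⟨p.1, map p.1 p.2⟩ : TotalSpace V F.Fib))
  smooth_symm : ContMDiff ((𝓡 n).prod 𝓘(ℝ, V)) ((𝓡 n).prod 𝓘(ℝ, V)) ∞
    (fun p : TotalSpace V F.Fib => (⟨p.1, (map p.1).symm p.2⟩ : TotalSpace V E.Fib))

/-- The identity isomorphism. -/
def BundleIso.refl {U : Opens N} (E : VectBundle n V U) : BundleIso E E where
  map _ := ContinuousLinearEquiv.refl ℝ _
  smooth := contMDiff_id
  smooth_symm := contMDiff_id

/-- The inverse isomorphism. -/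
def BundleIso.symm {U : Opens N} {E F : VectBundle n V U} (φ : BundleIso E F) :
    BundleIso F E where
  map x := (φ.map x).symm
  smooth := φ.smooth_symm
  smooth_symm := φ.smooth

/-- The composition, first `φ` and then `ψ`. -/
def BundleIso.trans {U : Opens N} {E F G : VectBundle n V U} (φ : BundleIso E F)
    (ψ : BundleIso F G) : BundleIso E G where
  map x := (φ.map x).trans (ψ.map x)
  smooth := ψ.smooth.comp φ.smooth
  smooth_symm := φ.smooth_symm.comp ψ.smooth_symm

/-- The action `s ↦ φ(s)` of an isomorphism on smooth sections. -/
def BundleIso.onSec {U : Opens N} {E F : VectBundle n V U} (φ : BundleIso E F) (s : E.Sec) :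
    F.Sec where
  toFun x := φ.map x (s x)
  contMDiff_toFun := φ.smooth.comp s.contMDiff

/-- An identification of a bundle `E` over `W` with the restriction to `W` of a bundle `F` over
`U`, for `W ⊆ U`: a smooth map of total spaces which covers the inclusion of `W` in `U` and is
a linear isomorphism on each fibre. -/
structure RestrictionMap {W U : Opens N} (h : W ≤ U) (E : VectBundle n V W)
    (F : VectBundle n V U) where
  map : ∀ x : W, E.Fib x ≃L[ℝ] F.Fib (Opens.inclusion h x)
  smooth : ContMDiff ((𝓡 n).prod 𝓘(ℝ, V)) ((𝓡 n).prod 𝓘(ℝ, V)) ∞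
    (fun p : TotalSpace V E.Fib =>
      (⟨Opens.inclusion h p.1, map p.1 p.2⟩ : TotalSpace V F.Fib))

/-- `ψ` is the restriction to `W` of the isomorphism `φ` of bundles over `U`. -/
def IsRestriction {W U : Opens N} {h : W ≤ U} {E' F' : VectBundle n V W} {E F : VectBundle n V U}
    (rE : RestrictionMap h E' E) (rF : RestrictionMap h F' F) (φ : BundleIso E F)
    (ψ : BundleIso E' F') : Prop :=
  ∀ (x : W) (a : E'.Fib x), rF.map x (ψ.map x a) = φ.map (Opens.inclusion h x) (rE.map x a)

/-- An isomorphism over `U ∩ U'` from the restriction of `F` to the restriction of `E`, as a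
family of isomorphisms from the fibres of `F` to the fibres of `E`. -/
def transition {U U' : Opens N} {E : VectBundle n V U} {F : VectBundle n V U'}
    {E' F' : VectBundle n V (U ⊓ U')} (rE : RestrictionMap inf_le_left E' E)
    (rF : RestrictionMap inf_le_right F' F) (φ : BundleIso F' E') (y : N) (hU : y ∈ U)
    (hU' : y ∈ U') : F.Fib ⟨y, hU'⟩ ≃L[ℝ] E.Fib ⟨y, hU⟩ :=
  ((rF.map ⟨y, hU, hU'⟩).symm.trans (φ.map ⟨y, hU, hU'⟩)).trans (rE.map ⟨y, hU, hU'⟩)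

end Bundles

/-! ### Vectorial gerbes -/

/-- A vectorial gerbe on `N` with typical fibre `V`: a sheaf of categories on `N` whose objects
over `U` are vector bundles over `U` with typical fibre `V`, whose arrows are isomorphisms of
vector bundles, and which is a gerbe with commutative band. -/
structure VectorialGerbe (n : ℕ) (N : Type u) [TopologicalSpace N] [ChartedSpace (Euc n) N]
    (V : Type v) [NormedAddCommGroup V] [NormedSpace ℝ V] where
  /-- The objects of `C(U)`. -/
  Obj : Opens N → Type w
  /-- The vector bundle over `U` given by an object of `C(U)`. -/
  bundle : ∀ {U : Opens N}, Obj U → VectBundle n V U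
  /-- The arrows of `C(U)`. -/
  Hom : ∀ {U : Opens N} (e e' : Obj U), Set (BundleIso (bundle e) (bundle e'))
  refl_mem : ∀ {U : Opens N} (e : Obj U), BundleIso.refl (bundle e) ∈ Hom e e
  symm_mem : ∀ {U : Opens N} {e e' : Obj U}, ∀ φ ∈ Hom e e', φ.symm ∈ Hom e' e
  trans_mem : ∀ {U : Opens N} {e e' e'' : Obj U}, ∀ φ ∈ Hom e e', ∀ ψ ∈ Hom e' e'',
    φ.trans ψ ∈ Hom e e''
  /-- The restriction functors, on objects. -/
  res : ∀ {W U : Opens N}, W ≤ U → Obj U → Obj W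
  /-- The bundle of the restriction of an object is the restriction of its bundle. -/
  resMap : ∀ {W U : Opens N} (h : W ≤ U) (e : Obj U), RestrictionMap h (bundle (res h e)) (bundle e)
  /-- The restriction of an arrow is an arrow. -/
  res_mem : ∀ {W U : Opens N} (h : W ≤ U) {e e' : Obj U}, ∀ φ ∈ Hom e e',
    ∀ ψ : BundleIso (bundle (res h e)) (bundle (res h e')),
      IsRestriction (resMap h e) (resMap h e') φ ψ → ψ ∈ Hom (res h e) (res h e')
  /-- The restriction to `U` itself is the identity. -/
  res_refl : ∀ {U : Opens N} (e : Obj U) (ψ : BundleIso (bundle (res le_rfl e)) (bundle e)),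
    (∀ x a, ψ.map x a = (resMap le_rfl e).map x a) → ψ ∈ Hom (res le_rfl e) e
  /-- Restrictions compose. -/
  res_res : ∀ {Y W U : Opens N} (h' : Y ≤ W) (h : W ≤ U) (e : Obj U)
    (ψ : BundleIso (bundle (res h' (res h e))) (bundle (res (h'.trans h) e))),
    (∀ x a, (resMap (h'.trans h) e).map x (ψ.map x a) =
      (resMap h e).map (Opens.inclusion h' x) ((resMap h' (res h e)).map x a)) →
    ψ ∈ Hom (res h' (res h e)) (res (h'.trans h) e)
  /-- Gluing of arrows. An arrow is determined by its values on the fibres, so that the sheaf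
  property of `Hom` says that an isomorphism which is locally an arrow is an arrow. -/
  glue_hom : ∀ {U : Opens N} {e e' : Obj U} (φ : BundleIso (bundle e) (bundle e')),
    (∀ x ∈ U, ∃ (W : Opens N) (h : W ≤ U), x ∈ W ∧ ∃ ψ ∈ Hom (res h e) (res h e'),
      IsRestriction (resMap h e) (resMap h e') φ ψ) → φ ∈ Hom e e'
  /-- Gluing of objects. -/
  glue_obj : ∀ {A : Type u} (W : A → Opens N) (e : ∀ a, Obj (W a))
    (g : ∀ a b, BundleIso (bundle (res (inf_le_right : W a ⊓ W b ≤ W b) (e b)))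
      (bundle (res (inf_le_left : W a ⊓ W b ≤ W a) (e a)))),
    (∀ a b, g a b ∈ Hom _ _) →
    (∀ a b c (y : N) (ha : y ∈ W a) (hb : y ∈ W b) (hc : y ∈ W c)
      (p : (bundle (e c)).Fib ⟨y, hc⟩),
      transition (resMap _ (e a)) (resMap _ (e b)) (g a b) y ha hb
        (transition (resMap _ (e b)) (resMap _ (e c)) (g b c) y hb hc p) =
      transition (resMap _ (e a)) (resMap _ (e c)) (g a c) y ha hc p) →
    ∃ (x : Obj (⨆ a, W a))
      (φ : ∀ a, BundleIso (bundle (res (le_iSup W a) x)) (bundle (e a))),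
      (∀ a, φ a ∈ Hom _ _) ∧
      ∀ a b (y : N) (ha : y ∈ W a) (hb : y ∈ W b)
        (p : (bundle x).Fib ⟨y, le_iSup W b hb⟩),
        transition (resMap _ (e a)) (resMap _ (e b)) (g a b) y ha hb
          ((φ b).map ⟨y, hb⟩ (((resMap (le_iSup W b) x).map ⟨y, hb⟩).symm p)) =
        (φ a).map ⟨y, ha⟩ (((resMap (le_iSup W a) x).map ⟨y, ha⟩).symm p)
  /-- There are objects locally. -/
  locally_nonempty : ∀ x : N, ∃ U : Opens N, x ∈ U ∧ Nonempty (Obj U)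
  /-- Two objects are locally isomorphic. -/
  locally_iso : ∀ {U : Opens N} (e e' : Obj U), ∀ x ∈ U, ∃ (W : Opens N) (h : W ≤ U),
    x ∈ W ∧ (Hom (res h e) (res h e')).Nonempty
  /-- The band, a sheaf of commutative groups. -/
  band : TopCat.Sheaf CommGrpCat.{max u v} (TopCat.of N)
  /-- The automorphisms of an object over `U` are the sections of the band over `U`. -/
  bandEquiv : ∀ {U : Opens N} (e : Obj U), band.obj.obj (Opposite.op U) ≃ Hom e e
  bandEquiv_mul : ∀ {U : Opens N} (e : Obj U) (a b : band.obj.obj (Opposite.op U)),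
    (bandEquiv e (a * b) : BundleIso (bundle e) (bundle e)) =
      (bandEquiv e b : BundleIso (bundle e) (bundle e)).trans (bandEquiv e a)
  bandEquiv_res : ∀ {W U : Opens N} (h : W ≤ U) (e : Obj U) (a : band.obj.obj (Opposite.op U)),
    IsRestriction (resMap h e) (resMap h e) (bandEquiv e a)
      (bandEquiv (res h e) (band.obj.map (CategoryTheory.homOfLE h).op a))

section Gerbes

variable {n : ℕ} {N : Type u} [TopologicalSpace N] [ChartedSpace (Euc n) N]
  [IsManifold (𝓡 n) ∞ N] {V : Type v} [NormedAddCommGroup V] [NormedSpace ℝ V]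

/-- A riemannian metric on a vectorial gerbe, which the arrows preserve, together with a
riemannian connection on each object. -/
structure RiemannianStructure (C : VectorialGerbe.{u, v, w} n N V) where
  metric : ∀ {U : Opens N} (e : C.Obj U),
    ContMDiffRiemannianMetric (𝓡 n) ∞ V (C.bundle e).Fib
  metric_hom : ∀ {U : Opens N} {e e' : C.Obj U}, ∀ φ ∈ C.Hom e e', ∀ x a b,
    (metric e').inner x (φ.map x a) (φ.map x b) = (metric e).inner x a b
  metric_res : ∀ {W U : Opens N} (h : W ≤ U) (e : C.Obj U) (x : W) (a b),
    (metric e).inner (Opens.inclusion h x) ((C.resMap h e).map x a) ((C.resMap h e).map x b) =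
      (metric (C.res h e)).inner x a b
  conn : ∀ {U : Opens N} (e : C.Obj U), CovariantDerivative (𝓡 n) V (C.bundle e).Fib
  conn_smooth : ∀ {U : Opens N} (e : C.Obj U), CovariantDerivative.ContMDiffCovariantDerivative (conn e) ∞
  /-- The connection is compatible with the metric: `X⟨s, t⟩ = ⟨∇_X s, t⟩ + ⟨s, ∇_X t⟩`. -/
  conn_metric : ∀ {U : Opens N} (e : C.Obj U) (s t : (C.bundle e).Sec) (x : U)
    (X : TangentSpace (𝓡 n) x),
    mfderiv (𝓡 n) 𝓘(ℝ, ℝ) (fun y => (metric e).inner y (s y) (t y)) x X =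
      (metric e).inner x (conn e s x X) (t x) + (metric e).inner x (s x) (conn e t x X)
  /-- The connection of the restriction is the restriction of the connection. -/
  conn_res : ∀ {W U : Opens N} (h : W ≤ U) (e : C.Obj U) (s : (C.bundle e).Sec)
    (t : (C.bundle (C.res h e)).Sec),
    (∀ x, (C.resMap h e).map x (t x) = s (Opens.inclusion h x)) →
    ∀ (x : W) (X : TangentSpace (𝓡 n) x),
      (C.resMap h e).map x (conn (C.res h e) t x X) =
        conn e s (Opens.inclusion h x) (mfderiv (𝓡 n) (𝓡 n) (Opens.inclusion h) x X)

/-- A Čech `1`-chain of a vectorial gerbe: an open covering, an object `e i` over each `U i`, and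
arrows `g i j` over `U i ∩ U j` from the restriction of `e j` to that of `e i`. -/
structure CechChain (C : VectorialGerbe.{u, v, w} n N V) where
  ι : Type u
  U : ι → Opens N
  cover : ∀ x : N, ∃ i, x ∈ U i
  e : ∀ i, C.Obj (U i)
  g : ∀ i j, BundleIso (C.bundle (C.res (inf_le_right : U i ⊓ U j ≤ U j) (e j)))
    (C.bundle (C.res (inf_le_left : U i ⊓ U j ≤ U i) (e i)))
  g_mem : ∀ i j, g i j ∈ C.Hom _ _

/-- The vector space `S(g_ij)` of global sections of the gerbe associated to the chain: families
of smooth sections `s i` of `e i` with `s i = g i j (s j)` on `U i ∩ U j`. -/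
def globalSections {C : VectorialGerbe.{u, v, w} n N V} (c : CechChain C) :
    Submodule ℝ (∀ i, (C.bundle (c.e i)).Sec) where
  carrier := {s | ∀ i j (y : N) (hi : y ∈ c.U i) (hj : y ∈ c.U j),
    s i ⟨y, hi⟩ =
      transition (C.resMap _ (c.e i)) (C.resMap _ (c.e j)) (c.g i j) y hi hj (s j ⟨y, hj⟩)}
  add_mem' {s t} hs ht i j y hi hj := by
    change s i ⟨y, hi⟩ + t i ⟨y, hi⟩ = transition _ _ _ y hi hj (s j ⟨y, hj⟩ + t j ⟨y, hj⟩)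
    rw [map_add, ← hs i j y hi hj, ← ht i j y hi hj]
  zero_mem' i j y hi hj := by
    change (0 : (C.bundle (c.e i)).Fib ⟨y, hi⟩) = transition _ _ _ y hi hj 0
    rw [map_zero]
  smul_mem' r s hs i j y hi hj := by
    change r • s i ⟨y, hi⟩ = transition _ _ _ y hi hj (r • s j ⟨y, hj⟩)
    rw [map_smul, ← hs i j y hi hj]

/-- A partition of unity subordinate to the covering of a chain. -/
abbrev Partition {C : VectorialGerbe.{u, v, w} n N V} (c : CechChain C) : Type _ :=
  {f : SmoothPartitionOfUnity c.ι (𝓡 n) N univ // f.IsSubordinate fun i => (c.U i : Set N)}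

end Gerbes

/-! ### Riemannian volume and scalar products -/

section Metric

variable {n : ℕ} {N : Type u} [TopologicalSpace N] [ChartedSpace (Euc n) N]
  [IsManifold (𝓡 n) ∞ N]

/-- A riemannian metric on the manifold `N`. -/
abbrev ManifoldMetric (n : ℕ) (N : Type u) [TopologicalSpace N] [ChartedSpace (Euc n) N]
    [IsManifold (𝓡 n) ∞ N] : Type _ :=
  ContMDiffRiemannianMetric (𝓡 n) ∞ (Euc n) (fun x : N => TangentSpace (𝓡 n) x)

/-- The coordinate vector fields `∂_a` of the chart of `N` at `c`, which are the local frame of the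
tangent bundle given by that chart. -/
def coordField (c : N) (a : Fin n) (x : N) : TangentSpace (𝓡 n) x :=
  (trivializationAt (Euc n) (fun x : N => TangentSpace (𝓡 n) x) c).localFrame
    (EuclideanSpace.basisFun (Fin n) ℝ).toBasis a x

/-- The matrix `g(∂_a, ∂_b)` of the metric in the chart at `c`. -/
def coordGram (g : ManifoldMetric n N) (c x : N) : Matrix (Fin n) (Fin n) ℝ :=
  Matrix.of fun a b => g.inner x (coordField c a x) (coordField c b x)

theorem continuousOn_coordGram_det (g : ManifoldMetric n N) (c : N) :
    ContinuousOn (fun x => (coordGram g c x).det) (chartAt (Euc n) c).source := by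
  have hf : ∀ a, ContMDiffOn (𝓡 n) ((𝓡 n).prod (𝓡 n)) ∞
      (fun x : N => TotalSpace.mk' (Euc n) (E := fun x : N => TangentSpace (𝓡 n) x) x
        (coordField c a x))
      (chartAt (Euc n) c).source := by
    intro a
    have := (trivializationAt (Euc n) (fun x : N => TangentSpace (𝓡 n) x)
      c).contMDiffOn_localFrame_baseSet (I := 𝓡 n) ∞ (EuclideanSpace.basisFun (Fin n) ℝ).toBasis a
    rw [TangentBundle.trivializationAt_baseSet] at this
    exact this
  have : ∀ a b, ContinuousOn (fun x => coordGram g c x a b) (chartAt (Euc n) c).source := by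
    intro a b
    have h2 : ContMDiffOn (𝓡 n) ((𝓡 n).prod 𝓘(ℝ, ℝ)) ∞
        (fun x => TotalSpace.mk' ℝ (E := Bundle.Trivial N ℝ) x
          (g.inner x (coordField c a x) (coordField c b x))) (chartAt (Euc n) c).source :=
      ContMDiffOn.clm_bundle_apply₂ (F₁ := Euc n) (F₂ := Euc n)
        (g.contMDiff.contMDiffOn) (hf a) (hf b)
    intro x hx
    have h3 := h2 x hx
    rw [contMDiffWithinAt_totalSpace] at h3
    exact h3.2.continuousWithinAt
  intro x hx
  have h : ContinuousWithinAt (fun x => coordGram g c x) (chartAt (Euc n) c).source x :=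
    continuousWithinAt_pi.2 fun a => continuousWithinAt_pi.2 fun b => this a b x hx
  exact (Continuous.matrix_det continuous_id).continuousAt.comp_continuousWithinAt h

variable [MeasurableSpace N]

/-- The measure `√det(g(∂_a, ∂_b)) dx¹ ⋯ dxⁿ` on the domain of the chart at `c`. -/
def chartVolume (g : ManifoldMetric n N) (c : N) : Measure N :=
  (((volume : Measure (Euc n)).restrict (extChartAt (𝓡 n) c).target).withDensity
    (fun y => ENNReal.ofReal
      (Real.sqrt (coordGram g c ((extChartAt (𝓡 n) c).symm y)).det))).map (extChartAt (𝓡 n) c).symm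

/-- The riemannian volume: the measure which is `√det(g(∂_a, ∂_b)) dx¹ ⋯ dxⁿ` in every chart,
assembled with a smooth partition of unity subordinate to the domains of the charts. -/
def riemannianVolume [T2Space N] [SigmaCompactSpace N] (g : ManifoldMetric n N) : Measure N :=
  Measure.sum fun c : N => (chartVolume g c).withDensity fun x => ENNReal.ofReal
    ((SmoothPartitionOfUnity.exists_isSubordinate_chartAt_source (𝓡 n) N).choose c x)

instance isFiniteMeasure_riemannianVolume [T2Space N] [CompactSpace N] [BorelSpace N]
    (g : ManifoldMetric n N) : IsFiniteMeasure (riemannianVolume g) := by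
  set ρ := (SmoothPartitionOfUnity.exists_isSubordinate_chartAt_source (𝓡 n) N).choose with hρ
  have hsub := (SmoothPartitionOfUnity.exists_isSubordinate_chartAt_source (𝓡 n) N).choose_spec
  have hρm : ∀ c, Measurable fun x => ENNReal.ofReal (ρ c x) := fun c =>
    ENNReal.measurable_ofReal.comp (ρ c).contMDiff.continuous.measurable
  have hfin : {c | (Function.support (ρ c) ∩ (univ : Set N)).Nonempty}.Finite :=
    ρ.locallyFinite.finite_nonempty_inter_compact isCompact_univ
  have hone : ∀ c, (chartVolume g c).withDensity (fun x => ENNReal.ofReal (ρ c x)) univ < ⊤ := by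
    intro c
    rw [withDensity_apply _ MeasurableSet.univ, Measure.restrict_univ]
    set φ := extChartAt (𝓡 n) c with hφ
    have hT : IsOpen φ.target := isOpen_extChartAt_target c
    have hφc : ContinuousOn φ.symm φ.target := continuousOn_extChartAt_symm c
    have hmap : MapsTo φ.symm φ.target (chartAt (Euc n) c).source := by
      intro y hy
      have := φ.map_target hy
      rwa [hφ, extChartAt_source] at this
    have hdc : ContinuousOn (fun y => Real.sqrt (coordGram g c (φ.symm y)).det) φ.target :=
      Real.continuous_sqrt.comp_continuousOn ((continuousOn_coordGram_det g c).comp hφc hmap)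
    have hdm : AEMeasurable (fun y => ENNReal.ofReal (Real.sqrt (coordGram g c (φ.symm y)).det))
        ((volume : Measure (Euc n)).restrict φ.target) :=
      ENNReal.measurable_ofReal.comp_aemeasurable (hdc.aemeasurable hT.measurableSet)
    have hsm : AEMeasurable φ.symm ((volume : Measure (Euc n)).restrict φ.target) :=
      hφc.aemeasurable hT.measurableSet
    have hsm' : AEMeasurable φ.symm (((volume : Measure (Euc n)).restrict φ.target).withDensity
        (fun y => ENNReal.ofReal (Real.sqrt (coordGram g c (φ.symm y)).det))) :=
      hsm.mono_ac (withDensity_absolutelyContinuous _ _)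
    have hρs : AEMeasurable (fun y => ENNReal.ofReal (ρ c (φ.symm y)))
        ((volume : Measure (Euc n)).restrict φ.target) := (hρm c).comp_aemeasurable hsm
    rw [chartVolume, lintegral_map' (hρm c).aemeasurable hsm',
      lintegral_withDensity_eq_lintegral_mul₀ hdm hρs]
    set K : Set (Euc n) := φ '' tsupport (ρ c) with hK
    have hts : tsupport (ρ c) ⊆ φ.source := by
      rw [hφ, extChartAt_source]; exact hsub c
    have hKc : IsCompact K :=
      (isClosed_tsupport _).isCompact.image_of_continuousOn
        ((continuousOn_extChartAt c).mono hts)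
    have hKT : K ⊆ φ.target := by
      rintro _ ⟨x, hx, rfl⟩; exact φ.map_source (hts hx)
    obtain ⟨M, hM⟩ := (hKc.image_of_continuousOn (hdc.mono hKT)).bddAbove
    have hle : ∀ y ∈ φ.target,
        ((fun y => ENNReal.ofReal (Real.sqrt (coordGram g c (φ.symm y)).det)) *
          fun y => ENNReal.ofReal (ρ c (φ.symm y))) y ≤
        K.indicator (fun _ => ENNReal.ofReal M) y := by
      intro y hy
      by_cases hyK : y ∈ K
      · rw [indicator_of_mem hyK, Pi.mul_apply]
        calc _ ≤ ENNReal.ofReal M * 1 := by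
              gcongr
              · exact hM ⟨y, hyK, rfl⟩
              · exact ENNReal.ofReal_le_one.2 (ρ.le_one c _)
          _ = _ := mul_one _
      · have h0 : ρ c (φ.symm y) = 0 := by
          by_contra hne
          exact hyK ⟨φ.symm y, subset_tsupport _ hne, φ.right_inv hy⟩
        simp [h0]
    calc _ ≤ ∫⁻ y in φ.target, K.indicator (fun _ => ENNReal.ofReal M) y :=
          setLIntegral_mono' hT.measurableSet hle
      _ ≤ ∫⁻ y, K.indicator (fun _ => ENNReal.ofReal M) y := setLIntegral_le_lintegral _ _
      _ = ENNReal.ofReal M * volume K := lintegral_indicator_const hKc.measurableSet _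
      _ < ⊤ := ENNReal.mul_lt_top ENNReal.ofReal_lt_top hKc.measure_lt_top
  refine ⟨?_⟩
  rw [riemannianVolume, Measure.sum_apply _ MeasurableSet.univ, ← hρ]
  rw [tsum_eq_sum (s := hfin.toFinset)]
  · exact ENNReal.sum_lt_top.2 fun c _ => hone c
  · intro c hc
    have h0 : ∀ x, ρ c x = 0 := by
      intro x
      by_contra hne
      exact hc (hfin.mem_toFinset.2 ⟨x, hne, mem_univ _⟩)
    simp [h0]

end Metric

section Contraction

variable {n : ℕ} {T : Type*} [AddCommGroup T] [Module ℝ T]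

/-- The contraction `∑ G^{ac} Q(b_a, b_c)` of a bilinear form `Q` with the inverse of a
scalar product `G`, in a basis `b`. -/
def contraction (b : Module.Basis (Fin n) ℝ T) (G Q : LinearMap.BilinForm ℝ T) : ℝ :=
  ∑ a, ∑ c, (LinearMap.BilinForm.toMatrix b G)⁻¹ a c * Q (b a) (b c)

theorem contraction_eq_trace (b : Module.Basis (Fin n) ℝ T) (G Q : LinearMap.BilinForm ℝ T) :
    contraction b G Q =
      ((LinearMap.BilinForm.toMatrix b G)⁻¹ * (LinearMap.BilinForm.toMatrix b Q).transpose).trace := by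
  simp [contraction, Matrix.trace, Matrix.mul_apply, LinearMap.BilinForm.toMatrix_apply]

/-- The contraction does not depend on the basis. -/
theorem contraction_basis_indep (b b' : Module.Basis (Fin n) ℝ T) (G Q : LinearMap.BilinForm ℝ T) :
    contraction b' G Q = contraction b G Q := by
  set P := b.toMatrix b' with hP
  set P' := b'.toMatrix b with hP'
  have h1 : P * P' = 1 := by rw [hP, hP', Module.Basis.toMatrix_mul_toMatrix_flip]
  have hG := LinearMap.BilinForm.toMatrix_mul_basis_toMatrix b b' G
  have hQ := LinearMap.BilinForm.toMatrix_mul_basis_toMatrix b b' Q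
  have hPi : P⁻¹ = P' := Matrix.inv_eq_right_inv h1
  have hP'P : P' * P = 1 := mul_eq_one_comm.1 h1
  have hPt : P.transpose⁻¹ = P'.transpose := by rw [← Matrix.transpose_nonsing_inv, hPi]
  have h2 : P'.transpose * P.transpose = 1 := by
    rw [← Matrix.transpose_mul, h1, Matrix.transpose_one]
  rw [contraction_eq_trace, contraction_eq_trace, ← hG, ← hQ, ← hP, Matrix.mul_inv_rev,
    Matrix.mul_inv_rev, hPi, hPt]
  simp only [Matrix.transpose_mul, Matrix.transpose_transpose]
  set Gi := (LinearMap.BilinForm.toMatrix b G)⁻¹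
  set Qt := (LinearMap.BilinForm.toMatrix b Q).transpose
  have : P' * (Gi * P'.transpose) * (P.transpose * (Qt * P)) = P' * (Gi * Qt * P) := by
    have h3 : P' * (Gi * P'.transpose) * (P.transpose * (Qt * P)) =
        P' * (Gi * ((P'.transpose * P.transpose) * (Qt * P))) := by
      simp only [Matrix.mul_assoc]
    rw [h3, h2, Matrix.one_mul, Matrix.mul_assoc]
  rw [this, Matrix.trace_mul_comm, Matrix.mul_assoc, h1, Matrix.mul_one]

theorem posDef_toMatrix (b : Module.Basis (Fin n) ℝ T) (G : LinearMap.BilinForm ℝ T)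
    (hs : ∀ v w, G v w = G w v) (hp : ∀ v, v ≠ 0 → 0 < G v v) :
    (LinearMap.BilinForm.toMatrix b G).PosDef := by
  refine Matrix.PosDef.of_dotProduct_mulVec_pos ?_ ?_
  · ext i j
    simp [LinearMap.BilinForm.toMatrix_apply, hs (b i) (b j)]
  · intro x hx
    have hne : b.equivFun.symm x ≠ 0 := fun h => hx (b.equivFun.symm.map_eq_zero_iff.1 h)
    have := hp _ hne
    rw [LinearMap.BilinForm.apply_eq_dotProduct_toMatrix_mulVec b] at this
    have hx' : ⇑(b.repr (b.equivFun.symm x)) = x := by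
      rw [← Module.Basis.equivFun_apply, LinearEquiv.apply_symm_apply]
    rw [hx'] at this
    simpa using this

/-- The contraction of a form `Q(v, w) = H(A v, A w)`, with `H` a scalar product, is
nonnegative. -/
theorem contraction_nonneg (b : Module.Basis (Fin n) ℝ T) (G Q : LinearMap.BilinForm ℝ T)
    (hs : ∀ v w, G v w = G w v) (hp : ∀ v, v ≠ 0 → 0 < G v v) (hQ : ∀ v, 0 ≤ Q v v) :
    0 ≤ contraction b G Q := by
  have hK := (posDef_toMatrix b G hs hp).inv.posSemidef
  obtain ⟨m, R, hR⟩ := Matrix.posSemidef_iff_eq_sum_vecMulVec.1 hK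
  have : contraction b G Q = ∑ k, Q (∑ a, R k a • b a) (∑ c, R k c • b c) := by
    have hk : ∀ k, Q (∑ a, R k a • b a) (∑ c, R k c • b c) =
        ∑ a, ∑ c, R k a * R k c * Q (b a) (b c) := by
      intro k
      simp only [map_sum, LinearMap.sum_apply, map_smul, LinearMap.smul_apply, smul_eq_mul,
        Finset.mul_sum]
      rw [Finset.sum_comm]
      exact Finset.sum_congr rfl fun a _ => Finset.sum_congr rfl fun c _ => by ring
    simp only [hk, contraction, hR, Matrix.sum_apply, Matrix.vecMulVec_apply, star_trivial,
      Finset.sum_mul]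
    rw [Finset.sum_comm (s := (Finset.univ : Finset (Fin m)))]
    refine Finset.sum_congr rfl fun a _ => ?_
    rw [Finset.sum_comm]
  rw [this]
  exact Finset.sum_nonneg fun k _ => hQ _

theorem contraction_symm (b : Module.Basis (Fin n) ℝ T) (G Q Q' : LinearMap.BilinForm ℝ T)
    (hs : ∀ v w, G v w = G w v) (hQ : ∀ v w, Q v w = Q' w v) :
    contraction b G Q = contraction b G Q' := by
  have hG : (LinearMap.BilinForm.toMatrix b G).transpose = LinearMap.BilinForm.toMatrix b G := by
    ext i j
    simp [LinearMap.BilinForm.toMatrix_apply, hs (b i) (b j)]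
  have hGi : ∀ a c, (LinearMap.BilinForm.toMatrix b G)⁻¹ a c =
      (LinearMap.BilinForm.toMatrix b G)⁻¹ c a := by
    intro a c
    have := congrFun (congrFun (Matrix.transpose_nonsing_inv (LinearMap.BilinForm.toMatrix b G)) c) a
    rw [hG] at this
    exact this
  simp only [contraction]
  rw [Finset.sum_comm]
  refine Finset.sum_congr rfl fun c _ => Finset.sum_congr rfl fun a _ => ?_
  rw [hGi a c, hQ]

end Contraction

section Gradient

variable {n : ℕ} {N : Type u} [TopologicalSpace N] [ChartedSpace (Euc n) N]
  {V : Type v} [NormedAddCommGroup V] [NormedSpace ℝ V]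

theorem injective_mfderiv_val (U : Opens N) (x : U) :
    Function.Injective (mfderiv (𝓡 n) (𝓡 n) (Subtype.val : U → N) x) := by
  have hid : HasMFDerivAt (𝓡 n) (𝓡 n) (Subtype.val : U → N) x
      (ContinuousLinearMap.id ℝ (Euc n)) := by
    refine ⟨continuous_subtype_val.continuousAt, ?_⟩
    have h := Opens.chartAt_subtype_val_symm_eventuallyEq (H := Euc n) U (x := x)
    have ho : (chartAt (Euc n) x.1).target ∈ 𝓝 (chartAt (Euc n) x.1 x.1) :=
      (chartAt (Euc n) x.1).open_target.mem_nhds (mem_chart_target _ _)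
    have hf : (writtenInExtChartAt (𝓡 n) (𝓡 n) x (Subtype.val : U → N))
        =ᶠ[𝓝 (chartAt (Euc n) x.1 x.1)] id := by
      filter_upwards [h, ho] with y hy hyt
      have := (chartAt (Euc n) x.1).right_inv hyt
      simp only [writtenInExtChartAt, extChartAt, OpenPartialHomeomorph.extend, Function.comp, id,
        mfld_simps] at hy ⊢
      exact (congrArg _ hy.symm).trans this
    exact ((hasFDerivAt_id _).congr_of_eventuallyEq hf).hasFDerivWithinAt
  rw [hid.mfderiv]
  exact fun a b h => h

variable [IsManifold (𝓡 n) ∞ N]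

/-- The metric of `N`, restricted to the open subset `U`, on the tangent space of `U` at `x`. -/
def tangentForm (g : ManifoldMetric n N) {U : Opens N} (x : U) :
    LinearMap.BilinForm ℝ (TangentSpace (𝓡 n) x) :=
  LinearMap.mk₂ ℝ (fun v w => g.inner x.1
      (mfderiv (𝓡 n) (𝓡 n) (Subtype.val : U → N) x v)
      (mfderiv (𝓡 n) (𝓡 n) (Subtype.val : U → N) x w))
    (by intros; simp) (by intros; simp) (by intros; simp) (by intros; simp)

theorem tangentForm_symm (g : ManifoldMetric n N) {U : Opens N} (x : U)
    (v w : TangentSpace (𝓡 n) x) : tangentForm g x v w = tangentForm g x w v :=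
  g.symm x.1 _ _

theorem tangentForm_pos (g : ManifoldMetric n N) {U : Opens N} (x : U)
    (v : TangentSpace (𝓡 n) x) (hv : v ≠ 0) : 0 < tangentForm g x v v :=
  g.pos x.1 _ fun h => hv (injective_mfderiv_val U x (by rw [h, map_zero]))

/-- A riemannian metric on a vector bundle over `U`. -/
abbrev VectBundle.Metric {U : Opens N} (E : VectBundle n V U) : Type _ :=
  ContMDiffRiemannianMetric (𝓡 n) ∞ V E.Fib

/-- The form `(X, Y) ↦ ⟨A X, B Y⟩` on the tangent space, for `A`, `B : T_x U → E_x`. -/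
def homForm {U : Opens N} {E : VectBundle n V U} (m : E.Metric) (x : U)
    (A B : TangentSpace (𝓡 n) x →L[ℝ] E.Fib x) : LinearMap.BilinForm ℝ (TangentSpace (𝓡 n) x) :=
  LinearMap.mk₂ ℝ (fun v w => m.inner x (A v) (B w))
    (by intros; simp) (by intros; simp) (by intros; simp) (by intros; simp)

/-- The basis of the tangent space of `U` at `y` given by the chart at `x`. -/
def chartBasis {U : Opens N} (x y : U)
    (h : y ∈ (trivializationAt (Euc n) (fun x : U => TangentSpace (𝓡 n) x) x).baseSet) :
    Module.Basis (Fin n) ℝ (TangentSpace (𝓡 n) y) :=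
  (trivializationAt (Euc n) (fun x : U => TangentSpace (𝓡 n) x) x).basisAt
    (EuclideanSpace.basisFun (Fin n) ℝ).toBasis h

/-- The scalar product `⟨A, B⟩ = ∑ g^{ab} ⟨A ∂_a, B ∂_b⟩` of linear maps `A, B : T_x U → E_x`,
computed in the coordinates of the chart at `x` (it does not depend on the basis). -/
def homInner (g : ManifoldMetric n N) {U : Opens N} {E : VectBundle n V U} (m : E.Metric) (x : U)
    (A B : TangentSpace (𝓡 n) x →L[ℝ] E.Fib x) : ℝ :=
  contraction (chartBasis x x (mem_baseSet_trivializationAt _ _ x)) (tangentForm g x)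
    (homForm m x A B)

theorem homInner_add (g : ManifoldMetric n N) {U : Opens N} {E : VectBundle n V U} (m : E.Metric)
    (x : U) (A A' B : TangentSpace (𝓡 n) x →L[ℝ] E.Fib x) :
    homInner g m x (A + A') B = homInner g m x A B + homInner g m x A' B := by
  simp only [homInner, contraction, ← Finset.sum_add_distrib, ← mul_add]
  refine Finset.sum_congr rfl fun a _ => Finset.sum_congr rfl fun b _ => ?_
  congr 1
  simp only [homForm, LinearMap.mk₂_apply, add_apply, map_add]

theorem homInner_smul (g : ManifoldMetric n N) {U : Opens N} {E : VectBundle n V U} (m : E.Metric)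
    (x : U) (r : ℝ) (A B : TangentSpace (𝓡 n) x →L[ℝ] E.Fib x) :
    homInner g m x (r • A) B = r * homInner g m x A B := by
  simp only [homInner, contraction, Finset.mul_sum]
  refine Finset.sum_congr rfl fun a _ => Finset.sum_congr rfl fun b _ => ?_
  rw [mul_left_comm]
  congr 1
  simp only [homForm, LinearMap.mk₂_apply, smul_apply, map_smul, smul_eq_mul]

theorem continuous_homInner (g : ManifoldMetric n N) {U : Opens N} {E : VectBundle n V U}
    (m : E.Metric) (A B : ∀ x : U, TangentSpace (𝓡 n) x →L[ℝ] E.Fib x)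
    (hA : ContMDiff (𝓡 n) ((𝓡 n).prod 𝓘(ℝ, Euc n →L[ℝ] V)) ∞ (fun x =>
      (⟨x, A x⟩ : TotalSpace (Euc n →L[ℝ] V) fun x : U => TangentSpace (𝓡 n) x →L[ℝ] E.Fib x)))
    (hB : ContMDiff (𝓡 n) ((𝓡 n).prod 𝓘(ℝ, Euc n →L[ℝ] V)) ∞ (fun x =>
      (⟨x, B x⟩ : TotalSpace (Euc n →L[ℝ] V) fun x : U => TangentSpace (𝓡 n) x →L[ℝ] E.Fib x))) :
    Continuous fun x => homInner g m x (A x) (B x) := by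
  rw [continuous_iff_continuousAt]
  intro x₀
  set e := trivializationAt (Euc n) (fun x : U => TangentSpace (𝓡 n) x) x₀ with he
  have hopen : IsOpen e.baseSet := e.open_baseSet
  have hx₀ : x₀ ∈ e.baseSet := mem_baseSet_trivializationAt _ _ x₀
  set X : Fin n → ∀ x : U, TangentSpace (𝓡 n) x := fun a x =>
    e.localFrame (EuclideanSpace.basisFun (Fin n) ℝ).toBasis a x with hX
  have hXs : ∀ a, ContMDiffOn (𝓡 n) ((𝓡 n).prod (𝓡 n)) ∞
      (fun x : U => TotalSpace.mk' (Euc n) (E := fun x : U => TangentSpace (𝓡 n) x) x (X a x))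
      e.baseSet := fun a =>
    e.contMDiffOn_localFrame_baseSet (I := 𝓡 n) ∞ (EuclideanSpace.basisFun (Fin n) ℝ).toBasis a
  have hXb : ∀ x (hx : x ∈ e.baseSet) a, X a x = chartBasis x₀ x hx a := fun x hx a =>
    e.localFrame_apply_of_mem_baseSet _ hx
  have hYs : ∀ a, ContMDiffOn (𝓡 n) ((𝓡 n).prod (𝓡 n)) ∞
      (fun x : U => TotalSpace.mk' (Euc n) (E := fun x : N => TangentSpace (𝓡 n) x) x.1
        (mfderiv (𝓡 n) (𝓡 n) (Subtype.val : U → N) x (X a x))) e.baseSet := by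
    intro a
    have h1 : ContMDiff (𝓡 n).tangent (𝓡 n).tangent ∞
        (tangentMap (𝓡 n) (𝓡 n) (Subtype.val : U → N)) :=
      (contMDiff_subtype_val (n := ∞)).contMDiff_tangentMap (by simp)
    exact h1.comp_contMDiffOn (hXs a)
  have hG : ∀ a b, ContinuousOn (fun x => tangentForm g x (X a x) (X b x)) e.baseSet := by
    intro a b
    have h2 : ContMDiffOn (𝓡 n) ((𝓡 n).prod 𝓘(ℝ, ℝ)) ∞
        (fun x : U => TotalSpace.mk' ℝ (E := Bundle.Trivial N ℝ) x.1
          (tangentForm g x (X a x) (X b x))) e.baseSet :=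
      ContMDiffOn.clm_bundle_apply₂ (F₁ := Euc n) (F₂ := Euc n)
        ((g.contMDiff.comp contMDiff_subtype_val).contMDiffOn) (hYs a) (hYs b)
    intro x hx
    have h3 := h2 x hx
    rw [contMDiffWithinAt_totalSpace] at h3
    exact h3.2.continuousWithinAt
  have hQ : ∀ a b, ContinuousOn (fun x => homForm m x (A x) (B x) (X a x) (X b x)) e.baseSet := by
    intro a b
    have hAX := ContMDiffOn.clm_bundle_apply (hA.contMDiffOn (s := e.baseSet)) (hXs a)
    have hBX := ContMDiffOn.clm_bundle_apply (hB.contMDiffOn (s := e.baseSet)) (hXs b)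
    have h2 : ContMDiffOn (𝓡 n) ((𝓡 n).prod 𝓘(ℝ, ℝ)) ∞
        (fun x : U => TotalSpace.mk' ℝ (E := Bundle.Trivial U ℝ) x
          (homForm m x (A x) (B x) (X a x) (X b x))) e.baseSet :=
      ContMDiffOn.clm_bundle_apply₂ (F₁ := V) (F₂ := V) m.contMDiff.contMDiffOn hAX hBX
    intro x hx
    have h3 := h2 x hx
    rw [contMDiffWithinAt_totalSpace] at h3
    exact h3.2.continuousWithinAt
  set G : U → Matrix (Fin n) (Fin n) ℝ := fun x =>
    Matrix.of fun a b => tangentForm g x (X a x) (X b x) with hGdef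
  have hGe : ∀ x (hx : x ∈ e.baseSet),
      LinearMap.BilinForm.toMatrix (chartBasis x₀ x hx) (tangentForm g x) = G x := by
    intro x hx
    ext a b
    simp [LinearMap.BilinForm.toMatrix_apply, hGdef, hXb x hx]
  have hGc : ContinuousAt G x₀ := by
    have : ContinuousWithinAt G e.baseSet x₀ :=
      continuousWithinAt_pi.2 fun a => continuousWithinAt_pi.2 fun b => hG a b x₀ hx₀
    exact this.continuousAt (hopen.mem_nhds hx₀)
  have hdet : IsUnit (G x₀).det := by
    rw [← hGe x₀ hx₀]
    exact (posDef_toMatrix _ _ (tangentForm_symm g x₀) (tangentForm_pos g x₀)).isUnit.map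
      Matrix.detMonoidHom
  have hGi : ContinuousAt (fun x => (G x)⁻¹) x₀ := by
    have h1 : ContinuousAt (fun x => (G x).det) x₀ :=
      (Continuous.matrix_det continuous_id).continuousAt.comp hGc
    have h2 : ContinuousAt (fun x => (G x).adjugate) x₀ :=
      (Continuous.matrix_adjugate continuous_id).continuousAt.comp hGc
    have h3 : ContinuousAt (fun x => ((G x).det)⁻¹ • (G x).adjugate) x₀ :=
      (h1.inv₀ hdet.ne_zero).smul h2
    simpa only [Matrix.inv_def, Ring.inverse_eq_inv'] using h3
  have hmain : ContinuousAt (fun x => ∑ a, ∑ b, (G x)⁻¹ a b *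
      homForm m x (A x) (B x) (X a x) (X b x)) x₀ := by
    refine tendsto_finsetSum _ fun a _ => tendsto_finsetSum _ fun b _ => ?_
    exact ((continuousAt_pi.1 (continuousAt_pi.1 hGi a) b)).mul
      ((hQ a b).continuousAt (hopen.mem_nhds hx₀))
  refine hmain.congr ?_
  filter_upwards [hopen.mem_nhds hx₀] with x hx
  rw [homInner, contraction_basis_indep (chartBasis x₀ x hx), contraction, hGe x hx]
  simp only [hXb x hx]

/-- `w = Δ u`, for the (nonnegative) connection laplacian `Δ = ∇*∇`, where `∇*` is the formal
adjoint of `∇`: `∫ ⟨w, t⟩ = ∫ ⟨∇u, ∇t⟩` for all smooth sections `t` over `U` with compact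
support. -/
def IsLaplacian [MeasurableSpace N] [T2Space N] [SigmaCompactSpace N] (g : ManifoldMetric n N)
    {U : Opens N} {E : VectBundle n V U} (m : E.Metric) (D : CovariantDerivative (𝓡 n) V E.Fib)
    (u w : E.Sec) : Prop :=
  ∀ t : E.Sec, IsCompact (closure {x : U | t x ≠ 0}) →
    ∫ x : U, m.inner x (w x) (t x) ∂((riemannianVolume g).comap Subtype.val) =
      ∫ x : U, homInner g m x (D u x) (D t x) ∂((riemannianVolume g).comap Subtype.val)

end Gradient

/-! ### The Sobolev spaces of global sections -/

section Sobolev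

set_option linter.unusedSectionVars false

variable {n : ℕ} {N : Type u} [TopologicalSpace N] [T2Space N] [CompactSpace N]
  [ChartedSpace (Euc n) N] [IsManifold (𝓡 n) ∞ N] [MeasurableSpace N] [BorelSpace N]
  {V : Type v} [NormedAddCommGroup V] [NormedSpace ℝ V]
  {C : VectorialGerbe.{u, v, w} n N V}

open scoped Classical in
/-- Extension by zero of a function on the open subset `U`. -/
def extendZero (U : Opens N) (q : U → ℝ) (x : N) : ℝ :=
  if h : x ∈ U then q ⟨x, h⟩ else 0

/-- The integral `∑ᵢ ∫ fᵢ qᵢ` over `N` of functions `qᵢ` on `Uᵢ`. -/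
def glueIntegral (g : ManifoldMetric n N) {c : CechChain C} (f : Partition c)
    (q : ∀ i, c.U i → ℝ) : ℝ :=
  ∫ x, ∑ᶠ i, f.1 i x • extendZero (c.U i) (q i) x ∂(riemannianVolume g)

theorem continuous_glue {c : CechChain C} (f : Partition c) {q : ∀ i, c.U i → ℝ}
    (hq : ∀ i, Continuous (q i)) :
    Continuous fun x => ∑ᶠ i, f.1 i x • extendZero (c.U i) (q i) x := by
  refine PartitionOfUnity.IsSubordinate.continuous_finsum_smul
    (f := f.1.toPartitionOfUnity) (U := fun i => (c.U i : Set N))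
    (fun i => (c.U i).isOpen) (f.1.isSubordinate_toPartitionOfUnity.2 f.2) fun i => ?_
  rw [continuousOn_iff_continuous_domRestrict]
  refine (hq i).congr fun x => ?_
  have hx : (x : N) ∈ c.U i := x.2
  simp [extendZero, hx]

theorem finite_support_glue {c : CechChain C} (f : Partition c) (q : ∀ i, c.U i → ℝ) (x : N) :
    (Function.support fun i => f.1 i x • extendZero (c.U i) (q i) x).Finite :=
  (f.1.locallyFinite.point_finite x).subset fun i hi => by
    intro h
    exact hi (by simp [show f.1 i x = 0 from h])

theorem glueIntegral_add (g : ManifoldMetric n N) {c : CechChain C} (f : Partition c)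
    {q q' : ∀ i, c.U i → ℝ} (hq : ∀ i, Continuous (q i)) (hq' : ∀ i, Continuous (q' i)) :
    glueIntegral g f (fun i x => q i x + q' i x) = glueIntegral g f q + glueIntegral g f q' := by
  have hi : ∀ {q : ∀ i, c.U i → ℝ}, (∀ i, Continuous (q i)) →
      Integrable (fun x => ∑ᶠ i, f.1 i x • extendZero (c.U i) (q i) x) (riemannianVolume g) :=
    fun hq => (continuous_glue f hq).integrable_of_hasCompactSupport
      (HasCompactSupport.of_compactSpace _)
  rw [glueIntegral, glueIntegral, glueIntegral, ← integral_add (hi hq) (hi hq')]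
  congr 1
  ext x
  rw [← finsum_add_distrib (finite_support_glue f q x) (finite_support_glue f q' x)]
  congr 1
  ext i
  by_cases h : x ∈ c.U i <;> simp [extendZero, h, mul_add]

theorem glueIntegral_smul (g : ManifoldMetric n N) {c : CechChain C} (f : Partition c)
    (r : ℝ) (q : ∀ i, c.U i → ℝ) :
    glueIntegral g f (fun i x => r * q i x) = r * glueIntegral g f q := by
  rw [glueIntegral, glueIntegral, ← integral_const_mul]
  congr 1
  ext x
  rw [← smul_eq_mul, smul_finsum]
  congr 1
  ext i
  by_cases h : x ∈ c.U i <;> simp [extendZero, h]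
  ring

theorem glueIntegral_mono (g : ManifoldMetric n N) {c : CechChain C} (f : Partition c)
    {q : ∀ i, c.U i → ℝ} (hq : ∀ i x, 0 ≤ q i x) : 0 ≤ glueIntegral g f q := by
  refine integral_nonneg fun x => finsum_nonneg fun i => mul_nonneg (f.1.nonneg i x) ?_
  by_cases h : x ∈ c.U i
  · simpa [extendZero, h] using hq i _
  · simp [extendZero, h]

theorem continuous_metric {U : Opens N} {E : VectBundle n V U} (m : E.Metric) (s t : E.Sec) :
    Continuous fun x => m.inner x (s x) (t x) := by
  have h2 : ContMDiff (𝓡 n) ((𝓡 n).prod 𝓘(ℝ, ℝ)) ∞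
      (fun x : U => TotalSpace.mk' ℝ (E := Bundle.Trivial U ℝ) x (m.inner x (s x) (t x))) :=
    ContMDiff.clm_bundle_apply₂ (F₁ := V) (F₂ := V) m.contMDiff s.contMDiff t.contMDiff
  rw [continuous_iff_continuousAt]
  intro x
  have h3 := h2 x
  rw [contMDiffAt_totalSpace] at h3
  exact h3.2.continuousAt

theorem continuous_gradient (g : ManifoldMetric n N) {U : Opens N} {E : VectBundle n V U}
    (m : E.Metric) (D : CovariantDerivative (𝓡 n) V E.Fib)
    (hD : CovariantDerivative.ContMDiffCovariantDerivative D ∞) (s t : E.Sec) :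
    Continuous fun x => homInner g m x (D s x) (D t x) := by
  have h : ∀ s : E.Sec, ContMDiff (𝓡 n) ((𝓡 n).prod 𝓘(ℝ, Euc n →L[ℝ] V)) ∞ (fun x =>
      (⟨x, D s x⟩ :
        TotalSpace (Euc n →L[ℝ] V) fun x : U => TangentSpace (𝓡 n) x →L[ℝ] E.Fib x)) :=
    fun s => contMDiffOn_univ.1 (hD.contMDiff.contMDiff s.contMDiff.contMDiffOn)
  exact continuous_homInner g m _ _ (h s) (h t)

variable (g : ManifoldMetric n N) (R : RiemannianStructure C) (c : CechChain C) (f : Partition c)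

/-- The scalar product `⟨s, t⟩ = ∑ᵢ ∫ fᵢ ⟨sᵢ, tᵢ⟩` of global sections. -/
@[reducible] def l2Core : PreInnerProductSpace.Core ℝ (globalSections c) where
  inner s t := glueIntegral g f fun i x => (R.metric (c.e i)).inner x (s.1 i x) (t.1 i x)
  conj_inner_symm s t := by
    simp only [conj_trivial]
    congr 1
    ext i x
    exact (R.metric (c.e i)).symm x _ _
  re_inner_nonneg s := by
    refine glueIntegral_mono g f fun i x => ?_
    by_cases h : s.1 i x = 0
    · simp [h]
    · exact ((R.metric (c.e i)).pos x _ h).le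
  add_left s t r := by
    rw [← glueIntegral_add g f (fun i => continuous_metric _ _ _)
      (fun i => continuous_metric _ _ _)]
    congr 1
    ext i x
    change (R.metric (c.e i)).inner x (s.1 i x + t.1 i x) (r.1 i x) = _
    rw [map_add]
    rfl
  smul_left s t r := by
    rw [conj_trivial, ← glueIntegral_smul]
    congr 1
    ext i x
    change (R.metric (c.e i)).inner x (r • s.1 i x) (t.1 i x) = _
    rw [map_smul]
    rfl

/-- The scalar product `∑ᵢ ∫ fᵢ (⟨sᵢ, tᵢ⟩ + ⟨∇sᵢ, ∇tᵢ⟩)` of global sections. -/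
@[reducible] def dirichletCore : PreInnerProductSpace.Core ℝ (globalSections c) where
  inner s t := (l2Core g R c f).inner s t +
    glueIntegral g f fun i x => homInner g (R.metric (c.e i)) x
      (R.conn (c.e i) (s.1 i) x) (R.conn (c.e i) (t.1 i) x)
  conj_inner_symm s t := by
    have h := (l2Core g R c f).conj_inner_symm s t
    simp only [conj_trivial] at h ⊢
    rw [h]
    congr 2
    ext i x
    exact contraction_symm _ _ _ _ (tangentForm_symm g x) fun v w =>
      (R.metric (c.e i)).symm x _ _
  re_inner_nonneg s := by
    refine add_nonneg ((l2Core g R c f).re_inner_nonneg s) (glueIntegral_mono g f fun i x => ?_)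
    refine contraction_nonneg _ _ _ (tangentForm_symm g x) (tangentForm_pos g x) fun v => ?_
    change 0 ≤ (R.metric (c.e i)).inner x (R.conn (c.e i) (s.1 i) x v)
      (R.conn (c.e i) (s.1 i) x v)
    by_cases h : R.conn (c.e i) (s.1 i) x v = 0
    · simp [h]
    · exact ((R.metric (c.e i)).pos x _ h).le
  add_left s t r := by
    rw [(l2Core g R c f).add_left]
    have : glueIntegral g f (fun i x => homInner g (R.metric (c.e i)) x
        (R.conn (c.e i) ((s + t).1 i) x) (R.conn (c.e i) (r.1 i) x)) =
      glueIntegral g f (fun i x => homInner g (R.metric (c.e i)) x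
        (R.conn (c.e i) (s.1 i) x) (R.conn (c.e i) (r.1 i) x)) +
      glueIntegral g f (fun i x => homInner g (R.metric (c.e i)) x
        (R.conn (c.e i) (t.1 i) x) (R.conn (c.e i) (r.1 i) x)) := by
      rw [← glueIntegral_add g f
        (fun i => continuous_gradient g _ _ (R.conn_smooth (c.e i)) _ _)
        (fun i => continuous_gradient g _ _ (R.conn_smooth (c.e i)) _ _)]
      congr 1
      ext i x
      have h : R.conn (c.e i) ((s + t).1 i) x =
          R.conn (c.e i) (s.1 i) x + R.conn (c.e i) (t.1 i) x :=
        (R.conn (c.e i)).isCovariantDerivativeOnUniv.add (s.1 i).mdifferentiableAt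
          (t.1 i).mdifferentiableAt
      rw [h]
      exact homInner_add g _ x _ _ _
    rw [this]
    ring
  smul_left s t r := by
    rw [(l2Core g R c f).smul_left]
    have : glueIntegral g f (fun i x => homInner g (R.metric (c.e i)) x
        (R.conn (c.e i) ((r • s).1 i) x) (R.conn (c.e i) (t.1 i) x)) =
      r * glueIntegral g f (fun i x => homInner g (R.metric (c.e i)) x
        (R.conn (c.e i) (s.1 i) x) (R.conn (c.e i) (t.1 i) x)) := by
      rw [← glueIntegral_smul]
      congr 1
      ext i x
      have h : R.conn (c.e i) ((r • s).1 i) x = r • R.conn (c.e i) (s.1 i) x :=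
        (R.conn (c.e i)).isCovariantDerivativeOnUniv.smul_const r (s.1 i).mdifferentiableAt
      rw [h]
      exact homInner_smul g _ x _ _ _
    rw [this, conj_trivial]
    ring

theorem l2_le_dirichlet (s : globalSections c) :
    (l2Core g R c f).inner s s ≤ (dirichletCore g R c f).inner s s := by
  refine le_add_of_nonneg_right (glueIntegral_mono g f fun i x => ?_)
  refine contraction_nonneg _ _ _ (tangentForm_symm g x) (tangentForm_pos g x) fun v => ?_
  change 0 ≤ (R.metric (c.e i)).inner x (R.conn (c.e i) (s.1 i) x v)
    (R.conn (c.e i) (s.1 i) x v)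
  by_cases h : R.conn (c.e i) (s.1 i) x v = 0
  · simp [h]
  · exact ((R.metric (c.e i)).pos x _ h).le

/-- The Hilbert space `L²(S(g_ij))`. -/
abbrev L2Sections : Type _ := HilbertCompletion (l2Core g R c f)

open scoped Classical in
/-- The laplacian of global sections: the linear map `Δ` of `S(g_ij)` with `(Δ u)ᵢ = Δ uᵢ` (it is
unique, and it exists if the arrows of the gerbe commute with the laplacians of the objects). -/
def laplacian : globalSections c →ₗ[ℝ] globalSections c :=
  if h : ∃ L : globalSections c →ₗ[ℝ] globalSections c, ∀ u i,
      IsLaplacian g (R.metric (c.e i)) (R.conn (c.e i)) (u.1 i) ((L u).1 i) then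
    h.choose
  else 0

/-- The bounded operator `(1 + Δ)⁻¹` of `L²(S(g_ij))`: `⟨(1 + Δ)⁻¹ v, u⟩₁ = ⟨v, u⟩` for all
`u ∈ S(g_ij)`, where `⟨ , ⟩₁` is the scalar product `∫ ⟨s, t⟩ + ⟨∇s, ∇t⟩ = ∫ ⟨(1 + Δ) s, t⟩`.
It is `J J*` for the canonical map `J` from the completion for `⟨ , ⟩₁` to `L²(S(g_ij))`. -/
def resolvent : L2Sections g R c f →L[ℝ] L2Sections g R c f :=
  (completionMap _ _ (l2_le_dirichlet g R c f)) ∘L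
    (completionMap _ _ (l2_le_dirichlet g R c f)).adjoint

/-- The operator `(1 + Δ)^{s/2} : S(g_ij) → L²(S(g_ij))` for a real number `s`, as the composition
of the differential operator `(1 + Δ)^k`, for the least natural number `k ≥ s/2`, with the bounded
operator `(1 + Δ)^{-(k - s/2)}`. -/
def besselPotential (s : ℝ) : globalSections c →ₗ[ℝ] L2Sections g R c f :=
  (realPower (resolvent g R c f) (⌈s / 2⌉₊ - s / 2)).toLinearMap ∘ₗ toHilbert (l2Core g R c f) ∘ₗ
    ((1 + laplacian g R c) ^ ⌈s / 2⌉₊ : globalSections c →ₗ[ℝ] globalSections c)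

/-- The scalar product of order `s`,
`⟨u, v⟩_s = ∫ ⟨(1 + Δ)^s u, v⟩ = ∫ ⟨(1 + Δ)^{s/2} u, (1 + Δ)^{s/2} v⟩`. -/
abbrev sobolevCore (s : ℝ) : PreInnerProductSpace.Core ℝ (globalSections c) :=
  inducedCore (besselPotential g R c f s)

/-- The Sobolev space `H_s(S(g_ij))`: the Hilbert completion of `S(g_ij)` for the scalar product
of order `s`. -/
abbrev SobolevSections (s : ℝ) : Type _ := HilbertCompletion (sobolevCore g R c f s)

end Sobolev

/-- The arrows of the gerbe commute with the laplacians of the objects. -/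
def ArrowsCommuteWithLaplacian {n : ℕ} {N : Type u} [TopologicalSpace N] [T2Space N]
    [CompactSpace N] [ChartedSpace (Euc n) N] [IsManifold (𝓡 n) ∞ N] [MeasurableSpace N]
    {V : Type v} [NormedAddCommGroup V] [NormedSpace ℝ V] {C : VectorialGerbe.{u, v, w} n N V}
    (g : ManifoldMetric n N) (R : RiemannianStructure C) : Prop :=
  ∀ {U : Opens N} {e e' : C.Obj U}, ∀ φ ∈ C.Hom e e', ∀ u w : (C.bundle e).Sec,
    IsLaplacian g (R.metric e) (R.conn e) u w →
      IsLaplacian g (R.metric e') (R.conn e') (φ.onSec u) (φ.onSec w)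

end GerbeRellich

end

/-! Let J be the map from the completion of S(g_ij) for the Dirichlet form ⟨u, v⟩ + ⟨∇u, ∇v⟩ to L².
The operator B = J J* (`resolvent`) is self-adjoint, satisfies ‖1 - B‖ ≤ 1, and is injective because
J has dense range. The theorem follows from two further facts: B is compact, and B (1 + Δ) u = u for
u in S(g_ij).

Given these, the rest is operator theory (`exists_compact_inclusion`). For r ≥ 0 the binomial
coefficients of r are absolutely summable, so the series for Bʳ converges although B is not
invertible in general, and Vandermonde's identity gives Bʳ Bᵖ = Bʳ⁺ᵖ. No spectral theorem is needed:
Bʳ is injective because a complementary power multiplies it to some B^m, and it is compact because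
(Bʳ)^(2^k) is compact for large k while a self-adjoint operator with compact square is compact. The
maps (1 + Δ)^(s/2) extend to isometries from H_s to L², and these turn the inclusion of H_s in H_t
into B^((s-t)/2), which is compact and injective.

The identity B (1 + Δ) u = u is the weak equation ⟨Δu, v⟩ = ⟨∇u, ∇v⟩ for global sections
(`l2Core_inner_laplacian`). A section of an object has a smooth laplacian, constructed locally by
integration by parts in a chart and unique by the fundamental lemma of the calculus of variations;
uniqueness and the commutation with arrows glue the laplacians of the components. Testing with fᵢ vᵢ
leaves the error ∑ᵢ ⟨∇uᵢ, dfᵢ ⊗ vᵢ⟩. The arrows are not assumed to preserve the connections, but an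
isometric arrow which commutes with Δ also respects the commutator [Δ, η] for every function η,
hence the expression ⟨∇u, dη ⊗ v⟩ (`homInner_smulRight_onSec`). So the error can be computed in a
single object, where it is ⟨∇u, d(∑ fᵢ) ⊗ v⟩ = 0.

The compactness of J, hence of B, is Rellich's lemma, in the form: for each ε the L² form is at most
ε times the Dirichlet form plus finitely many squares of bounded functionals
(`IsSmallModFiniteRank`). On ℝⁿ this is an estimate of the variance on the cubes of a fine grid
(`exists_finset_integral_sq_le`). It passes to N through charts, and to sections by pairing u with
finitely many compactly supported sections s: since the connection is metric, the derivatives of ⟨u,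
s⟩ are controlled by |u|² + |∇u|². -/

noncomputable section

namespace GerbeRellich

set_option linter.unusedSectionVars false

/-! ### Compact operators on Hilbert spaces -/

section CompactOperators

/-- A bounded operator is compact if it is dominated, up to a small multiple of the norm, by
compact operators. -/
theorem isCompactOperator_of_le_add {H : Type*} {K : Type*} [NormedAddCommGroup H]
    [NormedSpace ℝ H] [NormedAddCommGroup K] [NormedSpace ℝ K] [CompleteSpace K]
    (T : H →L[ℝ] K)
    (h : ∀ ε : ℝ, 0 < ε → ∃ (G : Type w) (_ : NormedAddCommGroup G) (_ : NormedSpace ℝ G)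
      (S : H →L[ℝ] G), IsCompactOperator S ∧ ∀ x, ‖T x‖ ≤ ε * ‖x‖ + ‖S x‖) :
    IsCompactOperator T := by
  refine (isCompactOperator_iff_isCompact_closure_image_closedBall (T : H →ₗ[ℝ] K) one_pos).2 ?_
  have htb : TotallyBounded (T '' Metric.closedBall 0 1) := by
    rw [Metric.totallyBounded_iff]
    intro ε hε
    -- Two points of the unit ball are at distance at most 2, so if their images under S are
    -- ε/4-close, then their images under T differ by less than 2 · ε/4 + ε/4 < ε.
    obtain ⟨G, _, _, S, hS, hle⟩ := h (ε / 4) (by positivity)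
    have hSc : TotallyBounded (S '' Metric.closedBall 0 1) :=
      (IsCompactOperator.isCompact_closure_image_closedBall (f := (S : H →ₗ[ℝ] G))
        hS 1).totallyBounded.subset subset_closure
    obtain ⟨t, hts, htf, hcov⟩ := hSc.exists_subset (Metric.dist_mem_uniformity
      (show 0 < ε / 4 by positivity))
    choose! y hy hyt using fun z (hz : z ∈ t) => hts hz
    refine ⟨(fun z => T (y z)) '' t, htf.image _, ?_⟩
    rintro _ ⟨x, hx, rfl⟩
    obtain ⟨z, hz, hxz⟩ := mem_iUnion₂.1 (hcov ⟨x, hx, rfl⟩)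
    refine mem_iUnion₂.2 ⟨_, ⟨z, hz, rfl⟩, ?_⟩
    rw [Metric.mem_ball, dist_eq_norm, ← map_sub]
    have h1 := hle (x - y z)
    have h2 : ‖x - y z‖ ≤ 2 := by
      have := norm_sub_le x (y z)
      have hx' := mem_closedBall_zero_iff.1 hx
      have hy' := mem_closedBall_zero_iff.1 (hy z hz)
      linarith
    have h3 : ‖S (x - y z)‖ < ε / 4 := by
      rw [map_sub, ← dist_eq_norm, hyt z hz]
      exact hxz
    nlinarith
  exact htb.closure.isCompact_of_isClosed isClosed_closure

variable {H : Type w} [NormedAddCommGroup H] [InnerProductSpace ℝ H] [CompleteSpace H]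

/-- From ‖T x‖² = ⟨T* T x, x⟩ ≤ ‖T* T x‖ ‖x‖ and the inequality of the means, ‖T x‖ ≤ ε ‖x‖ + ε⁻¹
‖T* T x‖; the compact operator that dominates T up to ε is ε⁻¹ T* T. -/
theorem isCompactOperator_of_adjoint_comp_self {K : Type*} [NormedAddCommGroup K]
    [InnerProductSpace ℝ K] [CompleteSpace K] (T : H →L[ℝ] K)
    (h : IsCompactOperator (T.adjoint ∘L T)) : IsCompactOperator T := by
  refine isCompactOperator_of_le_add T fun ε hε =>
    ⟨H, inferInstance, inferInstance, ε⁻¹ • (T.adjoint ∘L T), h.smul ε⁻¹, fun x => ?_⟩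
  have h1 : ‖T x‖ ^ 2 ≤ ‖(T.adjoint ∘L T) x‖ * ‖x‖ := by
    rw [← real_inner_self_eq_norm_sq, ← T.adjoint_inner_left]
    exact real_inner_le_norm _ _
  have h2 : ‖(ε⁻¹ • (T.adjoint ∘L T)) x‖ = ε⁻¹ * ‖(T.adjoint ∘L T) x‖ := by
    rw [smul_apply, norm_smul, Real.norm_of_nonneg (by positivity)]
  rw [h2]
  set a := ‖x‖
  set b := ‖(T.adjoint ∘L T) x‖
  have ha : 0 ≤ a := norm_nonneg _
  have hb : 0 ≤ b := norm_nonneg _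
  refine abs_le_of_sq_le_sq' ?_ (by positivity) |>.2
  have : (ε * a + ε⁻¹ * b) ^ 2 = (ε * a) ^ 2 + 2 * (b * a) * (ε * ε⁻¹) + (ε⁻¹ * b) ^ 2 := by ring
  rw [this, mul_inv_cancel₀ hε.ne']
  nlinarith [sq_nonneg (ε * a), sq_nonneg (ε⁻¹ * b), mul_nonneg hb ha]

/-- For self-adjoint T, the power T^(2^(k+1)) is S* S with S = T^(2^k), so compactness descends as
the exponent is halved. -/
theorem isCompactOperator_of_isSelfAdjoint_pow (T : H →L[ℝ] H) (hT : IsSelfAdjoint T) (k : ℕ)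
    (h : IsCompactOperator (T ^ 2 ^ k : H →L[ℝ] H)) : IsCompactOperator T := by
  induction k with
  | zero => rwa [pow_zero, pow_one] at h
  | succ k ih =>
    refine ih (isCompactOperator_of_adjoint_comp_self _ ?_)
    have : (T ^ 2 ^ k).adjoint = T ^ 2 ^ k := (hT.pow _).adjoint_eq
    rw [this]
    have h2 : (T ^ 2 ^ k) ∘L (T ^ 2 ^ k) = T ^ 2 ^ (k + 1) := by
      rw [pow_succ 2 k, mul_two, pow_add]
      rfl
    rw [h2]
    exact h

end CompactOperators

/-! ### Real powers of an operator -/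

section RealPower

theorem ring_choose_succ_mul (r : ℝ) (k : ℕ) :
    Ring.choose r (k + 1) * (k + 1) = Ring.choose r k * (r - k) := by
  have h1 := Ring.descPochhammer_eq_factorial_smul_choose r (k + 1)
  have h2 := Ring.descPochhammer_eq_factorial_smul_choose r k
  rw [descPochhammer_succ_right, Polynomial.smeval_mul, h2] at h1
  simp only [Polynomial.smeval_sub, Polynomial.smeval_X, pow_one, Polynomial.smeval_natCast,
    pow_zero, nsmul_eq_mul, mul_one, Nat.factorial_succ, Nat.cast_mul, Nat.cast_add,
    Nat.cast_one] at h1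
  have h3 : (k.factorial : ℝ) ≠ 0 := by positivity
  apply mul_left_cancel₀ h3
  linarith

/-- Write c_k for the binomial coefficient. Once k > r, the recursion (k+1) c_{k+1} = (r-k) c_k
gives r |c_k| = k |c_k| - (k+1) |c_{k+1}|, which telescopes and bounds the partial sums. This is
convergence on the boundary of the disc, which is needed because ‖1 - B‖ may equal 1. -/
theorem summable_abs_ring_choose {r : ℝ} (hr : 0 ≤ r) :
    Summable fun k : ℕ => |Ring.choose r k| := by
  rcases hr.eq_or_lt with rfl | hr
  · refine summable_of_ne_finset_zero (s := {0}) fun k hk => ?_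
    rw [Ring.choose_zero_pos ℝ (Nat.pos_of_ne_zero (by simpa using hk)), abs_zero]
  obtain ⟨m, hm⟩ := exists_nat_gt r
  rw [← summable_nat_add_iff m]
  have hrec : ∀ k : ℕ, r * |Ring.choose r (k + m)| =
      (k + m : ℝ) * |Ring.choose r (k + m)| - (k + m + 1 : ℝ) * |Ring.choose r (k + m + 1)| := by
    intro k
    have h := congrArg abs (ring_choose_succ_mul r (k + m))
    have hk : (0 : ℝ) ≤ k := Nat.cast_nonneg k
    rw [abs_mul, abs_mul, abs_of_nonneg (by positivity : (0 : ℝ) ≤ ((k + m : ℕ) : ℝ) + 1),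
      abs_of_nonpos (by push_cast; linarith : r - ((k + m : ℕ) : ℝ) ≤ 0)] at h
    push_cast at h
    linarith
  set a : ℕ → ℝ := fun k => (k + m : ℝ) * |Ring.choose r (k + m)| with ha
  have hsum : ∀ K : ℕ, r * ∑ k ∈ Finset.range K, |Ring.choose r (k + m)| = a 0 - a K := by
    intro K
    rw [Finset.mul_sum, ← Finset.sum_range_sub' a K]
    refine Finset.sum_congr rfl fun k _ => ?_
    rw [hrec k, ha]
    simp only [Nat.cast_add, Nat.cast_one, add_right_comm]
  refine summable_of_sum_range_le (c := a 0 / r) (fun _ => abs_nonneg _) fun K => ?_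
  rw [le_div_iff₀ hr, mul_comm, hsum]
  have : 0 ≤ a K := by positivity
  linarith

variable {H : Type w} [NormedAddCommGroup H] [InnerProductSpace ℝ H] [CompleteSpace H]
  {B : H →L[ℝ] H}

theorem norm_pow_le_one_of_norm_le_one (hB : ‖1 - B‖ ≤ 1) (k : ℕ) : ‖(1 - B) ^ k‖ ≤ 1 := by
  rcases Nat.eq_zero_or_pos k with rfl | hk
  · rw [pow_zero]
    exact ContinuousLinearMap.norm_id_le
  · exact (norm_pow_le' _ hk).trans (pow_le_one₀ (norm_nonneg _) hB)

theorem summable_norm_realPower (hB : ‖1 - B‖ ≤ 1) {r : ℝ} (hr : 0 ≤ r) :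
    Summable fun k : ℕ => ‖((-1 : ℝ) ^ k * Ring.choose r k) • (1 - B) ^ k‖ := by
  refine (summable_abs_ring_choose hr).of_nonneg_of_le (fun _ => norm_nonneg _) fun k => ?_
  rw [norm_smul, norm_mul, norm_pow, norm_neg, norm_one, one_pow, one_mul, Real.norm_eq_abs]
  exact mul_le_of_le_one_right (abs_nonneg _) (norm_pow_le_one_of_norm_le_one hB k)

theorem realPower_zero (B : H →L[ℝ] H) : realPower B 0 = 1 := by
  rw [realPower, tsum_eq_single 0]
  · simp
  · intro k hk
    rw [Ring.choose_zero_pos ℝ (Nat.pos_of_ne_zero hk), mul_zero, zero_smul]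

theorem realPower_one (B : H →L[ℝ] H) : realPower B 1 = B := by
  rw [realPower, tsum_eq_sum (s := Finset.range 2)]
  · simp [Finset.sum_range_succ]
  · intro k hk
    have h : Ring.choose (1 : ℝ) k = 0 := by
      have := Ring.choose_natCast (R := ℝ) 1 k
      rw [Nat.cast_one] at this
      rw [this, Nat.choose_eq_zero_of_lt (by simpa using hk), Nat.cast_zero]
    rw [h, mul_zero, zero_smul]

/-- The Cauchy product of the two absolutely convergent series, with Vandermonde's identity for the
coefficients. -/
theorem realPower_add (hB : ‖1 - B‖ ≤ 1) {r s : ℝ} (hr : 0 ≤ r) (hs : 0 ≤ s) :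
    realPower B (r + s) = realPower B r * realPower B s := by
  rw [realPower, realPower, realPower, tsum_mul_tsum_eq_tsum_sum_antidiagonal_of_summable_norm
    (summable_norm_realPower hB hr) (summable_norm_realPower hB hs)]
  congr 1
  ext1 k
  rw [Ring.add_choose_eq k (Commute.all r s), Finset.mul_sum, Finset.sum_smul]
  refine Finset.sum_congr rfl fun p hp => ?_
  have hk : p.1 + p.2 = k := Finset.HasAntidiagonal.mem_antidiagonal.1 hp
  rw [smul_mul_smul_comm, ← pow_add, hk]
  congr 1
  rw [← hk, pow_add]
  ring

theorem realPower_natCast (hB : ‖1 - B‖ ≤ 1) (m : ℕ) : realPower B m = B ^ m := by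
  induction m with
  | zero => rw [Nat.cast_zero, realPower_zero, pow_zero]
  | succ m ih =>
    rw [Nat.cast_succ, realPower_add hB (Nat.cast_nonneg m) zero_le_one, ih, realPower_one,
      pow_succ]

theorem realPower_nsmul (hB : ‖1 - B‖ ≤ 1) {r : ℝ} (hr : 0 ≤ r) (m : ℕ) :
    realPower B (m * r) = realPower B r ^ m := by
  induction m with
  | zero => rw [Nat.cast_zero, zero_mul, realPower_zero, pow_zero]
  | succ m ih =>
    rw [Nat.cast_succ, add_mul, one_mul, realPower_add hB (by positivity) hr, ih, pow_succ]

theorem isSelfAdjoint_realPower (hB : ‖1 - B‖ ≤ 1) (hs : IsSelfAdjoint B) {r : ℝ} (hr : 0 ≤ r) :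
    IsSelfAdjoint (realPower B r) := by
  have h := (summable_norm_realPower hB hr).of_norm.hasSum
  have h' := h.star
  refine h'.unique ?_
  have : (fun k : ℕ => star (((-1 : ℝ) ^ k * Ring.choose r k) • (1 - B) ^ k)) =
      fun k : ℕ => ((-1 : ℝ) ^ k * Ring.choose r k) • (1 - B) ^ k := by
    ext1 k
    rw [star_smul, star_trivial, star_pow, star_sub, star_one, hs.star_eq]
  rw [this]
  exact h

/-- If 2^k r ≥ 1, then (Bʳ)^(2^k) = B · B^(2^k r - 1) has the compact factor B; as Bʳ is
self-adjoint, it is itself compact. -/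
theorem isCompactOperator_realPower (hB : ‖1 - B‖ ≤ 1) (hs : IsSelfAdjoint B)
    (hc : IsCompactOperator B) {r : ℝ} (hr : 0 < r) : IsCompactOperator (realPower B r) := by
  obtain ⟨k, hk⟩ : ∃ k : ℕ, 1 ≤ (2 ^ k : ℝ) * r := by
    obtain ⟨k, hk⟩ := pow_unbounded_of_one_lt (1 / r) (one_lt_two (α := ℝ))
    exact ⟨k, by rw [div_lt_iff₀ hr] at hk; exact hk.le⟩
  refine isCompactOperator_of_isSelfAdjoint_pow _ (isSelfAdjoint_realPower hB hs hr.le) k ?_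
  rw [← realPower_nsmul hB hr.le]
  push_cast
  rw [← add_sub_cancel 1 ((2 : ℝ) ^ k * r), realPower_add hB zero_le_one (sub_nonneg.2 hk),
    realPower_one]
  exact hc.comp_clm _

/-- For a natural number m ≥ r one has B^(m-r) Bʳ = B^m, and B^m is injective. -/
theorem injective_realPower (hB : ‖1 - B‖ ≤ 1) (hi : Function.Injective B) {r : ℝ} (hr : 0 ≤ r) :
    Function.Injective (realPower B r) := by
  obtain ⟨m, hm⟩ := exists_nat_ge r
  have h : realPower B (m - r) * realPower B r = B ^ m := by
    rw [← realPower_add hB (sub_nonneg.2 hm) hr, sub_add_cancel, realPower_natCast hB]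
  have hm' : Function.Injective (B ^ m : H →L[ℝ] H) := by
    clear h hm
    induction m with
    | zero => exact fun _ _ h => h
    | succ m ih =>
      rw [pow_succ]
      exact ih.comp hi
  rw [← h] at hm'
  exact Function.Injective.of_comp hm'

end RealPower

/-! ### The scale of Hilbert spaces defined by a compact operator -/

section Scale

theorem hilbertCompletion_induction {X : Type*} [AddCommGroup X] [Module ℝ X]
    {cd : PreInnerProductSpace.Core ℝ X} {p : HilbertCompletion cd → Prop}
    (hp : IsClosed {x | p x}) (ih : ∀ u : X, p (toHilbert cd u)) (x : HilbertCompletion cd) :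
    p x :=
  UniformSpace.Completion.induction_on x hp ih

variable {X : Type*} [AddCommGroup X] [Module ℝ X]
  {H : Type w} [NormedAddCommGroup H] [InnerProductSpace ℝ H] [CompleteSpace H]

/-- The continuous linear map on a prehilbertian space with the scalar product induced by `A`. -/
def inducedMap (A : X →ₗ[ℝ] H) : PreHilbert (inducedCore A) →L[ℝ] H :=
  LinearMap.mkContinuous (E := PreHilbert (inducedCore A)) A 1 fun u => by
    rw [norm_preHilbert, one_mul]
    exact (norm_eq_sqrt_real_inner _).le

/-- The extension of `A` to the Hilbert completion for the scalar product induced by `A`. -/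
def inducedExtension (A : X →ₗ[ℝ] H) : HilbertCompletion (inducedCore A) →L[ℝ] H :=
  (inducedMap A).extend UniformSpace.Completion.toComplL

theorem inducedExtension_toHilbert (A : X →ₗ[ℝ] H) (u : X) :
    inducedExtension A (toHilbert (inducedCore A) u) = A u :=
  ContinuousLinearMap.extend_eq (inducedMap A) (e := UniformSpace.Completion.toComplL)
    UniformSpace.Completion.denseRange_coe
    (UniformSpace.Completion.isUniformInducing_coe _) u

theorem norm_toHilbert (A : X →ₗ[ℝ] H) (u : X) : ‖toHilbert (inducedCore A) u‖ = ‖A u‖ := by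
  change ‖((show PreHilbert (inducedCore A) from u : PreHilbert (inducedCore A)) :
    UniformSpace.Completion (PreHilbert (inducedCore A)))‖ = _
  rw [UniformSpace.Completion.norm_coe, norm_preHilbert]
  exact (norm_eq_sqrt_real_inner _).symm

/-- This isometry transports questions about the completions for different scalar products to the
single space H. -/
theorem norm_inducedExtension (A : X →ₗ[ℝ] H) (h : HilbertCompletion (inducedCore A)) :
    ‖inducedExtension A h‖ = ‖h‖ := by
  refine hilbertCompletion_induction (p := fun h => ‖inducedExtension A h‖ = ‖h‖)
    (isClosed_eq (by fun_prop) (by fun_prop)) (fun u => ?_) h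
  rw [inducedExtension_toHilbert, norm_toHilbert]

/-- For a compact injective self-adjoint operator `0 ≤ B ≤ 1`, the Hilbert spaces with the norms
`‖B⁻ˢᐟ² u‖` form a scale with compact inclusions. -/
theorem exists_compact_inclusion (ι : X →ₗ[ℝ] H) (B : H →L[ℝ] H) (hB : ‖1 - B‖ ≤ 1)
    (hs : IsSelfAdjoint B) (hc : IsCompactOperator B) (hi : Function.Injective B)
    (T : X →ₗ[ℝ] X) (hT : ∀ u, B (ι (T u)) = ι u) (A : ℝ → X →ₗ[ℝ] H)
    (hA : ∀ s u, A s u = realPower B (⌈s / 2⌉₊ - s / 2) (ι ((T ^ ⌈s / 2⌉₊) u)))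
    {s t : ℝ} (hts : t < s) :
    ∃ incl : HilbertCompletion (inducedCore (A s)) →L[ℝ] HilbertCompletion (inducedCore (A t)),
      (∀ u, incl (toHilbert (inducedCore (A s)) u) = toHilbert (inducedCore (A t)) u) ∧
      Function.Injective incl ∧
      (∀ (h : ℕ → HilbertCompletion (inducedCore (A s))) (L : ℝ), (∀ k, ‖h k‖ < L) →
        ∃ (σ : ℕ → ℕ) (h' : HilbertCompletion (inducedCore (A t))), StrictMono σ ∧
          Tendsto (fun k => incl (h (σ k))) atTop (𝓝 h')) ∧
      IsCompactOperator incl := by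
  have hr : 0 < (s - t) / 2 := by linarith
  set P := realPower B ((s - t) / 2) with hP
  have hpow : ∀ (m : ℕ) u, (B ^ m) (ι ((T ^ m) u)) = ι u := by
    intro m
    induction m with
    | zero => intro u; rfl
    | succ m ih =>
      intro u
      rw [pow_succ, pow_succ']
      change (B ^ m) (B (ι (T ((T ^ m) u)))) = ι u
      rw [hT, ih]
  have hnn : ∀ r : ℝ, 0 ≤ (⌈r / 2⌉₊ : ℝ) - r / 2 := fun r => sub_nonneg.2 (Nat.le_ceil _)
  -- With ⌈s/2⌉ = m + ⌈t/2⌉, the extra factor T^m on the side of s is undone by B^m, and the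
  -- exponents of B match: (s-t)/2 + (⌈s/2⌉ - s/2) = (⌈t/2⌉ - t/2) + m.
  have hst : ∀ u, A t u = P (A s u) := by
    intro u
    obtain ⟨m, hm⟩ : ∃ m, ⌈s / 2⌉₊ = m + ⌈t / 2⌉₊ :=
      ⟨_, (Nat.sub_add_cancel (Nat.ceil_mono (by linarith))).symm⟩
    rw [hA, hA, hP]
    have h1 : (T ^ ⌈s / 2⌉₊) u = (T ^ m) ((T ^ ⌈t / 2⌉₊) u) := by
      rw [hm, pow_add]
      rfl
    rw [← mul_apply_eq_comp, ← realPower_add hB hr.le (hnn s), h1,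
      ← hpow m ((T ^ ⌈t / 2⌉₊) u), hpow m ((T ^ ⌈t / 2⌉₊) u), ← hpow m ((T ^ ⌈t / 2⌉₊) u),
      ← realPower_natCast hB, ← mul_apply_eq_comp,
      ← realPower_add hB (hnn t) (Nat.cast_nonneg m)]
    congr 2
    rw [hm]
    push_cast
    ring
  have hle : ∀ u, ‖A t u‖ ≤ ‖P‖ * ‖A s u‖ := fun u => by
    rw [hst]
    exact P.le_opNorm _
  set incl : HilbertCompletion (inducedCore (A s)) →L[ℝ] HilbertCompletion (inducedCore (A t)) :=
    (LinearMap.mkContinuous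
      ({ toFun := fun u => u, map_add' := fun _ _ => rfl, map_smul' := fun _ _ => rfl } :
        PreHilbert (inducedCore (A s)) →ₗ[ℝ] PreHilbert (inducedCore (A t))) ‖P‖
      (fun u => by
        have h1 : ‖(show PreHilbert (inducedCore (A t)) from u)‖ = ‖A t u‖ :=
          (norm_eq_sqrt_real_inner _).symm
        have h2 : ‖u‖ = ‖A s u‖ := (norm_eq_sqrt_real_inner _).symm
        rw [h2]
        exact h1.le.trans (hle u))).completion with hincl
  have hcoe : ∀ u, incl (toHilbert (inducedCore (A s)) u) = toHilbert (inducedCore (A t)) u :=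
    fun u => ContinuousLinearMap.completion_apply_coe _ _
  -- Under the isometries into H, the inclusion becomes P; its injectivity and its compactness are
  -- those of P.
  have hcomm : ∀ h, inducedExtension (A t) (incl h) = P (inducedExtension (A s) h) := by
    intro h
    refine hilbertCompletion_induction
      (p := fun h => inducedExtension (A t) (incl h) = P (inducedExtension (A s) h))
      (isClosed_eq (by fun_prop) (by fun_prop)) (fun u => ?_) h
    rw [hcoe, inducedExtension_toHilbert, inducedExtension_toHilbert, hst]
  have hinj : ∀ r, Function.Injective (inducedExtension (A r)) := fun r =>
    (injective_iff_map_eq_zero _).2 fun h h0 => by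
      rw [← norm_eq_zero, ← norm_inducedExtension, h0, norm_zero]
  have hPc : IsCompactOperator (P ∘L inducedExtension (A s)) :=
    (isCompactOperator_realPower hB hs hc hr).comp_clm _
  have hcomp : IsCompactOperator incl := by
    refine isCompactOperator_of_le_add incl fun ε hε =>
      ⟨H, inferInstance, inferInstance, P ∘L inducedExtension (A s), hPc, fun h => ?_⟩
    rw [← norm_inducedExtension, hcomm]
    exact le_add_of_nonneg_left (by positivity)
  refine ⟨incl, hcoe, ?_, ?_, hcomp⟩
  · intro h h' hh
    have := congrArg (inducedExtension (A t)) hh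
    rw [hcomm, hcomm] at this
    exact hinj s (injective_realPower hB hi hr.le this)
  · intro h L hL
    have hK := IsCompactOperator.isCompact_closure_image_closedBall
      (f := (incl : HilbertCompletion (inducedCore (A s)) →ₗ[ℝ]
        HilbertCompletion (inducedCore (A t)))) hcomp L
    obtain ⟨h', -, σ, hσ, hlim⟩ := hK.tendsto_subseq (x := fun k => incl (h k)) fun k =>
      subset_closure ⟨h k, mem_closedBall_zero_iff.2 (hL k).le, rfl⟩
    exact ⟨σ, h', hσ, hlim⟩

end Scale

/-! ### The resolvent of a form -/

section Resolvent

variable {X : Type*} [AddCommGroup X] [Module ℝ X] {cd cd' : PreInnerProductSpace.Core ℝ X}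
  (h : ∀ u, cd'.inner u u ≤ cd.inner u u)

theorem completionMap_toHilbert (u : X) :
    completionMap cd cd' h (toHilbert cd u) = toHilbert cd' u := by
  unfold completionMap
  exact ContinuousLinearMap.completion_apply_coe _ (show PreHilbert cd from u)

theorem denseRange_toHilbert (cd : PreInnerProductSpace.Core ℝ X) : DenseRange (toHilbert cd) :=
  UniformSpace.Completion.denseRange_coe (α := PreHilbert cd)

theorem inner_toHilbert (cd : PreInnerProductSpace.Core ℝ X) (u v : X) :
    inner ℝ (toHilbert cd u) (toHilbert cd v) = cd.inner u v :=
  UniformSpace.Completion.inner_coe (E := PreHilbert cd) u v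

theorem norm_toHilbert_sq (cd : PreInnerProductSpace.Core ℝ X) (u : X) :
    ‖toHilbert cd u‖ ^ 2 = cd.inner u u := by
  rw [← real_inner_self_eq_norm_sq, inner_toHilbert]

theorem norm_completionMap_le : ‖completionMap cd cd' h‖ ≤ 1 := by
  refine ContinuousLinearMap.opNorm_le_bound _ zero_le_one fun x => ?_
  rw [one_mul]
  refine hilbertCompletion_induction (p := fun x => ‖completionMap cd cd' h x‖ ≤ ‖x‖)
    (isClosed_le (by fun_prop) (by fun_prop)) (fun u => ?_) x
  rw [completionMap_toHilbert]
  refine abs_le_of_sq_le_sq' ?_ (norm_nonneg _) |>.2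
  rw [norm_toHilbert_sq, norm_toHilbert_sq]
  exact h u

/-- The kernel of the adjoint is orthogonal to the range, which is dense since it contains the image
of X. -/
theorem injective_adjoint_completionMap : Function.Injective (completionMap cd cd' h).adjoint := by
  refine (injective_iff_map_eq_zero _).2 fun x hx => ?_
  refine (denseRange_toHilbert cd').eq_zero_of_inner_left ℝ fun u => ?_
  rw [← completionMap_toHilbert h, ← ContinuousLinearMap.adjoint_inner_left, hx, inner_zero_left]

/-- Used for w = (1 + Δ) u: the hypothesis is then the weak equation, and the conclusion says that
J* inverts 1 + Δ. -/
theorem adjoint_completionMap_toHilbert {u w : X} (huw : ∀ v, cd'.inner w v = cd.inner u v) :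
    (completionMap cd cd' h).adjoint (toHilbert cd' w) = toHilbert cd u := by
  refine (denseRange_toHilbert cd).eq_of_inner_left ℝ fun v => ?_
  rw [ContinuousLinearMap.adjoint_inner_left, completionMap_toHilbert, inner_toHilbert,
    inner_toHilbert, huw]

/-- Expand ‖x - J J* x‖² = ‖x‖² - 2 ‖J* x‖² + ‖J J* x‖², where the last term is at most ‖J* x‖². -/
theorem norm_one_sub_comp_adjoint_le {H K : Type*} [NormedAddCommGroup H] [InnerProductSpace ℝ H]
    [CompleteSpace H] [NormedAddCommGroup K] [InnerProductSpace ℝ K] [CompleteSpace K]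
    {J : H →L[ℝ] K} (hJ : ‖J‖ ≤ 1) : ‖1 - J ∘L J.adjoint‖ ≤ 1 := by
  refine ContinuousLinearMap.opNorm_le_bound _ zero_le_one fun x => ?_
  rw [one_mul]
  refine abs_le_of_sq_le_sq' ?_ (norm_nonneg _) |>.2
  change ‖x - J (J.adjoint x)‖ ^ 2 ≤ _
  have h1 : ‖J (J.adjoint x)‖ ≤ ‖J.adjoint x‖ := J.le_of_opNorm_le_of_le hJ le_rfl |>.trans_eq
    (one_mul _)
  rw [norm_sub_sq_real, ← J.adjoint_inner_left, real_inner_self_eq_norm_sq]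
  nlinarith [norm_nonneg (J (J.adjoint x)), norm_nonneg (J.adjoint x)]

/-- A criterion for the compactness of the inclusion of Hilbert completions. -/
theorem isCompactOperator_completionMap
    (hε : ∀ ε : ℝ, 0 < ε → ∃ (m : ℕ) (F : X →ₗ[ℝ] (Fin m → ℝ)) (C : ℝ),
      (∀ u j, F u j ^ 2 ≤ C * cd.inner u u) ∧
      ∀ u, cd'.inner u u ≤ ε * cd.inner u u + ∑ j, F u j ^ 2) :
    IsCompactOperator (completionMap cd cd' h) := by
  refine isCompactOperator_of_le_add.{0} _ fun ε hεpos => ?_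
  -- The hypothesis bounds squares of norms, so it is used with ε²; then ε² a² + b² ≤ (ε a + b)² for
  -- a, b ≥ 0.
  obtain ⟨m, F, C, hC, hF⟩ := hε (ε ^ 2) (by positivity)
  let F₀ : X →ₗ[ℝ] EuclideanSpace ℝ (Fin m) :=
    (WithLp.linearEquiv 2 ℝ (Fin m → ℝ)).symm.toLinearMap ∘ₗ F
  have hF₀ : ∀ u : X, ‖F₀ u‖ ^ 2 = ∑ j, F u j ^ 2 := fun u => by
    rw [EuclideanSpace.norm_sq_eq]
    exact Finset.sum_congr rfl fun j _ => sq_abs _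
  have hle : ∀ u : X, ‖F₀ u‖ ≤ Real.sqrt (m * |C|) * Real.sqrt (cd.inner u u) := fun u => by
    have hnn : 0 ≤ cd.inner u u := by
      rw [← norm_toHilbert_sq]
      positivity
    refine abs_le_of_sq_le_sq' ?_ (by positivity) |>.2
    rw [mul_pow, Real.sq_sqrt (by positivity), Real.sq_sqrt hnn, hF₀]
    calc ∑ j, F u j ^ 2 ≤ ∑ _j : Fin m, |C| * cd.inner u u :=
          Finset.sum_le_sum fun j _ => (hC u j).trans
            (mul_le_mul_of_nonneg_right (le_abs_self C) hnn)
      _ = _ := by simp [mul_assoc]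
  let F₁ : PreHilbert cd →L[ℝ] EuclideanSpace ℝ (Fin m) :=
    LinearMap.mkContinuous (E := PreHilbert cd) F₀ (Real.sqrt (m * |C|)) hle
  let S : HilbertCompletion cd →L[ℝ] EuclideanSpace ℝ (Fin m) :=
    F₁.extend UniformSpace.Completion.toComplL
  have hS : ∀ u : X, ‖S (toHilbert cd u)‖ ^ 2 = ∑ j, F u j ^ 2 := fun u =>
    (congrArg (‖·‖ ^ 2) (ContinuousLinearMap.extend_eq F₁
      (e := UniformSpace.Completion.toComplL) UniformSpace.Completion.denseRange_coe
      (UniformSpace.Completion.isUniformInducing_coe _) u)).trans (hF₀ u)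
  refine ⟨EuclideanSpace ℝ (Fin m), inferInstance, inferInstance, S,
    isCompactOperator_of_locallyCompactSpace_dom S, fun x => ?_⟩
  refine hilbertCompletion_induction
    (p := fun x => ‖completionMap cd cd' h x‖ ≤ ε * ‖x‖ + ‖S x‖)
    (isClosed_le (by fun_prop) (by fun_prop)) (fun u => ?_) x
  rw [completionMap_toHilbert]
  refine abs_le_of_sq_le_sq' ?_ (by positivity) |>.2
  rw [norm_toHilbert_sq]
  refine (hF u).trans ?_
  rw [← hS, add_sq, mul_pow, norm_toHilbert_sq]
  have : 0 ≤ 2 * (ε * ‖toHilbert cd u‖) * ‖S (toHilbert cd u)‖ := by positivity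
  linarith

end Resolvent

/-! ### The Rellich inequality on `ℝⁿ` -/

section EuclideanRellich

theorem integrable_quadratic {α : Type*} [MeasurableSpace α] {μ : Measure α} [IsFiniteMeasure μ]
    {a : α → ℝ} (ha : Integrable a μ) (ha2 : Integrable (fun x => a x ^ 2) μ) (p q r : ℝ) :
    Integrable (fun x => p * a x ^ 2 - q * a x + r) μ :=
  ((ha2.const_mul p).sub (ha.const_mul q)).add (integrable_const r)

theorem integral_quadratic {α : Type*} [MeasurableSpace α] {μ : Measure α} [IsFiniteMeasure μ]
    {a : α → ℝ} (ha : Integrable a μ) (ha2 : Integrable (fun x => a x ^ 2) μ) (p q r : ℝ) :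
    ∫ x, p * a x ^ 2 - q * a x + r ∂μ =
      p * (∫ x, a x ^ 2 ∂μ) - q * (∫ x, a x ∂μ) + μ.real univ * r := by
  have h1 : Integrable (fun x => p * a x ^ 2) μ := ha2.const_mul p
  have h2 : Integrable (fun x => q * a x) μ := ha.const_mul q
  have h3 : Integrable (fun x => p * a x ^ 2 - q * a x) μ := h1.sub h2
  rw [integral_add h3 (integrable_const r), integral_sub h1 h2, integral_const_mul,
    integral_const_mul, integral_const, smul_eq_mul]

/-- With M the total mass and c = ∫ a, expanding ∫ (M a - c)² ≥ 0 gives M (M ∫ a² - c²) ≥ 0; if M =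
0 the measure vanishes. -/
theorem sq_integral_le {α : Type*} [MeasurableSpace α] {μ : Measure α} [IsFiniteMeasure μ]
    {a : α → ℝ} (ha : Integrable a μ) (ha2 : Integrable (fun x => a x ^ 2) μ) :
    (∫ x, a x ∂μ) ^ 2 ≤ μ.real univ * ∫ x, a x ^ 2 ∂μ := by
  set M := μ.real univ with hM
  set c := ∫ x, a x ∂μ with hc
  have h0 : 0 ≤ ∫ x, (M ^ 2 * a x ^ 2 - (2 * M * c) * a x) + c ^ 2 ∂μ :=
    integral_nonneg fun x => by
      change 0 ≤ (M ^ 2 * a x ^ 2 - (2 * M * c) * a x) + c ^ 2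
      nlinarith [sq_nonneg (M * a x - c)]
  rw [integral_quadratic ha ha2, ← hc, ← hM] at h0
  rcases (measureReal_nonneg : 0 ≤ μ.real univ).eq_or_lt with h | h
  · have : μ = 0 := by
      rw [← Measure.measure_univ_eq_zero]
      exact (measureReal_eq_zero_iff).1 h.symm
    rw [hc, this]
    simp
  · rw [← hM] at h
    nlinarith

variable {n : ℕ}

/-- Write p(x+h) - p(x) = ∫₀¹ dp(x+sh)(h) ds, apply Cauchy–Schwarz in s, and integrate over x first:
by translation invariance the inner integral does not depend on s. Integrals with values in [0, ∞]
avoid integrability conditions. -/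
theorem lintegral_sq_translate_sub_le {p : Euc n → ℝ} (hp : ContDiff ℝ 1 p) (h : Euc n) :
    ∫⁻ x, ENNReal.ofReal ((p (x + h) - p x) ^ 2) ≤
      ENNReal.ofReal (‖h‖ ^ 2) * ∫⁻ x, ENNReal.ofReal (‖fderiv ℝ p x‖ ^ 2) := by
  have hdc : Continuous (fderiv ℝ p) := hp.continuous_fderiv one_ne_zero
  set μ : Measure ℝ := (volume : Measure ℝ).restrict (Ioc 0 1) with hμ
  have hpt : ∀ x, ENNReal.ofReal ((p (x + h) - p x) ^ 2) ≤
      ∫⁻ s, ENNReal.ofReal (‖h‖ ^ 2) * ENNReal.ofReal (‖fderiv ℝ p (x + s • h)‖ ^ 2) ∂μ := by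
    intro x
    have hd : ∀ s : ℝ, HasDerivAt (fun s : ℝ => p (x + s • h)) (fderiv ℝ p (x + s • h) h) s := by
      intro s
      have h1 : HasDerivAt (fun s : ℝ => x + s • h) h s := by
        simpa using ((hasDerivAt_id s).smul_const h).const_add x
      exact ((hp.differentiable one_ne_zero) _).hasFDerivAt.comp_hasDerivAt s h1
    have hc : Continuous fun s : ℝ => fderiv ℝ p (x + s • h) h := by fun_prop
    have hint : ∫ s, fderiv ℝ p (x + s • h) h ∂μ = p (x + h) - p x := by
      have := intervalIntegral.integral_eq_sub_of_hasDerivAt (fun s _ => hd s)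
        (hc.intervalIntegrable 0 1)
      rw [intervalIntegral.integral_of_le zero_le_one] at this
      simpa using this
    have hI : ∀ {q : ℝ → ℝ}, Continuous q → Integrable q μ := fun hq =>
      (hq.integrableOn_Icc (a := 0) (b := 1)).mono_set Ioc_subset_Icc_self
    have hc2 : Integrable (fun s : ℝ => (fderiv ℝ p (x + s • h) h) ^ 2) μ := hI (hc.pow 2)
    have h2 := sq_integral_le (hI hc) hc2
    have hμ1 : μ.real univ = 1 := by simp [hμ, Measure.real]
    rw [hint, hμ1, one_mul] at h2
    refine (ENNReal.ofReal_le_ofReal h2).trans ?_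
    rw [ofReal_integral_eq_lintegral_ofReal hc2 (ae_of_all _ fun _ => sq_nonneg _)]
    refine lintegral_mono fun s => ?_
    rw [← ENNReal.ofReal_mul (sq_nonneg _), ← mul_pow, mul_comm]
    refine ENNReal.ofReal_le_ofReal ?_
    rw [← sq_abs]
    exact pow_le_pow_left₀ (abs_nonneg _) ((fderiv ℝ p (x + s • h)).le_opNorm h) 2
  refine (lintegral_mono hpt).trans ?_
  rw [lintegral_lintegral_swap]
  · have : ∀ s : ℝ, ∫⁻ x, ENNReal.ofReal (‖h‖ ^ 2) *
        ENNReal.ofReal (‖fderiv ℝ p (x + s • h)‖ ^ 2) =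
        ENNReal.ofReal (‖h‖ ^ 2) * ∫⁻ x, ENNReal.ofReal (‖fderiv ℝ p x‖ ^ 2) := by
      intro s
      rw [lintegral_const_mul' _ _ ENNReal.ofReal_ne_top]
      congr 1
      exact lintegral_add_right_eq_self (fun x => ENNReal.ofReal (‖fderiv ℝ p x‖ ^ 2)) (s • h)
    simp only [this]
    simp [hμ]
  · refine Continuous.aemeasurable ?_
    refine ENNReal.continuous_const_mul ENNReal.ofReal_ne_top |>.comp ?_
    exact ENNReal.continuous_ofReal.comp (by fun_prop)

/-- The cube of the grid of size `δ` with index `k`. -/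
def gridCube (δ : ℝ) (k : Fin n → ℤ) : Set (Euc n) :=
  {x | ∀ i, x i ∈ Ico (k i * δ) ((k i + 1) * δ)}

theorem volume_coordinate_box {a b : Fin n → ℝ} :
    volume {x : Euc n | ∀ i, x i ∈ Ico (a i) (b i)} = ∏ i, ENNReal.ofReal (b i - a i) := by
  rw [← Real.volume_pi_Ico, ← (EuclideanSpace.volume_preserving_symm_measurableEquiv_toLp
    (Fin n)).measure_preimage_equiv]
  congr 1
  ext x
  simp only [mem_preimage, Set.mem_pi, mem_univ, true_imp_iff]
  rfl

theorem measurableSet_coordinate_box {a b : Fin n → ℝ} :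
    MeasurableSet {x : Euc n | ∀ i, x i ∈ Ico (a i) (b i)} := by
  rw [ofPred_forall]
  refine MeasurableSet.iInter fun i => ?_
  exact measurableSet_Ico.preimage (by fun_prop : Continuous fun x : Euc n => x i).measurable

theorem measurableSet_gridCube (δ : ℝ) (k : Fin n → ℤ) : MeasurableSet (gridCube δ k) :=
  measurableSet_coordinate_box

theorem volume_gridCube {δ : ℝ} (k : Fin n → ℤ) :
    volume (gridCube δ k) = ENNReal.ofReal δ ^ n := by
  rw [gridCube, volume_coordinate_box]
  simp [add_mul]

theorem mem_gridCube_iff {δ : ℝ} (hδ : 0 < δ) (k : Fin n → ℤ) (x : Euc n) :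
    x ∈ gridCube δ k ↔ (fun i => ⌊x i / δ⌋) = k := by
  rw [funext_iff]
  refine forall_congr' fun i => ?_
  rw [Int.floor_eq_iff, le_div_iff₀ hδ, div_lt_iff₀ hδ]
  rfl

theorem norm_sq_le_of_sub_mem {δ : ℝ} {h : Euc n} (hh : ∀ i, h i ∈ Ico (-δ) δ) :
    ‖h‖ ^ 2 ≤ n * δ ^ 2 := by
  rw [EuclideanSpace.norm_sq_eq]
  calc ∑ i, ‖h i‖ ^ 2 ≤ ∑ _i : Fin n, δ ^ 2 := by
        refine Finset.sum_le_sum fun i _ => ?_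
        rw [Real.norm_eq_abs]
        exact pow_le_pow_left₀ (abs_nonneg _) (abs_le.2 ⟨(hh i).1, (hh i).2.le⟩) 2
    _ = n * δ ^ 2 := by simp

/-- Points x and y of the same cube satisfy y = x + h with h in the box D = [-δ, δ)ⁿ. Replacing y by
h and enlarging the domain to D, the disjoint cubes combine into one integral over x, to which the
translation estimate applies for each h. The factors are the volume (2δ)ⁿ of D and the bound n δ²
for ‖h‖² on D. -/
theorem sum_lintegral_gridCube_le {δ : ℝ} (hδ : 0 < δ) (S : Finset (Fin n → ℤ)) {p : Euc n → ℝ}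
    (hp : ContDiff ℝ 1 p) :
    ∑ k ∈ S, ∫⁻ x in gridCube δ k, ∫⁻ y in gridCube δ k, ENNReal.ofReal ((p y - p x) ^ 2) ≤
      ENNReal.ofReal (2 * δ) ^ n *
        (ENNReal.ofReal (n * δ ^ 2) * ∫⁻ x, ENNReal.ofReal (‖fderiv ℝ p x‖ ^ 2)) := by
  set D : Set (Euc n) := {h | ∀ i, h i ∈ Ico (-δ) δ} with hD
  have hDm : MeasurableSet D := measurableSet_coordinate_box
  set Φ : Euc n → ENNReal := fun x => ∫⁻ h in D, ENNReal.ofReal ((p (x + h) - p x) ^ 2) with hΦ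
  have hpc := hp.continuous
  have h1 : ∀ k, ∀ x ∈ gridCube δ k,
      ∫⁻ y in gridCube δ k, ENNReal.ofReal ((p y - p x) ^ 2) ≤ Φ x := by
    intro k x hx
    change _ ≤ ∫⁻ h in D, ENNReal.ofReal ((p (x + h) - p x) ^ 2)
    rw [← lintegral_indicator (measurableSet_gridCube δ k), ← lintegral_indicator hDm,
      ← lintegral_add_left_eq_self _ x]
    refine lintegral_mono fun h => ?_
    by_cases hh : x + h ∈ gridCube δ k
    · have hhD : h ∈ D := by
        intro i
        have a := hh i
        have b := hx i
        simp only [PiLp.add_apply, mem_Ico] at a b ⊢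
        constructor <;> nlinarith
      rw [indicator_of_mem hh, indicator_of_mem hhD]
    · rw [indicator_of_notMem hh]
      exact zero_le
  have hdisj : Pairwise (Function.onFun Disjoint (gridCube δ : (Fin n → ℤ) → Set (Euc n))) := by
    intro k l hkl
    refine Set.disjoint_left.2 fun x hk hl => hkl ?_
    rw [mem_gridCube_iff hδ] at hk hl
    exact hk.symm.trans hl
  calc ∑ k ∈ S, ∫⁻ x in gridCube δ k, ∫⁻ y in gridCube δ k, ENNReal.ofReal ((p y - p x) ^ 2)
      ≤ ∑ k ∈ S, ∫⁻ x in gridCube δ k, Φ x :=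
        Finset.sum_le_sum fun k _ => setLIntegral_mono' (measurableSet_gridCube δ k) (h1 k)
    _ = ∫⁻ x in ⋃ k ∈ S, gridCube δ k, Φ x :=
        (lintegral_biUnion_finset (fun k _ l _ h => hdisj h)
          (fun k _ => measurableSet_gridCube δ k) Φ).symm
    _ ≤ ∫⁻ x, Φ x := setLIntegral_le_lintegral _ _
    _ = ∫⁻ h in D, ∫⁻ x, ENNReal.ofReal ((p (x + h) - p x) ^ 2) := by
        refine lintegral_lintegral_swap (Continuous.aemeasurable ?_)
        exact ENNReal.continuous_ofReal.comp (by fun_prop)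
    _ ≤ ∫⁻ _h in D, ENNReal.ofReal (n * δ ^ 2) * ∫⁻ x, ENNReal.ofReal (‖fderiv ℝ p x‖ ^ 2) := by
        refine setLIntegral_mono' hDm fun h hh => (lintegral_sq_translate_sub_le hp h).trans ?_
        gcongr
        exact norm_sq_le_of_sub_mem hh
    _ = _ := by
        rw [setLIntegral_const, hD, volume_coordinate_box, mul_comm]
        simp [two_mul]

/-- The variance as a double integral of squared differences; on a cube it links the square norm,
the average and the differences that the derivative controls. -/
theorem integral_integral_sq_sub {α : Type*} [MeasurableSpace α] {μ : Measure α}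
    [IsFiniteMeasure μ] {a : α → ℝ} (ha : Integrable a μ) (ha2 : Integrable (fun x => a x ^ 2) μ) :
    ENNReal.ofReal (2 * (μ.real univ * ∫ x, a x ^ 2 ∂μ - (∫ x, a x ∂μ) ^ 2)) =
      ∫⁻ x, ∫⁻ y, ENNReal.ofReal ((a y - a x) ^ 2) ∂μ ∂μ := by
  set c := ∫ x, a x ∂μ with hc
  set A := ∫ x, a x ^ 2 ∂μ with hA
  have e : ∀ x y, (a y - a x) ^ 2 = 1 * a y ^ 2 - (2 * a x) * a y + a x ^ 2 := fun x y => by ring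
  have hq : ∀ x, ∫ y, (a y - a x) ^ 2 ∂μ = μ.real univ * a x ^ 2 - (2 * c) * a x + A := by
    intro x
    simp only [e]
    rw [integral_quadratic ha ha2, ← hc, ← hA]
    ring
  have h1 : ∀ x, ∫⁻ y, ENNReal.ofReal ((a y - a x) ^ 2) ∂μ =
      ENNReal.ofReal (μ.real univ * a x ^ 2 - (2 * c) * a x + A) := by
    intro x
    rw [← hq, ofReal_integral_eq_lintegral_ofReal _ (ae_of_all _ fun _ => sq_nonneg _)]
    simp only [e]
    exact integrable_quadratic ha ha2 _ _ _
  have h2 : ∀ x, 0 ≤ μ.real univ * a x ^ 2 - (2 * c) * a x + A := fun x => by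
    rw [← hq]
    exact integral_nonneg fun y => sq_nonneg (a y - a x)
  simp only [h1]
  rw [← ofReal_integral_eq_lintegral_ofReal (integrable_quadratic ha ha2 _ _ _) (ae_of_all _ h2),
    integral_quadratic ha ha2, ← hc, ← hA]
  congr 1
  ring

/-- The Rellich inequality: for functions with support in a fixed compact set, the square norm is
bounded by a small multiple of the square norm of the derivative and finitely many averages. -/
theorem exists_finset_integral_sq_le {K : Set (Euc n)} (hK : IsCompact K) {ε : ℝ} (hε : 0 < ε) :
    ∃ (δ a : ℝ) (S : Finset (Fin n → ℤ)), 0 ≤ a ∧ ∀ p : Euc n → ℝ, ContDiff ℝ 1 p →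
      tsupport p ⊆ K →
      ∫ x, p x ^ 2 ≤ ε * (∫ x, ‖fderiv ℝ p x‖ ^ 2) +
        ∑ k ∈ S, a * (∫ x in gridCube δ k, p x) ^ 2 := by
  -- The final coefficient of the derivative term is (2δⁿ)⁻¹ (2δ)ⁿ n δ², which is half of the
  -- quantity made small here.
  obtain ⟨δ, hδ, hδε⟩ : ∃ δ : ℝ, 0 < δ ∧ 2 ^ n * (n * δ ^ 2) ≤ ε := by
    have hlim : Tendsto (fun δ : ℝ => 2 ^ n * (n * δ ^ 2)) (𝓝[>] 0) (𝓝 0) := by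
      have : Continuous fun δ : ℝ => (2 : ℝ) ^ n * (n * δ ^ 2) := by fun_prop
      simpa using this.tendsto 0 |>.mono_left nhdsWithin_le_nhds
    obtain ⟨δ, h1, h2⟩ := ((hlim.eventually (gt_mem_nhds hε)).and
      self_mem_nhdsWithin).exists
    exact ⟨δ, h2, h1.le⟩
  -- The bounded set K meets only finitely many cubes of the grid.
  have hfin : ((fun x : Euc n => fun i => ⌊x i / δ⌋) '' K).Finite := by
    obtain ⟨M, hM⟩ := hK.isBounded.exists_norm_le
    refine (Set.Finite.pi' (ι := Fin n) (κ := fun _ => ℤ)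
      (t := fun _ => Icc ⌊-M / δ⌋ ⌊M / δ⌋) fun i => finite_Icc _ _).subset ?_
    rintro _ ⟨x, hx, rfl⟩ i
    have h1 := (PiLp.norm_apply_le x i).trans (hM x hx)
    rw [Real.norm_eq_abs, abs_le] at h1
    exact ⟨Int.floor_mono (by gcongr; exact h1.1), Int.floor_mono (by gcongr; exact h1.2)⟩
  refine ⟨δ, (δ ^ n)⁻¹, hfin.toFinset, by positivity, fun p hp hpK => ?_⟩
  have hcs : HasCompactSupport p := hK.of_isClosed_subset (isClosed_tsupport p) hpK
  have hpc := hp.continuous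
  have hpi : Integrable p := hpc.integrable_of_hasCompactSupport hcs
  have hp2 : Integrable fun x => p x ^ 2 := by
    refine (hpc.pow 2).integrable_of_hasCompactSupport (hcs.mono fun x hx => ?_)
    intro h0
    exact hx (by simp [show p x = 0 from h0])
  have hd2 : Integrable fun x => ‖fderiv ℝ p x‖ ^ 2 := by
    refine ((hp.continuous_fderiv one_ne_zero).norm.pow 2).integrable_of_hasCompactSupport
      ((hcs.fderiv ℝ).mono fun x hx => ?_)
    intro h0
    exact hx (by simp [show fderiv ℝ p x = 0 from h0])
  have hdisj : Pairwise (Function.onFun Disjoint (gridCube δ : (Fin n → ℤ) → Set (Euc n))) := by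
    intro k l hkl
    refine Set.disjoint_left.2 fun x hk hl => hkl ?_
    rw [mem_gridCube_iff hδ] at hk hl
    exact hk.symm.trans hl
  have hsum : ∫ x, p x ^ 2 = ∑ k ∈ hfin.toFinset, ∫ x in gridCube δ k, p x ^ 2 := by
    rw [← integral_biUnion_finset _ (fun k _ => measurableSet_gridCube δ k)
      (fun k _ l _ h => hdisj h) (fun k _ => hp2.integrableOn)]
    refine (setIntegral_eq_integral_of_forall_compl_eq_zero fun x hx => ?_).symm
    by_contra hne
    refine hx (mem_iUnion₂.2 ⟨_, hfin.mem_toFinset.2 ⟨x, hpK (subset_tsupport p ?_), rfl⟩,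
      (mem_gridCube_iff hδ _ _).2 rfl⟩)
    exact fun h0 => hne (by simp [h0])
  have hvol : ∀ k : Fin n → ℤ, (volume.restrict (gridCube δ k)).real univ = δ ^ n := by
    intro k
    rw [measureReal_restrict_apply_univ, Measure.real, volume_gridCube, ENNReal.toReal_pow,
      ENNReal.toReal_ofReal hδ.le]
  have hfm : ∀ k : Fin n → ℤ, IsFiniteMeasure (volume.restrict (gridCube (n := n) δ k)) := fun k =>
    ⟨by rw [Measure.restrict_apply_univ, volume_gridCube]; exact ENNReal.pow_lt_top (by simp)⟩
  -- V k is the double integral of (p(y) - p(x))² over the square of the cube; solving for ∫ p²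
  -- leaves V k / (2δⁿ) plus δ⁻ⁿ times the square of the integral of p.
  set V : (Fin n → ℤ) → ℝ := fun k =>
    2 * (δ ^ n * (∫ x in gridCube δ k, p x ^ 2) - (∫ x in gridCube δ k, p x) ^ 2) with hV
  have hVnn : ∀ k, 0 ≤ V k := fun k => by
    have := sq_integral_le (μ := volume.restrict (gridCube δ k)) hpi.integrableOn hp2.integrableOn
    rw [hvol] at this
    simp only [hV]
    linarith
  have hVle : ∑ k ∈ hfin.toFinset, V k ≤
      (2 * δ) ^ n * (n * δ ^ 2 * ∫ x, ‖fderiv ℝ p x‖ ^ 2) := by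
    have h := sum_lintegral_gridCube_le hδ hfin.toFinset hp
    have h1 : ∀ k, ∫⁻ x in gridCube δ k, ∫⁻ y in gridCube δ k, ENNReal.ofReal ((p y - p x) ^ 2) =
        ENNReal.ofReal (V k) := fun k => by
      rw [← integral_integral_sq_sub hpi.integrableOn hp2.integrableOn, hvol]
    simp only [h1] at h
    have hDnn : 0 ≤ ∫ x, ‖fderiv ℝ p x‖ ^ 2 := integral_nonneg fun _ => sq_nonneg _
    rw [← ENNReal.ofReal_sum_of_nonneg fun k _ => hVnn k,
      ← ofReal_integral_eq_lintegral_ofReal hd2 (ae_of_all _ fun _ => sq_nonneg _),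
      ← ENNReal.ofReal_mul (by positivity), ← ENNReal.ofReal_pow (by positivity),
      ← ENNReal.ofReal_mul (by positivity)] at h
    exact (ENNReal.ofReal_le_ofReal_iff (by positivity)).1 h
  have hδn : 0 < δ ^ n := by positivity
  have hkey : ∀ k, ∫ x in gridCube δ k, p x ^ 2 =
      (2 * δ ^ n)⁻¹ * V k + (δ ^ n)⁻¹ * (∫ x in gridCube δ k, p x) ^ 2 := fun k => by
    simp only [hV]
    field_simp
    ring
  rw [hsum]
  simp only [hkey]
  rw [Finset.sum_add_distrib, ← Finset.mul_sum]
  refine add_le_add_left ?_ _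
  have hDnn : 0 ≤ ∫ x, ‖fderiv ℝ p x‖ ^ 2 := integral_nonneg fun _ => sq_nonneg _
  calc (2 * δ ^ n)⁻¹ * ∑ k ∈ hfin.toFinset, V k
      ≤ (2 * δ ^ n)⁻¹ * ((2 * δ) ^ n * (n * δ ^ 2 * ∫ x, ‖fderiv ℝ p x‖ ^ 2)) := by gcongr
    _ = (1 / 2) * (2 ^ n * (n * δ ^ 2)) * ∫ x, ‖fderiv ℝ p x‖ ^ 2 := by
        rw [mul_pow]
        field_simp
    _ ≤ ε * ∫ x, ‖fderiv ℝ p x‖ ^ 2 := by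
        gcongr
        linarith

end EuclideanRellich

/-! ### Coordinate vector fields -/

section CoordinateFields

variable {n : ℕ} {M : Type*} [TopologicalSpace M] [ChartedSpace (Euc n) M] [IsManifold (𝓡 n) ∞ M]

/-- The derivative of the inverse of the chart at `c`, at the point with chart coordinates those
of `x`. -/
def chartDeriv (c x : M) : Euc n →L[ℝ] TangentSpace (𝓡 n) x :=
  (trivializationAt (Euc n) (fun x : M => TangentSpace (𝓡 n) x) c).symmL ℝ x

theorem localFrame_eq_chartDeriv (c x : M) (a : Fin n) (hx : x ∈ (chartAt (Euc n) c).source) :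
    (trivializationAt (Euc n) (fun x : M => TangentSpace (𝓡 n) x) c).localFrame
      (EuclideanSpace.basisFun (Fin n) ℝ).toBasis a x =
      chartDeriv c x ((EuclideanSpace.basisFun (Fin n) ℝ).toBasis a) := by
  have hx' : x ∈ (trivializationAt (Euc n) (fun x : M => TangentSpace (𝓡 n) x) c).baseSet := by
    rw [TangentBundle.trivializationAt_baseSet]
    exact hx
  rw [Trivialization.localFrame_apply_of_mem_baseSet _ _ hx', Trivialization.basisAt,
    Module.Basis.map_apply, chartDeriv, Trivialization.symmL_apply,
    Trivialization.linearEquivAt_symm_apply]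
  exact hx'

/-- `chartDeriv` is defined through a trivialization of the tangent bundle; its identification with
a derivative makes the chain rule available. -/
theorem hasMFDerivAt_chart_symm (c : M) {y : Euc n} (hy : y ∈ (extChartAt (𝓡 n) c).target) :
    HasMFDerivAt 𝓘(ℝ, Euc n) (𝓡 n) (extChartAt (𝓡 n) c).symm y
      (chartDeriv c ((extChartAt (𝓡 n) c).symm y)) := by
  have h1 : MDifferentiableWithinAt 𝓘(ℝ, Euc n) (𝓡 n) (extChartAt (𝓡 n) c).symm (range (𝓡 n)) y :=
    mdifferentiableWithinAt_extChartAt_symm hy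
  have hr : range (𝓡 n) = univ := ModelWithCorners.Boundaryless.range_eq_univ
  have hs : (extChartAt (𝓡 n) c).symm y ∈ (chartAt (Euc n) c).source := by
    rw [← extChartAt_source (𝓡 n)]
    exact (extChartAt (𝓡 n) c).map_target hy
  have h2 := h1.hasMFDerivWithinAt
  have h3 := TangentBundle.symmL_trivializationAt (I := 𝓡 n) hs
  rw [(extChartAt (𝓡 n) c).right_inv hy] at h3
  rw [hr] at h2 h3
  rw [hasMFDerivWithinAt_univ] at h2
  rw [chartDeriv, h3]
  exact h2

/-- The derivative of a function in a chart. -/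
theorem hasFDerivAt_comp_chart_symm {p : M → ℝ} (c : M) {y : Euc n}
    (hy : y ∈ (extChartAt (𝓡 n) c).target)
    (hp : MDifferentiableAt (𝓡 n) 𝓘(ℝ, ℝ) p ((extChartAt (𝓡 n) c).symm y)) :
    HasFDerivAt (p ∘ (extChartAt (𝓡 n) c).symm)
      ((mfderiv (𝓡 n) 𝓘(ℝ, ℝ) p ((extChartAt (𝓡 n) c).symm y)) ∘L
        (chartDeriv c ((extChartAt (𝓡 n) c).symm y)) : Euc n →L[ℝ] ℝ) y :=
  (hp.hasMFDerivAt.comp y (hasMFDerivAt_chart_symm c hy)).hasFDerivAt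

/-- The coordinate change. -/
theorem hasFDerivAt_chart_comp_chart_symm (c c' : M) {y : Euc n}
    (hy : y ∈ (extChartAt (𝓡 n) c').target)
    (hy' : (extChartAt (𝓡 n) c').symm y ∈ (chartAt (Euc n) c).source) :
    ∃ τ : Euc n →L[ℝ] Euc n,
      HasFDerivAt (extChartAt (𝓡 n) c ∘ (extChartAt (𝓡 n) c').symm) τ y ∧
      chartDeriv c' ((extChartAt (𝓡 n) c').symm y) =
        chartDeriv c ((extChartAt (𝓡 n) c').symm y) ∘L τ := by
  set x := (extChartAt (𝓡 n) c').symm y with hx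
  have hxs : x ∈ (extChartAt (𝓡 n) c).source := by
    rw [extChartAt_source]
    exact hy'
  have h1 : MDifferentiableAt (𝓡 n) 𝓘(ℝ, Euc n) (extChartAt (𝓡 n) c) x :=
    mdifferentiableAt_extChartAt hy'
  have h2 := hasMFDerivAt_chart_symm c' hy
  have h3 := h1.hasMFDerivAt.comp y h2
  refine ⟨_, h3.hasFDerivAt, ?_⟩
  have hz : extChartAt (𝓡 n) c x ∈ (extChartAt (𝓡 n) c).target :=
    (extChartAt (𝓡 n) c).map_source hxs
  have h4 := hasMFDerivAt_chart_symm c hz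
  have hxx : (extChartAt (𝓡 n) c).symm (extChartAt (𝓡 n) c x) = x :=
    (extChartAt (𝓡 n) c).left_inv hxs
  have h5 := h4.comp y h3
  have h6 : (extChartAt (𝓡 n) c').symm =ᶠ[𝓝 y]
      (extChartAt (𝓡 n) c).symm ∘ (extChartAt (𝓡 n) c ∘ (extChartAt (𝓡 n) c').symm) := by
    have : ∀ᶠ z in 𝓝 y, (extChartAt (𝓡 n) c').symm z ∈ (extChartAt (𝓡 n) c).source :=
      h2.continuousAt.eventually ((isOpen_extChartAt_source c).mem_nhds hxs)
    filter_upwards [this] with z hz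
    exact ((extChartAt (𝓡 n) c).left_inv hz).symm
  have h7 := hasMFDerivAt_unique h2 (h5.congr_of_eventuallyEq h6)
  -- Following the two charts back leads to a point which is equal to x only propositionally, so its
  -- tangent space is a different type and the derivative has to be transported.
  have h8 : ∀ x' : M, x' = x → HEq (chartDeriv (n := n) c x') (chartDeriv (n := n) c x) := by
    rintro x' rfl
    rfl
  refine h7.trans ?_
  exact congrArg (fun L : Euc n →L[ℝ] Euc n => L ∘L (mfderiv (𝓡 n) 𝓘(ℝ, Euc n)
    (extChartAt (𝓡 n) c) x ∘L chartDeriv c' x : Euc n →L[ℝ] Euc n))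
    (eq_of_heq (h8 ((extChartAt (𝓡 n) c).symm (extChartAt (𝓡 n) c x)) hxx))

end CoordinateFields

/-! ### The riemannian volume in a chart -/

section ChartVolume

variable {n : ℕ} {N : Type u} [TopologicalSpace N] [ChartedSpace (Euc n) N]
  [IsManifold (𝓡 n) ∞ N]

/-- The metric in the coordinates of the chart at `c`. -/
def gramForm (g : ManifoldMetric n N) (c x : N) : LinearMap.BilinForm ℝ (Euc n) :=
  LinearMap.mk₂ ℝ (fun v w => g.inner x (chartDeriv c x v) (chartDeriv c x w))
    (by intros; simp) (by intros; simp) (by intros; simp) (by intros; simp)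

theorem coordField_eq {c x : N} (hx : x ∈ (chartAt (Euc n) c).source) (a : Fin n) :
    coordField c a x = chartDeriv c x ((EuclideanSpace.basisFun (Fin n) ℝ).toBasis a) :=
  localFrame_eq_chartDeriv c x a hx

theorem coordGram_eq_toMatrix (g : ManifoldMetric n N) {c x : N}
    (hx : x ∈ (chartAt (Euc n) c).source) :
    coordGram g c x =
      LinearMap.BilinForm.toMatrix (EuclideanSpace.basisFun (Fin n) ℝ).toBasis
        (gramForm g c x) := by
  ext a b
  rw [LinearMap.BilinForm.toMatrix_apply, coordGram, Matrix.of_apply, coordField_eq hx,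
    coordField_eq hx]
  rfl

theorem injective_chartDeriv {c x : N} (hx : x ∈ (chartAt (Euc n) c).source) :
    Function.Injective (chartDeriv (n := n) c x) := by
  have hx' : x ∈ (trivializationAt (Euc n) (fun x : N => TangentSpace (𝓡 n) x) c).baseSet := by
    rw [TangentBundle.trivializationAt_baseSet]
    exact hx
  intro v w hvw
  have := congrArg ((trivializationAt (Euc n) (fun x : N => TangentSpace (𝓡 n) x)
    c).continuousLinearMapAt ℝ x) hvw
  rwa [chartDeriv, Trivialization.continuousLinearMapAt_symmL _ hx',
    Trivialization.continuousLinearMapAt_symmL _ hx'] at this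

theorem posDef_coordGram (g : ManifoldMetric n N) {c x : N}
    (hx : x ∈ (chartAt (Euc n) c).source) : (coordGram g c x).PosDef := by
  rw [coordGram_eq_toMatrix g hx]
  refine posDef_toMatrix _ _ (fun v w => g.symm x _ _) fun v hv => g.pos x _ fun h => hv ?_
  exact injective_chartDeriv hx (h.trans (map_zero _).symm)

/-- The density of the riemannian volume in the chart at `c`, as a function on the manifold. -/
def chartDensity (g : ManifoldMetric n N) (c x : N) : ℝ := Real.sqrt (coordGram g c x).det

theorem chartDensity_pos (g : ManifoldMetric n N) {c x : N}
    (hx : x ∈ (chartAt (Euc n) c).source) : 0 < chartDensity g c x :=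
  Real.sqrt_pos.2 (posDef_coordGram g hx).det_pos

/-- The Gram matrix becomes τᵀ G τ under the coordinate change, so its determinant is multiplied by
(det τ)² and the square root by |det τ|. -/
theorem chartDensity_change (g : ManifoldMetric n N) {c c' x : N}
    (hx : x ∈ (chartAt (Euc n) c).source) (hx' : x ∈ (chartAt (Euc n) c').source)
    {τ : Euc n →L[ℝ] Euc n} (hτ : chartDeriv c' x = chartDeriv c x ∘L τ) :
    chartDensity g c' x = |τ.det| * chartDensity g c x := by
  have h1 : gramForm g c' x = (gramForm g c x).comp τ.toLinearMap τ.toLinearMap := by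
    ext v w
    change g.inner x (chartDeriv c' x v) (chartDeriv c' x w) =
      g.inner x (chartDeriv c x (τ v)) (chartDeriv c x (τ w))
    rw [hτ]
    rfl
  set b := (EuclideanSpace.basisFun (Fin n) ℝ).toBasis
  rw [chartDensity, chartDensity, coordGram_eq_toMatrix g hx', coordGram_eq_toMatrix g hx, h1,
    LinearMap.BilinForm.toMatrix_comp b b, Matrix.det_mul, Matrix.det_mul, Matrix.det_transpose,
    LinearMap.det_toMatrix, mul_right_comm, ← sq, Real.sqrt_mul (sq_nonneg _), Real.sqrt_sq_eq_abs]

theorem extChartAt_image_eq {c : N} {s : Set N} (hs : s ⊆ (chartAt (Euc n) c).source) :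
    extChartAt (𝓡 n) c '' s =
      (extChartAt (𝓡 n) c).target ∩ (extChartAt (𝓡 n) c).symm ⁻¹' s := by
  refine (extChartAt (𝓡 n) c).image_eq_target_inter_inv_preimage ?_
  rw [extChartAt_source]
  exact hs

variable [MeasurableSpace N] [BorelSpace N]

theorem measurableSet_extChartAt_image {c : N} {s : Set N} (hm : MeasurableSet s)
    (hs : s ⊆ (chartAt (Euc n) c).source) : MeasurableSet (extChartAt (𝓡 n) c '' s) := by
  rw [extChartAt_image_eq hs]
  have hc := continuousOn_iff_continuous_domRestrict.1 (continuousOn_extChartAt_symm (I := 𝓡 n) c)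
  have := MeasurableSet.subtype_image (isOpen_extChartAt_target (I := 𝓡 n) c).measurableSet
    (hc.measurable hm)
  convert this using 1
  ext y
  simp [and_comm]

theorem aemeasurable_extChartAt_symm (c : N) : AEMeasurable (extChartAt (𝓡 n) c).symm
    ((volume : Measure (Euc n)).restrict (extChartAt (𝓡 n) c).target) :=
  (continuousOn_extChartAt_symm c).aemeasurable (isOpen_extChartAt_target c).measurableSet

theorem aemeasurable_chartDensity (g : ManifoldMetric n N) (c : N) :
    AEMeasurable (fun y => ENNReal.ofReal (Real.sqrt
      (coordGram g c ((extChartAt (𝓡 n) c).symm y)).det))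
      ((volume : Measure (Euc n)).restrict (extChartAt (𝓡 n) c).target) := by
  refine ENNReal.measurable_ofReal.comp_aemeasurable (ContinuousOn.aemeasurable
    (Real.continuous_sqrt.comp_continuousOn ((continuousOn_coordGram_det g c).comp
      (continuousOn_extChartAt_symm c) fun y hy => ?_))
    (isOpen_extChartAt_target c).measurableSet)
  rw [← extChartAt_source (𝓡 n)]
  exact (extChartAt (𝓡 n) c).map_target hy

theorem chartVolume_apply (g : ManifoldMetric n N) {c : N} {s : Set N} (hm : MeasurableSet s)
    (hs : s ⊆ (chartAt (Euc n) c).source) :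
    chartVolume g c s = ∫⁻ y in extChartAt (𝓡 n) c '' s,
      ENNReal.ofReal (chartDensity g c ((extChartAt (𝓡 n) c).symm y)) := by
  have h1 := aemeasurable_extChartAt_symm (n := n) c
  have h2 := h1.mono_ac (withDensity_absolutelyContinuous _ (fun y => ENNReal.ofReal (Real.sqrt
      (coordGram g c ((extChartAt (𝓡 n) c).symm y)).det)))
  have h3 : ∀ u : Set (Euc n), (extChartAt (𝓡 n) c).target ∩ u = u ∩ (extChartAt (𝓡 n) c).target :=
    fun u => inter_comm _ _
  have hnull : NullMeasurableSet ((extChartAt (𝓡 n) c).symm ⁻¹' s)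
      ((volume : Measure (Euc n)).restrict (extChartAt (𝓡 n) c).target) :=
    h1.nullMeasurable hm
  rw [chartVolume, Measure.map_apply_of_aemeasurable h2 hm, withDensity_apply₀ _ hnull,
    Measure.restrict_restrict₀ hnull, extChartAt_image_eq hs, inter_comm]
  rfl

/-- Change of variables along φ ∘ φ'⁻¹: the Jacobian factor is exactly the ratio of the two
densities. -/
theorem chartVolume_eq_of_subset (g : ManifoldMetric n N) {c c' : N} {s : Set N}
    (hm : MeasurableSet s) (hs : s ⊆ (chartAt (Euc n) c).source)
    (hs' : s ⊆ (chartAt (Euc n) c').source) : chartVolume g c s = chartVolume g c' s := by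
  rw [chartVolume_apply g hm hs, chartVolume_apply g hm hs']
  set φ := extChartAt (𝓡 n) c with hφ
  set φ' := extChartAt (𝓡 n) c' with hφ'
  have hsrc : ∀ x ∈ s, x ∈ φ.source := fun x hx => by
    rw [hφ, extChartAt_source]
    exact hs hx
  have hsrc' : ∀ x ∈ s, x ∈ φ'.source := fun x hx => by
    rw [hφ', extChartAt_source]
    exact hs' hx
  have himg : φ '' s = (φ ∘ φ'.symm) '' (φ' '' s) := by
    rw [image_image]
    refine image_congr fun x hx => ?_
    rw [Function.comp_apply, φ'.left_inv (hsrc' x hx)]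
  -- The change of variables formula takes a derivative defined at every y; outside the image of s
  -- its value is irrelevant and is set to 0.
  have hτ : ∀ y : Euc n, ∃ τ : Euc n →L[ℝ] Euc n, y ∈ φ' '' s → HasFDerivAt (φ ∘ φ'.symm) τ y ∧
      chartDeriv c' (φ'.symm y) = chartDeriv c (φ'.symm y) ∘L τ := by
    intro y
    by_cases hy : y ∈ φ' '' s
    · obtain ⟨x, hx, rfl⟩ := hy
      obtain ⟨τ, h1, h2⟩ := hasFDerivAt_chart_comp_chart_symm (n := n) c c'
        (φ'.map_source (hsrc' x hx)) (by rw [φ'.left_inv (hsrc' x hx)]; exact hs hx)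
      exact ⟨τ, fun _ => ⟨h1, h2⟩⟩
    · exact ⟨0, fun h => absurd h hy⟩
  choose τ hτ using hτ
  have hinj : InjOn (φ ∘ φ'.symm) (φ' '' s) := by
    rintro _ ⟨x, hx, rfl⟩ _ ⟨z, hz, rfl⟩ h
    simp only [Function.comp_apply, φ'.left_inv (hsrc' x hx), φ'.left_inv (hsrc' z hz)] at h
    rw [φ.injOn (hsrc x hx) (hsrc z hz) h]
  rw [himg, lintegral_image_eq_lintegral_abs_det_fderiv_mul volume
    (measurableSet_extChartAt_image hm hs') (fun y hy => (hτ y hy).1.hasFDerivWithinAt) hinj]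
  refine setLIntegral_congr_fun (measurableSet_extChartAt_image hm hs') ?_
  rintro _ ⟨x, hx, rfl⟩
  have h := hτ (φ' x) ⟨x, hx, rfl⟩
  simp only [Function.comp_apply]
  rw [φ'.left_inv (hsrc' x hx)] at h
  rw [φ'.left_inv (hsrc' x hx), φ.left_inv (hsrc x hx),
    chartDensity_change g (hs hx) (hs' hx) h.2, ENNReal.ofReal_mul (abs_nonneg _)]

variable [T2Space N]

/-- The weight ρ_d lives in the domain of the chart at d, where the volume of that chart may be
replaced by the one of the chart at c; the weights then sum to 1. In particular the arbitrary choice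
of ρ is immaterial. -/
theorem riemannianVolume_apply [CompactSpace N] (g : ManifoldMetric n N) {c : N} {s : Set N}
    (hm : MeasurableSet s) (hs : s ⊆ (chartAt (Euc n) c).source) :
    riemannianVolume g s = chartVolume g c s := by
  set ρ := (SmoothPartitionOfUnity.exists_isSubordinate_chartAt_source (𝓡 n) N).choose with hρ
  have hsub := (SmoothPartitionOfUnity.exists_isSubordinate_chartAt_source (𝓡 n) N).choose_spec
  have hρm : ∀ c, Measurable fun x => ENNReal.ofReal (ρ c x) := fun c =>
    ENNReal.measurable_ofReal.comp (ρ c).contMDiff.continuous.measurable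
  have hfin : {c | (Function.support (ρ c) ∩ (univ : Set N)).Nonempty}.Finite :=
    ρ.locallyFinite.finite_nonempty_inter_compact isCompact_univ
  have hzero : ∀ d ∉ hfin.toFinset, ∀ x, ρ d x = 0 := by
    intro d hd x
    by_contra hne
    exact hd (hfin.mem_toFinset.2 ⟨x, hne, mem_univ _⟩)
  have hchart : ∀ d, ∫⁻ x in s, ENNReal.ofReal (ρ d x) ∂(chartVolume g d) =
      ∫⁻ x in s, ENNReal.ofReal (ρ d x) ∂(chartVolume g c) := by
    intro d
    set O := (chartAt (Euc n) d).source
    have hO : MeasurableSet O := (chartAt (Euc n) d).open_source.measurableSet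
    have h1 : ∀ μ : Measure N, ∫⁻ x in s, ENNReal.ofReal (ρ d x) ∂μ =
        ∫⁻ x in s ∩ O, ENNReal.ofReal (ρ d x) ∂μ := by
      intro μ
      have hind : (fun x => ENNReal.ofReal (ρ d x)) =
          O.indicator fun x => ENNReal.ofReal (ρ d x) := by
        ext x
        by_cases hx : x ∈ O
        · rw [indicator_of_mem hx]
        · rw [indicator_of_notMem hx, image_eq_zero_of_notMem_tsupport fun h => hx (hsub d h),
            ENNReal.ofReal_zero]
      conv_lhs => rw [hind]
      rw [setLIntegral_indicator hO, inter_comm]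
    have h2 : (chartVolume g d).restrict (s ∩ O) = (chartVolume g c).restrict (s ∩ O) := by
      ext t ht
      rw [Measure.restrict_apply ht, Measure.restrict_apply ht]
      exact chartVolume_eq_of_subset g (ht.inter (hm.inter hO))
        (fun x hx => hx.2.2) (fun x hx => hs hx.2.1)
    rw [h1, h1, h2]
  rw [riemannianVolume, Measure.sum_apply _ hm, ← hρ, tsum_eq_sum (s := hfin.toFinset)]
  · have : ∀ d ∈ hfin.toFinset, (chartVolume g d).withDensity
        (fun x => ENNReal.ofReal (ρ d x)) s =
        ∫⁻ x in s, ENNReal.ofReal (ρ d x) ∂(chartVolume g c) := fun d _ => by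
      rw [withDensity_apply _ hm, hchart]
    rw [Finset.sum_congr rfl this, ← lintegral_finsetSum _ fun d _ => hρm d]
    have hone : ∀ x, ∑ d ∈ hfin.toFinset, ENNReal.ofReal (ρ d x) = 1 := by
      intro x
      rw [← ENNReal.ofReal_sum_of_nonneg fun d _ => ρ.nonneg d x, ← ENNReal.ofReal_one,
        ← ρ.sum_eq_one (mem_univ x), finsum_eq_sum_of_support_subset]
      intro d hd
      by_contra h
      exact hd (hzero d h x)
    simp only [hone]
    simp
  · intro d hd
    simp [hzero d hd]

theorem riemannianVolume_restrict_chart [CompactSpace N] (g : ManifoldMetric n N) (c : N) :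
    (riemannianVolume g).restrict (chartAt (Euc n) c).source = chartVolume g c := by
  have hO : MeasurableSet (chartAt (Euc n) c).source := (chartAt (Euc n) c).open_source.measurableSet
  have hmap : MapsTo (extChartAt (𝓡 n) c).symm (extChartAt (𝓡 n) c).target
      (chartAt (Euc n) c).source := by
    intro y hy
    rw [← extChartAt_source (𝓡 n)]
    exact (extChartAt (𝓡 n) c).map_target hy
  have hzero : chartVolume g c (chartAt (Euc n) c).sourceᶜ = 0 := by
    have h1 := aemeasurable_extChartAt_symm (n := n) c
    have h2 := h1.mono_ac (withDensity_absolutelyContinuous _ (fun y => ENNReal.ofReal (Real.sqrt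
      (coordGram g c ((extChartAt (𝓡 n) c).symm y)).det)))
    rw [chartVolume, Measure.map_apply_of_aemeasurable h2 hO.compl]
    refine withDensity_absolutelyContinuous _ _ ?_
    rw [Measure.restrict_apply₀ (h1.nullMeasurable hO.compl)]
    convert measure_empty (μ := (volume : Measure (Euc n)))
    exact eq_empty_of_forall_notMem fun y hy => hy.1 (hmap hy.2)
  ext t ht
  rw [Measure.restrict_apply ht, riemannianVolume_apply g (ht.inter hO) inter_subset_right,
    ← measure_inter_add_sdiff t hO, measure_mono_null (sdiff_subset_compl _ _) hzero, add_zero]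

/-- The density is strictly positive in each chart. The fundamental lemma of the calculus of
variations, hence the uniqueness of laplacians, depends on this. -/
instance isOpenPosMeasure_riemannianVolume [CompactSpace N] (g : ManifoldMetric n N) :
    (riemannianVolume g).IsOpenPosMeasure := by
  refine ⟨fun O hO ⟨x, hx⟩ h0 => ?_⟩
  set s := O ∩ (chartAt (Euc n) x).source with hs
  have hso : IsOpen s := hO.inter (chartAt (Euc n) x).open_source
  have h1 : riemannianVolume g s = 0 := measure_mono_null inter_subset_left h0
  rw [riemannianVolume_apply g hso.measurableSet inter_subset_right,
    chartVolume_apply g hso.measurableSet inter_subset_right] at h1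
  have hopen : IsOpen (extChartAt (𝓡 n) x '' s) := by
    rw [extChartAt_image_eq inter_subset_right]
    exact (continuousOn_extChartAt_symm x).isOpen_inter_preimage (isOpen_extChartAt_target x) hso
  have hne : (extChartAt (𝓡 n) x '' s).Nonempty :=
    ⟨_, x, ⟨hx, mem_chart_source (Euc n) x⟩, rfl⟩
  have hmap : ∀ y ∈ extChartAt (𝓡 n) x '' s,
      (extChartAt (𝓡 n) x).symm y ∈ (chartAt (Euc n) x).source := by
    intro y hy
    rw [extChartAt_image_eq inter_subset_right] at hy
    exact hy.2.2
  have hpos := hopen.measure_pos (volume : Measure (Euc n)) hne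
  have hsub : extChartAt (𝓡 n) x '' s ⊆ (extChartAt (𝓡 n) x).target := by
    rw [extChartAt_image_eq inter_subset_right]
    exact inter_subset_left
  have hae : AEMeasurable (fun y => ENNReal.ofReal (chartDensity g x
      ((extChartAt (𝓡 n) x).symm y))) (volume.restrict (extChartAt (𝓡 n) x '' s)) :=
    (aemeasurable_chartDensity g x).mono_measure (Measure.restrict_mono hsub le_rfl)
  rw [lintegral_eq_zero_iff' hae] at h1
  have h2 : ∀ᵐ y ∂(volume.restrict (extChartAt (𝓡 n) x '' s)), False := by
    filter_upwards [h1, ae_restrict_mem hopen.measurableSet] with y hy hys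
    have := chartDensity_pos g (hmap y hys)
    exact (ENNReal.ofReal_pos.2 this).ne' hy
  rw [ae_iff] at h2
  simp only [not_false_eq_true, ofPred_true, Measure.restrict_apply_univ] at h2
  exact hpos.ne' h2

/-- The integral of a function with support in the domain of a chart, in coordinates. -/
theorem integral_riemannianVolume_eq [CompactSpace N] (g : ManifoldMetric n N) (c : N) {F : N → ℝ}
    (hF : AEStronglyMeasurable F (riemannianVolume g))
    (h0 : ∀ x ∉ (chartAt (Euc n) c).source, F x = 0) :
    ∫ x, F x ∂(riemannianVolume g) = ∫ y in (extChartAt (𝓡 n) c).target,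
      chartDensity g c ((extChartAt (𝓡 n) c).symm y) * F ((extChartAt (𝓡 n) c).symm y) := by
  have h1 := aemeasurable_extChartAt_symm (n := n) c
  have h2 := h1.mono_ac (withDensity_absolutelyContinuous _ (fun y => ENNReal.ofReal (Real.sqrt
      (coordGram g c ((extChartAt (𝓡 n) c).symm y)).det)))
  have hF' : AEStronglyMeasurable F (chartVolume g c) := by
    rw [← riemannianVolume_restrict_chart]
    exact hF.restrict
  rw [← setIntegral_eq_integral_of_forall_compl_eq_zero h0, riemannianVolume_restrict_chart]
  rw [chartVolume] at hF' ⊢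
  rw [integral_map h2 hF', integral_withDensity_eq_integral_toReal_smul₀
    (aemeasurable_chartDensity g c) (ae_of_all _ fun _ => ENNReal.ofReal_lt_top)]
  refine integral_congr_ae (ae_of_all _ fun y => ?_)
  simp only [smul_eq_mul]
  rw [ENNReal.toReal_ofReal (Real.sqrt_nonneg _)]
  rfl

end ChartVolume

/-! ### Smoothness of the metric coefficients -/

section MetricCoefficients

variable {n : ℕ} {N : Type u} [TopologicalSpace N] [ChartedSpace (Euc n) N]
  [IsManifold (𝓡 n) ∞ N]

theorem contMDiffOn_coordField (c : N) (a : Fin n) :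
    ContMDiffOn (𝓡 n) ((𝓡 n).prod (𝓡 n)) ∞
      (fun x : N => TotalSpace.mk' (Euc n) (E := fun x : N => TangentSpace (𝓡 n) x) x
        (coordField c a x)) (chartAt (Euc n) c).source := by
  have := (trivializationAt (Euc n) (fun x : N => TangentSpace (𝓡 n) x)
    c).contMDiffOn_localFrame_baseSet (I := 𝓡 n) ∞ (EuclideanSpace.basisFun (Fin n) ℝ).toBasis a
  rw [TangentBundle.trivializationAt_baseSet] at this
  exact this

theorem contMDiffOn_coordGram (g : ManifoldMetric n N) (c : N) (a b : Fin n) :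
    ContMDiffOn (𝓡 n) 𝓘(ℝ, ℝ) ∞ (fun x => coordGram g c x a b) (chartAt (Euc n) c).source := by
  have h2 : ContMDiffOn (𝓡 n) ((𝓡 n).prod 𝓘(ℝ, ℝ)) ∞
      (fun x => TotalSpace.mk' ℝ (E := Bundle.Trivial N ℝ) x
        (g.inner x (coordField c a x) (coordField c b x))) (chartAt (Euc n) c).source :=
    ContMDiffOn.clm_bundle_apply₂ (F₁ := Euc n) (F₂ := Euc n)
      (g.contMDiff.contMDiffOn) (contMDiffOn_coordField c a) (contMDiffOn_coordField c b)
  intro x hx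
  have h3 := h2 x hx
  rw [contMDiffWithinAt_totalSpace] at h3
  exact h3.2

theorem contMDiffOn_matrix_det {M : Type*} [TopologicalSpace M] [ChartedSpace (Euc n) M]
    {ι : Type*} [Fintype ι] [DecidableEq ι] {s : Set M} {A : M → Matrix ι ι ℝ}
    (hA : ∀ a b, ContMDiffOn (𝓡 n) 𝓘(ℝ, ℝ) ∞ (fun x => A x a b) s) :
    ContMDiffOn (𝓡 n) 𝓘(ℝ, ℝ) ∞ (fun x => (A x).det) s := by
  simp only [Matrix.det_apply']
  exact contMDiffOn_finsetSum fun σ _ => contMDiffOn_const.mul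
    (contMDiffOn_finsetProd fun a _ => hA _ _)

/-- By Cramer's rule the entries of the inverse are quotients of polynomials in the entries by the
determinant. -/
theorem contMDiffOn_matrix_inv {M : Type*} [TopologicalSpace M] [ChartedSpace (Euc n) M]
    {ι : Type*} [Fintype ι] [DecidableEq ι] {s : Set M} {A : M → Matrix ι ι ℝ}
    (hA : ∀ a b, ContMDiffOn (𝓡 n) 𝓘(ℝ, ℝ) ∞ (fun x => A x a b) s)
    (h0 : ∀ x ∈ s, (A x).det ≠ 0) (a b : ι) :
    ContMDiffOn (𝓡 n) 𝓘(ℝ, ℝ) ∞ (fun x => (A x)⁻¹ a b) s := by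
  simp only [Matrix.inv_def, Ring.inverse_eq_inv', Matrix.smul_apply, Matrix.adjugate_apply,
    smul_eq_mul]
  refine ((contMDiffOn_matrix_det hA).inv₀ h0).mul (contMDiffOn_matrix_det fun i j => ?_)
  by_cases hi : i = b
  · subst hi
    simp only [Matrix.updateRow_self]
    exact contMDiffOn_const
  · simp only [Matrix.updateRow_ne hi]
    exact hA i j

theorem contMDiffOn_coordGram_inv (g : ManifoldMetric n N) (c : N) (a b : Fin n) :
    ContMDiffOn (𝓡 n) 𝓘(ℝ, ℝ) ∞ (fun x => (coordGram g c x)⁻¹ a b)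
      (chartAt (Euc n) c).source :=
  contMDiffOn_matrix_inv (contMDiffOn_coordGram g c)
    (fun _ hx => (posDef_coordGram g hx).det_pos.ne') a b

theorem contMDiffOn_chartDensity (g : ManifoldMetric n N) (c : N) :
    ContMDiffOn (𝓡 n) 𝓘(ℝ, ℝ) ∞ (chartDensity g c) (chartAt (Euc n) c).source := by
  intro x hx
  exact (Real.contDiffAt_sqrt (posDef_coordGram g hx).det_pos.ne').contMDiffAt.comp_contMDiffWithinAt
    x (contMDiffOn_matrix_det (contMDiffOn_coordGram g c) x hx)

/-- The derivative of a function along a coordinate vector field. -/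
def coordDeriv (c : N) (b : Fin n) (p : N → ℝ) (x : N) : ℝ :=
  mvfderiv (𝓡 n) p x (coordField c b x)

theorem coordDeriv_mul (c : N) (b : Fin n) {p q : N → ℝ} {x : N}
    (hp : MDifferentiableAt (𝓡 n) 𝓘(ℝ, ℝ) p x) (hq : MDifferentiableAt (𝓡 n) 𝓘(ℝ, ℝ) q x) :
    coordDeriv c b (fun y => p y * q y) x =
      p x * coordDeriv c b q x + q x * coordDeriv c b p x := by
  have := mvfderiv_mul hp hq
  rw [coordDeriv, show (fun y => p y * q y) = p * q from rfl, this]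
  rfl

theorem coordDeriv_eq_zero_of_notMem_tsupport (c : N) (b : Fin n) {p : N → ℝ} {x : N}
    (hx : x ∉ tsupport p) : coordDeriv c b p x = 0 := by
  have h : p =ᶠ[𝓝 x] fun _ => 0 := notMem_tsupport_iff_eventuallyEq.1 hx
  rw [coordDeriv, mvfderiv, h.mfderiv_eq, mfderiv_const]
  rfl

theorem contMDiffOn_coordDeriv (c : N) (b : Fin n) {p : N → ℝ}
    (hp : ContMDiff (𝓡 n) 𝓘(ℝ, ℝ) ∞ p) :
    ContMDiffOn (𝓡 n) 𝓘(ℝ, ℝ) ∞ (coordDeriv c b p) (chartAt (Euc n) c).source := by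
  have h1 : ContMDiff (𝓡 n).tangent 𝓘(ℝ, ℝ).tangent ∞ (tangentMap (𝓡 n) 𝓘(ℝ, ℝ) p) :=
    hp.contMDiff_tangentMap (by simp)
  have h2 := h1.comp_contMDiffOn (contMDiffOn_coordField c b)
  exact (contMDiff_snd_tangentBundle_modelSpace ℝ 𝓘(ℝ, ℝ)).comp_contMDiffOn h2

end MetricCoefficients

/-! ### Integration by parts -/

section Divergence

variable {n : ℕ} {N : Type u} [TopologicalSpace N] [ChartedSpace (Euc n) N]
  [IsManifold (𝓡 n) ∞ N]

/-- A function which is smooth on an open set that contains its support is smooth. -/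
theorem contMDiff_of_contMDiffOn_of_tsupport_subset {p : N → ℝ} {O : Set N} (hO : IsOpen O)
    (hp : ContMDiffOn (𝓡 n) 𝓘(ℝ, ℝ) ∞ p O) (hs : tsupport p ⊆ O) :
    ContMDiff (𝓡 n) 𝓘(ℝ, ℝ) ∞ p :=
  contMDiff_of_tsupport fun _ hx => hp.contMDiffAt (hO.mem_nhds (hs hx))

open scoped Classical in
/-- The expression of a function in the coordinates of the chart at `c`, extended by zero. -/
def chartRep (c : N) (p : N → ℝ) (y : Euc n) : ℝ :=
  if y ∈ (extChartAt (𝓡 n) c).target then p ((extChartAt (𝓡 n) c).symm y) else 0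

theorem chartRep_of_mem {c : N} {p : N → ℝ} {y : Euc n} (hy : y ∈ (extChartAt (𝓡 n) c).target) :
    chartRep c p y = p ((extChartAt (𝓡 n) c).symm y) := if_pos hy

theorem chartRep_of_notMem {c : N} {p : N → ℝ} {y : Euc n}
    (hy : y ∉ (extChartAt (𝓡 n) c).target) : chartRep c p y = 0 := if_neg hy

theorem chart_symm_mem_source {c : N} {y : Euc n} (hy : y ∈ (extChartAt (𝓡 n) c).target) :
    (extChartAt (𝓡 n) c).symm y ∈ (chartAt (Euc n) c).source := by
  rw [← extChartAt_source (𝓡 n)]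
  exact (extChartAt (𝓡 n) c).map_target hy

theorem isCompact_extChartAt_image {c : N} {K : Set N} (hK : IsCompact K)
    (hs : K ⊆ (chartAt (Euc n) c).source) : IsCompact (extChartAt (𝓡 n) c '' K) :=
  hK.image_of_continuousOn ((continuousOn_extChartAt c).mono (by rwa [extChartAt_source]))

theorem extChartAt_image_subset_target {c : N} {K : Set N}
    (hs : K ⊆ (chartAt (Euc n) c).source) :
    extChartAt (𝓡 n) c '' K ⊆ (extChartAt (𝓡 n) c).target := by
  rw [extChartAt_image_eq hs]
  exact inter_subset_left

theorem tsupport_chartRep_subset {c : N} {K : Set N} (hK : IsCompact K)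
    (hs : K ⊆ (chartAt (Euc n) c).source) {p : N → ℝ} (hp : tsupport p ⊆ K) :
    tsupport (chartRep (n := n) c p) ⊆ extChartAt (𝓡 n) c '' K := by
  refine closure_minimal (fun y hy => ?_) (isCompact_extChartAt_image hK hs).isClosed
  by_cases hyt : y ∈ (extChartAt (𝓡 n) c).target
  · rw [Function.mem_support, chartRep_of_mem hyt] at hy
    exact ⟨_, hp (subset_tsupport _ hy), (extChartAt (𝓡 n) c).right_inv hyt⟩
  · exact absurd (chartRep_of_notMem hyt) hy

theorem chartRep_eventuallyEq {c : N} {p : N → ℝ} {y : Euc n}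
    (hy : y ∈ (extChartAt (𝓡 n) c).target) :
    chartRep c p =ᶠ[𝓝 y] p ∘ (extChartAt (𝓡 n) c).symm := by
  filter_upwards [(isOpen_extChartAt_target (I := 𝓡 n) c).mem_nhds hy] with z hz
  exact chartRep_of_mem hz

theorem contDiff_chartRep {c : N} {K : Set N} (hK : IsCompact K)
    (hs : K ⊆ (chartAt (Euc n) c).source) {p : N → ℝ} (hp : ContMDiff (𝓡 n) 𝓘(ℝ, ℝ) ∞ p)
    (hpK : tsupport p ⊆ K) : ContDiff ℝ 1 (chartRep (n := n) c p) := by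
  rw [← contMDiff_iff_contDiff]
  refine contMDiff_of_tsupport fun y hy => ?_
  have hyt := extChartAt_image_subset_target hs (tsupport_chartRep_subset hK hs hpK hy)
  have h1 : ContMDiffAt 𝓘(ℝ, Euc n) 𝓘(ℝ, ℝ) 1 (p ∘ (extChartAt (𝓡 n) c).symm) y :=
    ((hp.of_le (by simp)).contMDiffAt).comp y
      (((contMDiffOn_extChartAt_symm (n := ∞) c).contMDiffAt
        ((isOpen_extChartAt_target c).mem_nhds hyt)).of_le (by simp))
  exact h1.congr_of_eventuallyEq (chartRep_eventuallyEq hyt)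

theorem fderiv_chartRep {c : N} {p : N → ℝ} (hp : ContMDiff (𝓡 n) 𝓘(ℝ, ℝ) ∞ p) {y : Euc n}
    (hy : y ∈ (extChartAt (𝓡 n) c).target) (b : Fin n) :
    fderiv ℝ (chartRep c p) y ((EuclideanSpace.basisFun (Fin n) ℝ).toBasis b) =
      coordDeriv c b p ((extChartAt (𝓡 n) c).symm y) := by
  rw [(chartRep_eventuallyEq hy).fderiv_eq,
    (hasFDerivAt_comp_chart_symm c hy ((hp.mdifferentiable (by simp)) _)).fderiv, coordDeriv,
    coordField_eq (chart_symm_mem_source hy)]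
  rfl

/-- The integral of a derivative of a function with support in the domain of a chart. -/
theorem integral_coordDeriv_eq_zero {c : N} {K : Set N} (hK : IsCompact K)
    (hs : K ⊆ (chartAt (Euc n) c).source) {p : N → ℝ} (hp : ContMDiff (𝓡 n) 𝓘(ℝ, ℝ) ∞ p)
    (hpK : tsupport p ⊆ K) (b : Fin n) :
    ∫ y in (extChartAt (𝓡 n) c).target, coordDeriv c b p ((extChartAt (𝓡 n) c).symm y) = 0 := by
  set e : Euc n := (EuclideanSpace.basisFun (Fin n) ℝ).toBasis b
  have hP := contDiff_chartRep hK hs hp hpK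
  have hc : HasCompactSupport (chartRep (n := n) c p) :=
    (isCompact_extChartAt_image hK hs).of_isClosed_subset (isClosed_tsupport _)
      (tsupport_chartRep_subset hK hs hpK)
  have hd : Continuous fun y => fderiv ℝ (chartRep c p) y e :=
    (hP.continuous_fderiv one_ne_zero).clm_apply continuous_const
  have hdc : HasCompactSupport fun y => fderiv ℝ (chartRep c p) y e :=
    (hc.fderiv ℝ).comp_left (g := fun L : Euc n →L[ℝ] ℝ => L e) rfl
  -- Integration by parts against the constant function 1.
  have h := integral_mul_fderiv_eq_neg_fderiv_mul_of_integrable (μ := (volume : Measure (Euc n)))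
    (f := fun _ => (1 : ℝ)) (g := chartRep (n := n) c p) (v := e) (by simp)
    (by simpa using hd.integrable_of_hasCompactSupport hdc)
    (by simpa using hP.continuous.integrable_of_hasCompactSupport hc)
    (fun _ _ => differentiableAt_const _) (fun _ _ => hP.differentiable one_ne_zero _)
  simp only [one_mul, fderiv_fun_const, Pi.zero_apply, zero_apply, zero_mul, integral_zero,
    neg_zero] at h
  rw [← h, ← setIntegral_eq_integral_of_forall_compl_eq_zero (s := (extChartAt (𝓡 n) c).target)
    (f := fun y => fderiv ℝ (chartRep c p) y e)]
  · refine setIntegral_congr_fun (isOpen_extChartAt_target (I := 𝓡 n) c).measurableSet fun y hy => ?_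
    exact (fderiv_chartRep hp hy b).symm
  · intro y hy
    have hy' : y ∉ tsupport (chartRep (n := n) c p) := fun h =>
      hy (extChartAt_image_subset_target hs (tsupport_chartRep_subset hK hs hpK h))
    rw [(notMem_tsupport_iff_eventuallyEq.1 hy').fderiv_eq]
    simp

variable [MeasurableSpace N] [BorelSpace N] [T2Space N] [CompactSpace N]

/-- Integration by parts: a coefficient `h` with support in the domain of a chart defines a first
order operator `h ∂_b` on `N` whose formal adjoint is `- h ∂_b + κ`. -/
theorem exists_integral_mul_coordDeriv_eq (g : ManifoldMetric n N) (c : N) (b : Fin n) {h : N → ℝ}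
    (hh : ContMDiff (𝓡 n) 𝓘(ℝ, ℝ) ∞ h) (hs : tsupport h ⊆ (chartAt (Euc n) c).source) :
    ∃ κ : N → ℝ, ContMDiff (𝓡 n) 𝓘(ℝ, ℝ) ∞ κ ∧ tsupport κ ⊆ tsupport h ∧
      ∀ p : N → ℝ, ContMDiff (𝓡 n) 𝓘(ℝ, ℝ) ∞ p →
        ∫ x, h x * coordDeriv c b p x ∂(riemannianVolume g) =
          ∫ x, κ x * p x ∂(riemannianVolume g) := by
  have hO := (chartAt (Euc n) c).open_source
  have hK : IsCompact (tsupport h) := (isClosed_tsupport h).isCompact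
  have hρ := contMDiffOn_chartDensity g c
  -- With ρ the density and r = h ρ, the function κ must make ρ (h ∂_b p - κ p) equal to ∂_b (r p),
  -- whose integral in the chart vanishes. This forces κ = -ρ⁻¹ ∂_b r.
  set r : N → ℝ := fun x => h x * chartDensity g c x with hr
  have hrs : tsupport r ⊆ tsupport h := closure_mono (Function.support_mul_subset_left _ _)
  have hrc : ContMDiff (𝓡 n) 𝓘(ℝ, ℝ) ∞ r :=
    contMDiff_of_contMDiffOn_of_tsupport_subset hO (hh.contMDiffOn.mul hρ) (hrs.trans hs)
  set κ : N → ℝ := fun x => -(coordDeriv c b r x * (chartDensity g c x)⁻¹) with hκ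
  have hκs : tsupport κ ⊆ tsupport h := by
    refine closure_minimal (fun x hx => ?_) (isClosed_tsupport h)
    by_contra hxn
    exact hx (by simp only [hκ, coordDeriv_eq_zero_of_notMem_tsupport c b fun h => hxn (hrs h),
      zero_mul, neg_zero])
  have hκc : ContMDiff (𝓡 n) 𝓘(ℝ, ℝ) ∞ κ := by
    refine contMDiff_of_contMDiffOn_of_tsupport_subset hO ?_ (hκs.trans hs)
    exact ((contMDiffOn_coordDeriv c b hrc).mul
      (hρ.inv₀ fun x hx => (chartDensity_pos g hx).ne')).neg
  refine ⟨κ, hκc, hκs, fun p hp => ?_⟩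
  have hzero : ∀ {q : N → ℝ}, tsupport q ⊆ tsupport h → ∀ x ∉ (chartAt (Euc n) c).source,
      q x = 0 := fun hq x hx => image_eq_zero_of_notMem_tsupport fun h => hx (hs (hq h))
  have hd : ContMDiff (𝓡 n) 𝓘(ℝ, ℝ) ∞ fun x => h x * coordDeriv c b p x :=
    contMDiff_of_contMDiffOn_of_tsupport_subset hO
      (hh.contMDiffOn.mul (contMDiffOn_coordDeriv c b hp))
      ((closure_mono (Function.support_mul_subset_left _ _)).trans hs)
  have hint : Integrable (fun x => h x * coordDeriv c b p x - κ x * p x) (riemannianVolume g) :=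
    ((hd.continuous).sub (hκc.continuous.mul hp.continuous)).integrable_of_hasCompactSupport
      (HasCompactSupport.of_compactSpace _)
  have hrp : tsupport (fun x => r x * p x) ⊆ tsupport h :=
    (closure_mono (Function.support_mul_subset_left _ _)).trans hrs
  have hint' := (hκc.continuous.mul hp.continuous).integrable_of_hasCompactSupport
    (μ := riemannianVolume g) (HasCompactSupport.of_compactSpace _)
  rw [← sub_eq_zero, ← integral_sub
    (hd.continuous.integrable_of_hasCompactSupport (HasCompactSupport.of_compactSpace _))
    (show Integrable (fun x => κ x * p x) _ from hint'),
    integral_riemannianVolume_eq g c hint.aestronglyMeasurable,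
    ← integral_coordDeriv_eq_zero hK hs (hrc.mul hp) hrp b]
  · refine setIntegral_congr_fun (isOpen_extChartAt_target (I := 𝓡 n) c).measurableSet fun y hy => ?_
    set x := (extChartAt (𝓡 n) c).symm y
    have hx : x ∈ (chartAt (Euc n) c).source := chart_symm_mem_source hy
    have hpos := (chartDensity_pos g hx).ne'
    have := coordDeriv_mul c b (hrc.mdifferentiable (by simp) x) (hp.mdifferentiable (by simp) x)
    refine Eq.trans ?_ this.symm
    simp only [hκ, hr]
    field_simp
    ring
  · intro x hx
    rw [hzero subset_rfl x hx, hzero hκs x hx]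
    simp

end Divergence

/-! ### Rellich's inequality in a chart -/

section ChartRellich

variable {n : ℕ} {N : Type u} [TopologicalSpace N] [ChartedSpace (Euc n) N]
  [IsManifold (𝓡 n) ∞ N] [MeasurableSpace N] [BorelSpace N] [T2Space N] [CompactSpace N]

theorem norm_sq_clm_eq_sum (L : Euc n →L[ℝ] ℝ) :
    ‖L‖ ^ 2 = ∑ b, L ((EuclideanSpace.basisFun (Fin n) ℝ).toBasis b) ^ 2 := by
  rw [← (InnerProductSpace.toDual ℝ (Euc n)).symm.norm_map L, EuclideanSpace.norm_sq_eq]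
  refine Finset.sum_congr rfl fun b _ => ?_
  rw [← InnerProductSpace.toDual_symm_apply (𝕜 := ℝ) (y := L), real_inner_comm]
  simp [EuclideanSpace.inner_single_left]

/-- On the compact set K the density of the volume is bounded above and away from 0, so the
Euclidean Rellich inequality transfers through the chart up to constants. -/
theorem integral_sq_le_of_tsupport_subset (g : ManifoldMetric n N) (c : N) {K : Set N}
    (hK : IsCompact K) (hs : K ⊆ (chartAt (Euc n) c).source) {ε : ℝ} (hε : 0 < ε) :
    ∃ (m : ℕ) (q : Fin m → N → ℝ) (M : ℝ),
      (∀ j, AEStronglyMeasurable (q j) (riemannianVolume g)) ∧ (∀ j x, |q j x| ≤ M) ∧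
      ∀ p : N → ℝ, ContMDiff (𝓡 n) 𝓘(ℝ, ℝ) ∞ p → tsupport p ⊆ K →
        ∫ x, p x ^ 2 ∂(riemannianVolume g) ≤
          ε * (∫ x, ∑ b : Fin n, coordDeriv c b p x ^ 2 ∂(riemannianVolume g)) +
            ∑ j, (∫ x, q j x * p x ∂(riemannianVolume g)) ^ 2 := by
  set φ := extChartAt (𝓡 n) c with hφ
  have hρK : ContinuousOn (chartDensity g c) K := (contMDiffOn_chartDensity g c).continuousOn.mono hs
  obtain ⟨A, hA0, hA⟩ : ∃ A, 0 < A ∧ ∀ x ∈ K, chartDensity g c x ≤ A := by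
    obtain ⟨A, hA⟩ := (hK.image_of_continuousOn hρK).bddAbove
    exact ⟨max A 1, by positivity, fun x hx => (hA ⟨x, hx, rfl⟩).trans (le_max_left _ _)⟩
  obtain ⟨B, hB0, hB⟩ : ∃ B, 0 < B ∧ ∀ x ∈ K, (chartDensity g c x)⁻¹ ≤ B := by
    obtain ⟨B, hB⟩ := (hK.image_of_continuousOn
      (hρK.inv₀ fun x hx => (chartDensity_pos g (hs hx)).ne')).bddAbove
    exact ⟨max B 1, by positivity, fun x hx => (hB ⟨x, hx, rfl⟩).trans (le_max_left _ _)⟩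
  -- Comparing Lebesgue measure with the volume costs a factor A for the square of p and a factor B
  -- for the square of its derivative; hence ε / (A B).
  obtain ⟨δ, a, S, ha, hmain⟩ := exists_finset_integral_sq_le
    (isCompact_extChartAt_image hK hs) (ε := ε / (A * B)) (by positivity)
  set k : Fin S.card → Fin n → ℤ := fun j => (S.equivFin.symm j : Fin n → ℤ) with hk
  -- The inverse density cancels the one in the volume, so that the integral of w j · p over N is
  -- √(A a) times the Lebesgue integral of p over the grid cube.
  set w : Fin S.card → N → ℝ := fun j => K.indicator fun x =>
    Real.sqrt (A * a) * (chartDensity g c x)⁻¹ * (gridCube δ (k j)).indicator 1 (φ x) with hw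
  have hKm : MeasurableSet K := hK.isClosed.measurableSet
  have hTm : MeasurableSet φ.target := (isOpen_extChartAt_target (I := 𝓡 n) c).measurableSet
  have hwm : ∀ j, AEStronglyMeasurable (w j) (riemannianVolume g) := by
    intro j
    refine AEMeasurable.aestronglyMeasurable ((aemeasurable_indicator_iff hKm).2 ?_)
    refine AEMeasurable.mul (((hρK.inv₀ fun x hx =>
      (chartDensity_pos g (hs hx)).ne').aemeasurable hKm).const_mul _) ?_
    refine Measurable.comp_aemeasurable (g := (gridCube δ (k j)).indicator 1)
      (measurable_one.indicator (measurableSet_gridCube δ (k j))) ?_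
    refine ContinuousOn.aemeasurable ((continuousOn_extChartAt c).mono ?_) hKm
    rwa [extChartAt_source]
  refine ⟨S.card, w, Real.sqrt (A * a) * B, hwm, fun j x => ?_, fun p hp hpK => ?_⟩
  · simp only [hw]
    by_cases hx : x ∈ K
    · have hpos := chartDensity_pos g (hs hx)
      rw [indicator_of_mem hx, abs_mul, abs_mul, abs_of_nonneg (Real.sqrt_nonneg _),
        abs_of_pos (inv_pos.2 hpos)]
      have h1 : |(gridCube δ (k j)).indicator (1 : Euc n → ℝ) (φ x)| ≤ 1 := by
        by_cases h : φ x ∈ gridCube δ (k j) <;> simp [h]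
      calc _ ≤ Real.sqrt (A * a) * B * 1 := by
            gcongr
            exact hB x hx
        _ = _ := mul_one _
    · rw [indicator_of_notMem hx, abs_zero]
      positivity
  · have hO := (chartAt (Euc n) c).open_source
    have hp0 : ∀ x ∉ K, p x = 0 := fun x hx => image_eq_zero_of_notMem_tsupport fun h => hx (hpK h)
    have hd0 : ∀ x ∉ K, ∀ b : Fin n, coordDeriv c b p x = 0 := fun x hx b =>
      coordDeriv_eq_zero_of_notMem_tsupport c b fun h => hx (hpK h)
    set D : N → ℝ := fun x => ∑ b : Fin n, coordDeriv c b p x ^ 2 with hD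
    have hDK : ∀ x ∉ K, D x = 0 := fun x hx => by simp [hD, hd0 x hx]
    have htK : ∀ {q : N → ℝ}, (∀ x ∉ K, q x = 0) → tsupport q ⊆ K := fun hq =>
      closure_minimal (fun x hx => by_contra fun h => hx (hq x h)) hK.isClosed
    have hDO : ContMDiffOn (𝓡 n) 𝓘(ℝ, ℝ) ∞ D (chartAt (Euc n) c).source :=
      contMDiffOn_finsetSum fun b _ => (contMDiffOn_coordDeriv c b hp).pow 2
    have hDs : ContMDiff (𝓡 n) 𝓘(ℝ, ℝ) ∞ D :=
      contMDiff_of_contMDiffOn_of_tsupport_subset hO hDO ((htK hDK).trans hs)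
    -- This product is the integrand of ∫ D in coordinates; being smooth with support in K, it is
    -- integrable there.
    set u : N → ℝ := fun x => chartDensity g c x * D x with hu
    have huK : tsupport u ⊆ K := htK fun x hx => by simp [hu, hDK x hx]
    have hus : ContMDiff (𝓡 n) 𝓘(ℝ, ℝ) ∞ u :=
      contMDiff_of_contMDiffOn_of_tsupport_subset hO ((contMDiffOn_chartDensity g c).mul hDO)
        (huK.trans hs)
    have hrep : ∀ {q : N → ℝ}, ContMDiff (𝓡 n) 𝓘(ℝ, ℝ) ∞ q → tsupport q ⊆ K →
        Continuous (chartRep (n := n) c q) ∧ HasCompactSupport (chartRep (n := n) c q) :=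
      fun hq hqK => ⟨(contDiff_chartRep hK hs hq hqK).continuous,
        (isCompact_extChartAt_image hK hs).of_isClosed_subset (isClosed_tsupport _)
          (tsupport_chartRep_subset hK hs hqK)⟩
    have hset : ∀ {F : Euc n → ℝ}, (∀ y ∉ φ.target, F y = 0) → ∫ y, F y = ∫ y in φ.target, F y :=
      fun hF => (setIntegral_eq_integral_of_forall_compl_eq_zero hF).symm
    obtain ⟨hPc, hPs⟩ := hrep hp hpK
    set P := chartRep (n := n) c p with hP
    have hvol : ∀ {F : N → ℝ}, AEStronglyMeasurable F (riemannianVolume g) → (∀ x ∉ K, F x = 0) →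
        ∫ x, F x ∂(riemannianVolume g) =
          ∫ y in φ.target, chartDensity g c (φ.symm y) * F (φ.symm y) := fun hF h0 =>
      integral_riemannianVolume_eq g c hF fun x hx => h0 x fun h => hx (hs h)
    have hP2 : Integrable (fun y => A * P y ^ 2) (volume : Measure (Euc n)) := by
      refine Integrable.const_mul ?_ A
      refine Continuous.integrable_of_hasCompactSupport (hPc.pow 2) ?_
      exact HasCompactSupport.comp_left (g := fun t : ℝ => t ^ 2) hPs (by simp)
    have h1 : ∫ x, p x ^ 2 ∂(riemannianVolume g) ≤ A * ∫ y, P y ^ 2 := by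
      rw [hvol (F := fun x => p x ^ 2) (hp.continuous.pow 2).aestronglyMeasurable fun x hx => by simp [hp0 x hx],
        hset fun y hy => by rw [hP, chartRep_of_notMem hy]; simp, ← integral_const_mul]
      refine integral_mono_of_nonneg (ae_restrict_of_forall_mem hTm fun y hy => ?_) ?_
        (ae_restrict_of_forall_mem hTm fun y hy => ?_)
      · exact mul_nonneg (chartDensity_pos g (chart_symm_mem_source hy)).le (sq_nonneg _)
      · exact hP2.restrict
      · change _ ≤ A * P y ^ 2
        rw [hP, chartRep_of_mem hy]
        by_cases hx : φ.symm y ∈ K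
        · exact mul_le_mul_of_nonneg_right (hA _ hx) (sq_nonneg _)
        · change chartDensity g c (φ.symm y) * p (φ.symm y) ^ 2 ≤ A * p (φ.symm y) ^ 2
          rw [hp0 _ hx]
          simp
    have h2 : ∫ y, ‖fderiv ℝ P y‖ ^ 2 ≤ B * ∫ x, D x ∂(riemannianVolume g) := by
      obtain ⟨huc, hucs⟩ := hrep hus huK
      rw [hvol hDs.continuous.aestronglyMeasurable hDK, ← integral_const_mul,
        hset (F := fun y => ‖fderiv ℝ P y‖ ^ 2)]
      · refine integral_mono_of_nonneg (ae_of_all _ fun y => sq_nonneg _) ?_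
          (ae_restrict_of_forall_mem hTm fun y hy => ?_)
        · refine (IntegrableOn.congr_fun (f := chartRep (n := n) c u)
            (huc.integrable_of_hasCompactSupport hucs).integrableOn (fun y hy => ?_) hTm).const_mul B
          exact chartRep_of_mem hy
        · simp only
          rw [norm_sq_clm_eq_sum]
          simp only [hP, fderiv_chartRep hp hy]
          change D (φ.symm y) ≤ B * (chartDensity g c (φ.symm y) * D (φ.symm y))
          by_cases hx : φ.symm y ∈ K
          · have hpos := chartDensity_pos g (hs hx)
            have h1 : 1 ≤ B * chartDensity g c (φ.symm y) := by
              calc 1 = (chartDensity g c (φ.symm y))⁻¹ * chartDensity g c (φ.symm y) := by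
                    field_simp
                _ ≤ _ := mul_le_mul_of_nonneg_right (hB _ hx) hpos.le
            rw [← mul_assoc]
            exact le_mul_of_one_le_left (Finset.sum_nonneg fun _ _ => sq_nonneg _) h1
          · rw [hDK _ hx]
            simp
      · intro y hy
        have hy' : y ∉ tsupport P := fun h =>
          hy (extChartAt_image_subset_target hs (tsupport_chartRep_subset hK hs hpK h))
        rw [(notMem_tsupport_iff_eventuallyEq.1 hy').fderiv_eq]
        simp
    have h3 : ∀ j, A * (a * (∫ y in gridCube δ (k j), P y) ^ 2) =
        (∫ x, w j x * p x ∂(riemannianVolume g)) ^ 2 := by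
      intro j
      have hw0 : ∀ x ∉ K, w j x = 0 := fun x hx => indicator_of_notMem hx _
      have hPQ : ∫ y in gridCube δ (k j), P y =
          ∫ y in φ.target, (gridCube δ (k j)).indicator P y := by
        rw [← integral_indicator (measurableSet_gridCube δ (k j))]
        refine hset fun y hy => ?_
        by_cases h : y ∈ gridCube δ (k j)
        · rw [indicator_of_mem h, hP, chartRep_of_notMem hy]
        · rw [indicator_of_notMem h]
      rw [hvol (F := fun x => w j x * p x) ((hwm j).mul hp.continuous.aestronglyMeasurable) fun x hx => by simp [hw0 x hx],
        ← mul_assoc, ← Real.sq_sqrt (mul_nonneg hA0.le ha), ← mul_pow, hPQ, ← integral_const_mul]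
      congr 1
      refine setIntegral_congr_fun hTm fun y hy => ?_
      by_cases hx : φ.symm y ∈ K
      · have hpos := (chartDensity_pos g (hs hx)).ne'
        simp only [hw, indicator_of_mem hx]
        rw [φ.right_inv hy]
        by_cases h : y ∈ gridCube δ (k j)
        · rw [indicator_of_mem h, indicator_of_mem h, hP, chartRep_of_mem hy, Pi.one_apply]
          change _ = chartDensity g c (φ.symm y) * (Real.sqrt (A * a) *
            (chartDensity g c (φ.symm y))⁻¹ * 1 * p (φ.symm y))
          linear_combination (-(Real.sqrt (A * a) * p (φ.symm y))) * mul_inv_cancel₀ hpos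
        · rw [indicator_of_notMem h, indicator_of_notMem h]
          simp
      · rw [hw0 _ hx]
        have : P y = 0 := by rw [hP, chartRep_of_mem hy]; exact hp0 _ hx
        by_cases h : y ∈ gridCube δ (k j)
        · rw [indicator_of_mem h, this]
          simp
        · rw [indicator_of_notMem h]
          simp
    have h4 := hmain P (contDiff_chartRep hK hs hp hpK) (tsupport_chartRep_subset hK hs hpK)
    have h5 : ∑ l ∈ S, a * (∫ y in gridCube δ l, P y) ^ 2 =
        ∑ j, a * (∫ y in gridCube δ (k j), P y) ^ 2 := by
      rw [← Finset.sum_coe_sort]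
      exact (S.equivFin.symm.sum_comp fun l : S => a * (∫ y in gridCube δ l, P y) ^ 2).symm
    rw [h5] at h4
    calc _ ≤ A * ∫ y, P y ^ 2 := h1
      _ ≤ A * (ε / (A * B) * (B * ∫ x, D x ∂(riemannianVolume g)) +
          ∑ j, a * (∫ y in gridCube δ (k j), P y) ^ 2) := by
        gcongr
        exact h4.trans (by gcongr)
      _ = _ := by
        rw [mul_add, Finset.mul_sum]
        congr 1
        · field_simp
        · exact Finset.sum_congr rfl fun j _ => h3 j

end ChartRellich

/-! ### Functions and sections on open subsets -/

section OpenSubsets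

variable {n : ℕ} {N : Type u} [TopologicalSpace N] [ChartedSpace (Euc n) N]
  [IsManifold (𝓡 n) ∞ N] {U : Opens N}

theorem extendZero_apply_of_mem (q : U → ℝ) {x : N} (hx : x ∈ U) :
    extendZero U q x = q ⟨x, hx⟩ := dif_pos hx

theorem extendZero_apply_of_notMem (q : U → ℝ) {x : N} (hx : x ∉ U) :
    extendZero U q x = 0 := dif_neg hx

theorem extendZero_val (q : U → ℝ) (x : U) : extendZero U q x.1 = q x :=
  extendZero_apply_of_mem q x.2

theorem extendZero_comp_val {F : N → ℝ} (hF : ∀ x ∉ U, F x = 0) :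
    extendZero U (fun x => F x.1) = F := by
  ext x
  by_cases hx : x ∈ U
  · rw [extendZero_apply_of_mem _ hx]
  · rw [extendZero_apply_of_notMem _ hx, hF x hx]

theorem tsupport_extendZero_subset [T2Space N] {q : U → ℝ} (hq : HasCompactSupport q) :
    tsupport (extendZero U q) ⊆ Subtype.val '' tsupport q := by
  refine closure_minimal (fun x hx => ?_) (hq.isCompact.image continuous_subtype_val).isClosed
  by_cases h : x ∈ U
  · rw [Function.mem_support, extendZero_apply_of_mem _ h] at hx
    exact ⟨⟨x, h⟩, subset_tsupport _ hx, rfl⟩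
  · exact absurd (extendZero_apply_of_notMem q h) hx

theorem contMDiff_extendZero [T2Space N] {q : U → ℝ} (hq : ContMDiff (𝓡 n) 𝓘(ℝ, ℝ) ∞ q)
    (hc : HasCompactSupport q) : ContMDiff (𝓡 n) 𝓘(ℝ, ℝ) ∞ (extendZero U q) := by
  refine contMDiff_of_tsupport fun x hx => ?_
  obtain ⟨y, -, rfl⟩ := tsupport_extendZero_subset hc hx
  rw [← contMDiffAt_subtype_iff]
  have : (fun x : U => extendZero U q x) = q := funext (extendZero_val q)
  rw [this]
  exact hq y

theorem integral_comap_val_eq [MeasurableSpace N] [BorelSpace N] (μ : Measure N) (q : U → ℝ) :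
    ∫ x : U, q x ∂(μ.comap Subtype.val) = ∫ x, extendZero U q x ∂μ := by
  have h := integral_subtype_comap (μ := μ) U.isOpen.measurableSet (extendZero U q)
  simp only [extendZero_val] at h
  refine h.trans (setIntegral_eq_integral_of_forall_compl_eq_zero fun x hx => ?_)
  exact extendZero_apply_of_notMem q hx

theorem isOpenPosMeasure_comap_val [MeasurableSpace N] [BorelSpace N] (μ : Measure N)
    [μ.IsOpenPosMeasure] : (μ.comap (Subtype.val : U → N)).IsOpenPosMeasure := by
  refine ⟨fun O hO hne h0 => ?_⟩
  have h1 := (MeasurableEmbedding.subtype_coe U.isOpen.measurableSet).comap_apply μ O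
  exact (U.isOpenEmbedding'.isOpenMap _ hO).measure_ne_zero μ (hne.image _) (h1.symm.trans h0)

/-- The fundamental lemma of the calculus of variations. -/
theorem eq_zero_of_forall_integral_mul_eq_zero [T2Space N] [MeasurableSpace N] [BorelSpace N]
    (μ : Measure N) [μ.IsOpenPosMeasure] [IsFiniteMeasure μ] {F : U → ℝ} (hF : Continuous F)
    {O : Set U} (hO : IsOpen O)
    (h : ∀ η : U → ℝ, ContMDiff (𝓡 n) 𝓘(ℝ, ℝ) ∞ η → HasCompactSupport η → tsupport η ⊆ O →
      ∫ x : U, η x * F x ∂(μ.comap Subtype.val) = 0) :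
    ∀ x ∈ O, F x = 0 := by
  haveI := isOpenPosMeasure_comap_val (U := U) μ
  -- If F were positive at a point of O, a bump function supported where F > 0 would give a positive
  -- integral. Negative values are excluded by applying this to -F.
  have key : ∀ F : U → ℝ, Continuous F → (∀ η : U → ℝ, ContMDiff (𝓡 n) 𝓘(ℝ, ℝ) ∞ η →
      HasCompactSupport η → tsupport η ⊆ O → ∫ x : U, η x * F x ∂(μ.comap Subtype.val) = 0) →
      ∀ x ∈ O, ¬ 0 < F x := by
    intro F hF h x hx hpos
    have hmem : O ∩ F ⁻¹' Ioi 0 ∈ 𝓝 x :=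
      (hO.inter (isOpen_Ioi.preimage hF)).mem_nhds ⟨hx, hpos⟩
    obtain ⟨f, -, hf⟩ := (SmoothBumpFunction.nhds_basis_tsupport (I := 𝓡 n) x).mem_iff.1 hmem
    have h0 := h f f.contMDiff f.hasCompactSupport fun y hy => (hf hy).1
    refine (Continuous.integral_pos_of_hasCompactSupport_nonneg_nonzero (f := fun y => f y * F y)
      (μ := μ.comap Subtype.val) (x := x) (f.continuous.mul hF) ?_ (fun y => ?_) ?_).ne' h0
    · exact f.hasCompactSupport.mul_right
    · by_cases hy : y ∈ tsupport f
      · exact mul_nonneg f.nonneg (hf hy).2.le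
      · simp [image_eq_zero_of_notMem_tsupport hy]
    · simp only [f.eq_one, one_mul]
      exact hpos.ne'
  intro x hx
  refine le_antisymm (not_lt.1 (key F hF h x hx)) (not_lt.1 fun hneg => ?_)
  refine key (fun x => -F x) hF.neg (fun η h1 h2 h3 => ?_) x hx (neg_pos.2 hneg)
  have := h η h1 h2 h3
  simp only [mul_neg, integral_neg, this, neg_zero]

theorem hasMFDerivAt_subtype_val (x : U) :
    HasMFDerivAt (𝓡 n) (𝓡 n) (Subtype.val : U → N) x (ContinuousLinearMap.id ℝ (Euc n)) := by
  refine ⟨continuous_subtype_val.continuousAt, ?_⟩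
  have h := Opens.chartAt_subtype_val_symm_eventuallyEq (H := Euc n) U (x := x)
  have ho : (chartAt (Euc n) x.1).target ∈ 𝓝 (chartAt (Euc n) x.1 x.1) :=
    (chartAt (Euc n) x.1).open_target.mem_nhds (mem_chart_target _ _)
  have hf : (writtenInExtChartAt (𝓡 n) (𝓡 n) x (Subtype.val : U → N))
      =ᶠ[𝓝 (chartAt (Euc n) x.1 x.1)] id := by
    filter_upwards [h, ho] with y hy hyt
    have := (chartAt (Euc n) x.1).right_inv hyt
    simp only [writtenInExtChartAt, extChartAt, OpenPartialHomeomorph.extend, Function.comp, id,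
      mfld_simps] at hy ⊢
    exact (congrArg _ hy.symm).trans this
  exact ((hasFDerivAt_id _).congr_of_eventuallyEq hf).hasFDerivWithinAt

theorem chart_source_opens (c : U) :
    (chartAt (Euc n) c).source = Subtype.val ⁻¹' (chartAt (Euc n) c.1).source := by
  rw [TopologicalSpace.Opens.chartAt_eq]
  simp [OpenPartialHomeomorph.subtypeRestr_source]

/-- The chart of U at c is the restriction of the chart of N at c, so the two inverse charts differ
near the point only by the inclusion of U; differentiate. -/
theorem mfderiv_val_chartDeriv {c x : U} (hx : x ∈ (chartAt (Euc n) c).source) (v : Euc n) :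
    mfderiv (𝓡 n) (𝓡 n) (Subtype.val : U → N) x (chartDeriv c x v) = chartDeriv c.1 x.1 v := by
  have hxN : x.1 ∈ (chartAt (Euc n) c.1).source := by
    rw [chart_source_opens] at hx
    exact hx
  set y := extChartAt (𝓡 n) c x with hy
  have hxs : x ∈ (extChartAt (𝓡 n) c).source := by rwa [extChartAt_source]
  have hyt : y ∈ (extChartAt (𝓡 n) c).target := (extChartAt (𝓡 n) c).map_source hxs
  have hyN : y = extChartAt (𝓡 n) c.1 x.1 := by
    rw [hy]
    simp only [extChartAt, OpenPartialHomeomorph.extend_coe, Function.comp_apply]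
    rw [TopologicalSpace.Opens.chartAt_eq]
    rfl
  have hytN : y ∈ (extChartAt (𝓡 n) c.1).target := by
    rw [hyN]
    exact (extChartAt (𝓡 n) c.1).map_source (by rwa [extChartAt_source])
  have hsy : (extChartAt (𝓡 n) c).symm y = x := (extChartAt (𝓡 n) c).left_inv hxs
  have hsyN : (extChartAt (𝓡 n) c.1).symm y = x.1 := by
    rw [hyN]
    exact (extChartAt (𝓡 n) c.1).left_inv (by rwa [extChartAt_source])
  have h1 := hasMFDerivAt_chart_symm c hyt
  have h2 := hasMFDerivAt_chart_symm c.1 hytN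
  have hev : (extChartAt (𝓡 n) c.1).symm =ᶠ[𝓝 y] Subtype.val ∘ (extChartAt (𝓡 n) c).symm := by
    filter_upwards [(isOpen_extChartAt_target (I := 𝓡 n) c).mem_nhds hyt] with z hz
    have hz' := (extChartAt (𝓡 n) c).map_target hz
    have e1 := (extChartAt (𝓡 n) c).right_inv hz
    set w := (extChartAt (𝓡 n) c).symm z
    have e2 : extChartAt (𝓡 n) c w = extChartAt (𝓡 n) c.1 w.1 := by
      simp only [extChartAt, OpenPartialHomeomorph.extend_coe, Function.comp_apply]
      rw [TopologicalSpace.Opens.chartAt_eq]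
      rfl
    rw [extChartAt_source, chart_source_opens] at hz'
    rw [Function.comp_apply, ← congrArg (extChartAt (𝓡 n) c.1).symm (e2.symm.trans e1)]
    exact (extChartAt (𝓡 n) c.1).left_inv (by rw [extChartAt_source]; exact hz')
  have h3 := (hasMFDerivAt_subtype_val ((extChartAt (𝓡 n) c).symm y)).comp y h1
  have h4 := hasMFDerivAt_unique h2 (h3.congr_of_eventuallyEq hev)
  -- All tangent spaces have `Euc n` as underlying type, which allows vectors at propositionally
  -- equal base points to be compared.
  have h5 : ∀ x' : U, x' = x → (chartDeriv c x' v : Euc n) = (chartDeriv c x v : Euc n) := by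
    rintro x' rfl
    rfl
  have h6 : ∀ x' : N, x' = x.1 → (chartDeriv c.1 x' v : Euc n) = (chartDeriv c.1 x.1 v : Euc n) := by
    rintro x' rfl
    rfl
  rw [(hasMFDerivAt_subtype_val x).mfderiv]
  exact (h5 _ hsy).symm.trans ((congrArg (fun L : Euc n →L[ℝ] Euc n => L v) h4).symm.trans
    (h6 _ hsyN))

theorem mfderiv_val_coordField {c x : U} (hx : x ∈ (chartAt (Euc n) c).source) (a : Fin n) :
    mfderiv (𝓡 n) (𝓡 n) (Subtype.val : U → N) x (coordField c a x) = coordField c.1 a x.1 := by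
  have hxN : x.1 ∈ (chartAt (Euc n) c.1).source := by
    rw [chart_source_opens] at hx
    exact hx
  rw [coordField_eq hx, coordField_eq hxN, mfderiv_val_chartDeriv hx]

/-- The derivative of a function on `N` along a coordinate vector field, on an open subset. -/
theorem coordDeriv_comp_val {c x : U} (hx : x ∈ (chartAt (Euc n) c).source) (b : Fin n)
    {p : N → ℝ} (hp : MDifferentiableAt (𝓡 n) 𝓘(ℝ, ℝ) p x.1) :
    coordDeriv c.1 b p x.1 = coordDeriv c b (fun y : U => p y.1) x := by
  have h := mfderiv_comp x hp (hasMFDerivAt_subtype_val x).mdifferentiableAt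
  rw [coordDeriv, coordDeriv, mvfderiv, mvfderiv, ← mfderiv_val_coordField hx]
  exact (congrArg (fun L : TangentSpace (𝓡 n) x →L[ℝ] ℝ => L (coordField c b x)) h).symm

theorem coordDeriv_extendZero [T2Space N] {c x : U} (hx : x ∈ (chartAt (Euc n) c).source)
    (b : Fin n) {q : U → ℝ} (hq : ContMDiff (𝓡 n) 𝓘(ℝ, ℝ) ∞ q) (hc : HasCompactSupport q) :
    coordDeriv c.1 b (extendZero U q) x.1 = coordDeriv c b q x := by
  rw [coordDeriv_comp_val hx b ((contMDiff_extendZero hq hc).mdifferentiable (by simp) _)]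
  congr 1
  exact funext (extendZero_val q)

theorem contMDiffOn_comp_val {F : N → ℝ} {c : U}
    (hF : ContMDiffOn (𝓡 n) 𝓘(ℝ, ℝ) ∞ F (chartAt (Euc n) c.1).source) :
    ContMDiffOn (𝓡 n) 𝓘(ℝ, ℝ) ∞ (fun x : U => F x.1) (chartAt (Euc n) c).source := by
  rw [chart_source_opens]
  exact hF.comp contMDiff_subtype_val.contMDiffOn subset_rfl

end OpenSubsets

/-! ### Metric connections -/

section MetricConnections

variable {n : ℕ} {N : Type u} [TopologicalSpace N] [ChartedSpace (Euc n) N]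
  [IsManifold (𝓡 n) ∞ N] {V : Type v} [NormedAddCommGroup V] [NormedSpace ℝ V]
  {U : Opens N} {E : VectBundle n V U}

/-- The product of a smooth function and a smooth section. -/
def mulSec (f : U → ℝ) (hf : ContMDiff (𝓡 n) 𝓘(ℝ, ℝ) ∞ f) (s : E.Sec) : E.Sec :=
  ⟨fun x => f x • s x, hf.smul_section s.contMDiff⟩

theorem mulSec_apply (f : U → ℝ) (hf : ContMDiff (𝓡 n) 𝓘(ℝ, ℝ) ∞ f) (s : E.Sec) (x : U) :
    mulSec f hf s x = f x • s x := rfl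

theorem sec_add_apply (s t : E.Sec) (x : U) : (s + t) x = s x + t x := rfl

theorem sec_sub_apply (s t : E.Sec) (x : U) : (s - t) x = s x - t x := rfl

theorem closure_support_mulSec_subset_tsupport (f : U → ℝ) (hf : ContMDiff (𝓡 n) 𝓘(ℝ, ℝ) ∞ f)
    (s : E.Sec) : closure {x : U | mulSec f hf s x ≠ 0} ⊆ tsupport f :=
  closure_mono fun x hx h => hx (by rw [mulSec_apply, h, zero_smul])

theorem closure_support_mulSec_subset (f : U → ℝ) (hf : ContMDiff (𝓡 n) 𝓘(ℝ, ℝ) ∞ f)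
    (s : E.Sec) : closure {x : U | mulSec f hf s x ≠ 0} ⊆ closure {x : U | s x ≠ 0} :=
  closure_mono fun x hx h => hx (by rw [mulSec_apply, h, smul_zero])

theorem eventually_eq_zero_of_notMem_closure {s : E.Sec} {x : U}
    (hx : x ∉ closure {x : U | s x ≠ 0}) : ∀ᶠ y in 𝓝 x, s y = 0 := by
  filter_upwards [isClosed_closure.isOpen_compl.mem_nhds hx] with y hy
  by_contra h
  exact hy (subset_closure h)

theorem metric_self_eq_zero (m : E.Metric) {x : U} {a : E.Fib x} (h : m.inner x a a = 0) :
    a = 0 := by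
  by_contra h0
  exact (m.pos x a h0).ne' h

theorem metric_self_nonneg (m : E.Metric) {x : U} (a : E.Fib x) : 0 ≤ m.inner x a a := by
  by_cases h : a = 0
  · simp [h]
  · exact (m.pos x a h).le

theorem contMDiff_metric (m : E.Metric) (s t : E.Sec) :
    ContMDiff (𝓡 n) 𝓘(ℝ, ℝ) ∞ fun x => m.inner x (s x) (t x) := by
  have h2 : ContMDiff (𝓡 n) ((𝓡 n).prod 𝓘(ℝ, ℝ)) ∞
      (fun x : U => TotalSpace.mk' ℝ (E := Bundle.Trivial U ℝ) x (m.inner x (s x) (t x))) :=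
    ContMDiff.clm_bundle_apply₂ (F₁ := V) (F₂ := V) m.contMDiff s.contMDiff t.contMDiff
  intro x
  have h3 := h2 x
  rw [contMDiffAt_totalSpace] at h3
  exact h3.2

/-- A smooth connection which is compatible with a metric. -/
structure IsMetricConnection (m : E.Metric) (D : CovariantDerivative (𝓡 n) V E.Fib) : Prop where
  smooth : CovariantDerivative.ContMDiffCovariantDerivative D ∞
  metric : ∀ (s t : E.Sec) (x : U) (X : TangentSpace (𝓡 n) x),
    mfderiv (𝓡 n) 𝓘(ℝ, ℝ) (fun y => m.inner y (s y) (t y)) x X =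
      m.inner x (D s x X) (t x) + m.inner x (s x) (D t x X)

variable (D : CovariantDerivative (𝓡 n) V E.Fib)

theorem conn_add (s t : E.Sec) (x : U) : D ⇑(s + t) x = D s x + D t x :=
  D.isCovariantDerivativeOnUniv.add s.mdifferentiableAt t.mdifferentiableAt

theorem conn_mulSec (f : U → ℝ) (hf : ContMDiff (𝓡 n) 𝓘(ℝ, ℝ) ∞ f) (s : E.Sec) (x : U) :
    D (mulSec f hf s) x = f x • D s x + (mvfderiv (𝓡 n) f x).smulRight (s x) :=
  D.isCovariantDerivativeOnUniv.leibniz (g := f) s.mdifferentiableAt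
    (hf.mdifferentiable (by simp) x)

theorem conn_congr {s t : E.Sec} {x : U} (h : ∀ᶠ y in 𝓝 x, s y = t y) : D s x = D t x :=
  D.isCovariantDerivativeOnUniv.congr_of_eventuallyEq s.mdifferentiableAt t.mdifferentiableAt
    univ_mem h

theorem conn_eq_zero {s : E.Sec} {x : U} (h : ∀ᶠ y in 𝓝 x, s y = 0) : D s x = 0 := by
  have h1 : D s x = D ⇑(0 : E.Sec) x := conn_congr D (t := 0) h
  rw [h1]
  exact congrFun D.zero x

/-- The derivative of a section along a coordinate vector field, cut off by `χ`. -/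
theorem exists_sec_conn_coordField (hD : CovariantDerivative.ContMDiffCovariantDerivative D ∞)
    (c : U) {χ : U → ℝ} (hχ : ContMDiff (𝓡 n) 𝓘(ℝ, ℝ) ∞ χ)
    (hs : tsupport χ ⊆ (chartAt (Euc n) c).source) (a : Fin n) (u : E.Sec) :
    ∃ v : E.Sec, ∀ x, v x = χ x • D u x (coordField c a x) := by
  have h1 : ContMDiff (𝓡 n) ((𝓡 n).prod 𝓘(ℝ, Euc n →L[ℝ] V)) ∞ (fun x =>
      (⟨x, D u x⟩ :
        TotalSpace (Euc n →L[ℝ] V) fun x : U => TangentSpace (𝓡 n) x →L[ℝ] E.Fib x)) :=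
    contMDiffOn_univ.1 (hD.contMDiff.contMDiff u.contMDiff.contMDiffOn)
  have h2 := ContMDiffOn.clm_bundle_apply (h1.contMDiffOn) (contMDiffOn_coordField c a)
  exact ⟨⟨_, hχ.contMDiffOn.smul_section_of_tsupport (chartAt (Euc n) c).open_source hs h2⟩,
    fun x => rfl⟩

theorem sec_sum_apply {ι : Type*} (S : Finset ι) (s : ι → E.Sec) (x : U) :
    (∑ i ∈ S, s i) x = ∑ i ∈ S, s i x := by
  induction S using Finset.cons_induction with
  | empty => rfl
  | cons i S hi ih => rw [Finset.sum_cons, Finset.sum_cons, sec_add_apply, ih]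

theorem contMDiff_mul_coordDeriv {c : N} (b : Fin n) {h p : N → ℝ}
    (hh : ContMDiff (𝓡 n) 𝓘(ℝ, ℝ) ∞ h) (hs : tsupport h ⊆ (chartAt (Euc n) c).source)
    (hp : ContMDiff (𝓡 n) 𝓘(ℝ, ℝ) ∞ p) :
    ContMDiff (𝓡 n) 𝓘(ℝ, ℝ) ∞ fun x => h x * coordDeriv c b p x :=
  contMDiff_of_contMDiffOn_of_tsupport_subset (chartAt (Euc n) c).open_source
    (hh.contMDiffOn.mul (contMDiffOn_coordDeriv c b hp))
    ((closure_mono (Function.support_mul_subset_left _ _)).trans hs)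

end MetricConnections

/-! ### The scalar product of linear maps on the tangent space -/

section HomInner

variable {n : ℕ} {N : Type u} [TopologicalSpace N] [ChartedSpace (Euc n) N]
  [IsManifold (𝓡 n) ∞ N] {V : Type v} [NormedAddCommGroup V] [NormedSpace ℝ V]
  {U : Opens N} {E : VectBundle n V U} (g : ManifoldMetric n N) (m : E.Metric)

/-- The contraction is independent of the basis, so one fixed chart at c serves for all x in its
domain, and smooth coefficients become available. -/
theorem homInner_eq_sum {c x : U} (hx : x ∈ (chartAt (Euc n) c).source)
    (A B : TangentSpace (𝓡 n) x →L[ℝ] E.Fib x) :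
    homInner g m x A B = ∑ a, ∑ b, (coordGram g c.1 x.1)⁻¹ a b *
      m.inner x (A (coordField c a x)) (B (coordField c b x)) := by
  have hx' : x ∈ (trivializationAt (Euc n) (fun x : U => TangentSpace (𝓡 n) x) c).baseSet := by
    rw [TangentBundle.trivializationAt_baseSet]
    exact hx
  have hb : ∀ a, chartBasis c x hx' a = coordField c a x := fun a =>
    (Trivialization.localFrame_apply_of_mem_baseSet _ _ hx').symm
  have hG : LinearMap.BilinForm.toMatrix (chartBasis c x hx') (tangentForm g x) =
      coordGram g c.1 x.1 := by
    ext a b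
    rw [LinearMap.BilinForm.toMatrix_apply, hb, hb, coordGram, Matrix.of_apply,
      ← mfderiv_val_coordField hx, ← mfderiv_val_coordField hx]
    rfl
  rw [homInner, contraction_basis_indep (chartBasis c x hx'), contraction, hG]
  simp only [hb]
  rfl

theorem homInner_comm (x : U) (A B : TangentSpace (𝓡 n) x →L[ℝ] E.Fib x) :
    homInner g m x A B = homInner g m x B A :=
  contraction_symm _ _ _ _ (tangentForm_symm g x) fun _ _ => m.symm x _ _

theorem homInner_add_right (x : U) (A B B' : TangentSpace (𝓡 n) x →L[ℝ] E.Fib x) :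
    homInner g m x A (B + B') = homInner g m x A B + homInner g m x A B' := by
  rw [homInner_comm, homInner_add, homInner_comm, homInner_comm g m x B']

theorem homInner_smul_right (x : U) (r : ℝ) (A B : TangentSpace (𝓡 n) x →L[ℝ] E.Fib x) :
    homInner g m x A (r • B) = r * homInner g m x A B := by
  rw [homInner_comm, homInner_smul, homInner_comm]

theorem homInner_zero_right (x : U) (A : TangentSpace (𝓡 n) x →L[ℝ] E.Fib x) :
    homInner g m x A 0 = 0 := by
  have := homInner_smul_right g m x 0 A 0
  rwa [zero_smul, zero_mul] at this

theorem homInner_self_nonneg (x : U) (A : TangentSpace (𝓡 n) x →L[ℝ] E.Fib x) :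
    0 ≤ homInner g m x A A :=
  contraction_nonneg _ _ _ (tangentForm_symm g x) (tangentForm_pos g x) fun v =>
    metric_self_nonneg m (A v)

end HomInner

/-! ### The connection laplacian -/

section Laplacian

variable {n : ℕ} {N : Type u} [TopologicalSpace N] [T2Space N] [CompactSpace N]
  [ChartedSpace (Euc n) N] [IsManifold (𝓡 n) ∞ N] [MeasurableSpace N] [BorelSpace N]
  {V : Type v} [NormedAddCommGroup V] [NormedSpace ℝ V]
  {U : Opens N} {E : VectBundle n V U} (g : ManifoldMetric n N) (m : E.Metric)
  (D : CovariantDerivative (𝓡 n) V E.Fib)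

/-- The function `⟨w, t⟩ - ⟨∇u, ∇t⟩`. -/
def laplaceDefect (u w t : E.Sec) (x : U) : ℝ :=
  m.inner x (w x) (t x) - homInner g m x (D u x) (D t x)

variable {g m D}

theorem laplaceDefect_eq_zero {u w t : E.Sec} {x : U} (h : ∀ᶠ y in 𝓝 x, t y = 0) :
    laplaceDefect g m D u w t x = 0 := by
  rw [laplaceDefect, conn_eq_zero D h, h.self_of_nhds, homInner_zero_right, map_zero, sub_zero]

theorem integrable_of_continuous_of_eq_zero {F : U → ℝ} (hF : Continuous F) {K : Set U}
    (hK : IsCompact K) (h0 : ∀ x ∉ K, F x = 0) :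
    Integrable F ((riemannianVolume g).comap Subtype.val) :=
  hF.integrable_of_hasCompactSupport (HasCompactSupport.intro hK h0)

theorem continuous_laplaceDefect (hD : IsMetricConnection m D) (u w t : E.Sec) :
    Continuous (laplaceDefect g m D u w t) :=
  (continuous_metric m w t).sub (continuous_gradient g m D hD.smooth u t)

theorem integrable_laplaceDefect (hD : IsMetricConnection m D) (u w : E.Sec) {t : E.Sec}
    (ht : IsCompact (closure {x : U | t x ≠ 0})) :
    Integrable (laplaceDefect g m D u w t) ((riemannianVolume g).comap Subtype.val) :=
  integrable_of_continuous_of_eq_zero (continuous_laplaceDefect hD u w t) ht fun _ hx =>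
    laplaceDefect_eq_zero (eventually_eq_zero_of_notMem_closure hx)

variable (g m D) in
/-- `w` is the laplacian of `u` on the subset `O` of `U`. -/
def IsLaplacianOn (O : Set U) (u w : E.Sec) : Prop :=
  ∀ t : E.Sec, IsCompact (closure {x : U | t x ≠ 0}) → closure {x : U | t x ≠ 0} ⊆ O →
    ∫ x : U, laplaceDefect g m D u w t x ∂((riemannianVolume g).comap Subtype.val) = 0

theorem isLaplacian_iff (hD : IsMetricConnection m D) {u w : E.Sec} :
    IsLaplacian g m D u w ↔ IsLaplacianOn g m D univ u w := by
  refine forall_congr' fun t => ?_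
  rw [imp_congr_right]
  intro ht
  have h1 : Integrable (fun x : U => m.inner x (w x) (t x))
      ((riemannianVolume g).comap Subtype.val) := by
    refine integrable_of_continuous_of_eq_zero (continuous_metric m w t) ht fun x hx => ?_
    rw [(eventually_eq_zero_of_notMem_closure hx).self_of_nhds, map_zero]
  have h2 : Integrable (fun x : U => homInner g m x (D u x) (D t x))
      ((riemannianVolume g).comap Subtype.val) := by
    refine integrable_of_continuous_of_eq_zero (continuous_gradient g m D hD.smooth u t) ht
      fun x hx => ?_
    rw [conn_eq_zero D (eventually_eq_zero_of_notMem_closure hx), homInner_zero_right]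
  simp only [subset_univ, forall_true_left, laplaceDefect]
  rw [integral_sub h1 h2, sub_eq_zero]

theorem IsLaplacianOn.mono {O O' : Set U} {u w : E.Sec} (h : IsLaplacianOn g m D O u w)
    (hO : O' ⊆ O) : IsLaplacianOn g m D O' u w := fun t ht hs => h t ht (hs.trans hO)

/-- Test both equations with η (w - w'): the gradient terms cancel and ∫ η |w - w'|² = 0 remains for
every η supported in O. -/
theorem IsLaplacianOn.eqOn (hD : IsMetricConnection m D) {O : Set U} (hO : IsOpen O)
    {u w w' : E.Sec} (h : IsLaplacianOn g m D O u w) (h' : IsLaplacianOn g m D O u w') :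
    ∀ x ∈ O, w x = w' x := by
  have key := eq_zero_of_forall_integral_mul_eq_zero (n := n) (riemannianVolume g)
    (continuous_metric m (w - w') (w - w')) hO fun η hη hc hs => by
      have hK : IsCompact (closure {x : U | mulSec η hη (w - w') x ≠ 0}) :=
        hc.isCompact.of_isClosed_subset isClosed_closure
          (closure_support_mulSec_subset_tsupport _ _ _)
      have hKO := (closure_support_mulSec_subset_tsupport η hη (w - w')).trans hs
      have h1 := h _ hK hKO
      have h2 := h' _ hK hKO
      have h3 := integral_sub (integrable_laplaceDefect (g := g) hD u w hK)
        (integrable_laplaceDefect hD u w' hK)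
      rw [h1, h2, sub_zero] at h3
      rw [← h3]
      refine integral_congr_ae (ae_of_all _ fun x => ?_)
      simp only [laplaceDefect, mulSec_apply, map_smul, smul_eq_mul, sec_sub_apply, map_sub,
        sub_apply]
      ring
  intro x hx
  exact sub_eq_zero.1 (metric_self_eq_zero m (key x hx))

/-- Every section has a laplacian locally. -/
theorem exists_isLaplacianOn (hD : IsMetricConnection m D) (x₀ : U) (u : E.Sec) :
    ∃ (w : E.Sec) (O : Set U), IsOpen O ∧ x₀ ∈ O ∧ IsLaplacianOn g m D O u w := by
  obtain ⟨χ⟩ : Nonempty (SmoothBumpFunction (𝓡 n) x₀) := inferInstance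
  have hχs : tsupport χ ⊆ (chartAt (Euc n) x₀).source := χ.tsupport_subset_chartAt_source
  have hχ : ContMDiff (𝓡 n) 𝓘(ℝ, ℝ) ∞ χ := χ.contMDiff
  choose v hv using fun a => exists_sec_conn_coordField D hD.smooth x₀ hχ hχs a u
  choose z hz using fun a b => exists_sec_conn_coordField D hD.smooth x₀ hχ hχs b (v a)
  set G : Fin n → Fin n → U → ℝ := fun a b x => χ x * (coordGram g x₀.1 x.1)⁻¹ a b with hG
  have hGχ : ∀ a b, tsupport (G a b) ⊆ tsupport χ := fun a b =>
    closure_mono (Function.support_mul_subset_left _ _)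
  have hGs : ∀ a b, ContMDiff (𝓡 n) 𝓘(ℝ, ℝ) ∞ (G a b) := fun a b =>
    contMDiff_of_contMDiffOn_of_tsupport_subset (chartAt (Euc n) x₀).open_source
      (hχ.contMDiffOn.mul (contMDiffOn_comp_val (contMDiffOn_coordGram_inv g x₀.1 a b)))
      ((hGχ a b).trans hχs)
  have hGc : ∀ a b, HasCompactSupport (G a b) := fun a b => χ.hasCompactSupport.mul_right
  have hhs : ∀ a b, ContMDiff (𝓡 n) 𝓘(ℝ, ℝ) ∞ (extendZero U (G a b)) := fun a b =>
    contMDiff_extendZero (hGs a b) (hGc a b)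
  have hht : ∀ a b, tsupport (extendZero U (G a b)) ⊆ (chartAt (Euc n) x₀.1).source := by
    intro a b y hy
    obtain ⟨x, hx, rfl⟩ := tsupport_extendZero_subset (hGc a b) hy
    have := hχs (hGχ a b hx)
    rwa [chart_source_opens] at this
  choose κ hκ hκt hκi using fun a b => exists_integral_mul_coordDeriv_eq g x₀.1 b (hhs a b)
    (hht a b)
  have hκU : ∀ a b, ContMDiff (𝓡 n) 𝓘(ℝ, ℝ) ∞ fun x : U => κ a b x.1 := fun a b =>
    (hκ a b).comp contMDiff_subtype_val
  -- Where χ = 1 this is the coordinate formula Δu = -ρ⁻¹ ∑ ∇_b (ρ g^{ab} ∇_a u), with ρ the density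
  -- of the volume: v a is ∇_a u, z a b is ∇_b ∇_a u, and κ a b is -ρ⁻¹ ∂_b (ρ g^{ab}).
  set w : E.Sec := ∑ a, ∑ b, (mulSec _ (hκU a b) (v a) - mulSec _ (hGs a b) (z a b)) with hw
  refine ⟨w, {x | ∀ᶠ y in 𝓝 x, χ y = 1}, isOpen_setOf_eventually_nhds, χ.eventuallyEq_one,
    fun t htc htO => ?_⟩
  set q : Fin n → U → ℝ := fun a x => m.inner x (v a x) (t x) with hq
  have hqs : ∀ a, ContMDiff (𝓡 n) 𝓘(ℝ, ℝ) ∞ (q a) := fun a => contMDiff_metric m (v a) t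
  have hqt : ∀ a, tsupport (q a) ⊆ closure {x : U | t x ≠ 0} := fun a =>
    closure_mono fun x hx h => hx (by simp only [hq, h, map_zero])
  have hqc : ∀ a, HasCompactSupport (q a) := fun a =>
    htc.of_isClosed_subset (isClosed_tsupport _) (hqt a)
  set p : Fin n → N → ℝ := fun a => extendZero U (q a) with hp
  have hps : ∀ a, ContMDiff (𝓡 n) 𝓘(ℝ, ℝ) ∞ (p a) := fun a => contMDiff_extendZero (hqs a) (hqc a)
  -- As the connection is metric, ∂_b ⟨v_a, t⟩ = ⟨∇_b v_a, t⟩ + ⟨v_a, ∇_b t⟩, so the defect is ∑ (κ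
  -- p_a - G ∂_b p_a) with p_a = ⟨v_a, t⟩. Each summand integrates to 0 by the choice of κ.
  set Φ : N → ℝ := fun x => ∑ a, ∑ b,
    (κ a b x * p a x - extendZero U (G a b) x * coordDeriv x₀.1 b (p a) x) with hΦ
  have hpoint : ∀ x : U, laplaceDefect g m D u w t x = Φ x.1 := by
    intro x
    by_cases hxO : x ∈ closure {x : U | t x ≠ 0}
    · have hx1 : χ x = 1 := (htO hxO).self_of_nhds
      have hxs : x ∈ (chartAt (Euc n) x₀).source :=
        hχs (subset_tsupport _ (by rw [Function.mem_support, hx1]; exact one_ne_zero))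
      have hd : ∀ a b, coordDeriv x₀.1 b (p a) x.1 =
          m.inner x (D (v a) x (coordField x₀ b x)) (t x) +
            m.inner x (v a x) (D t x (coordField x₀ b x)) := fun a b => by
        rw [hp, coordDeriv_extendZero hxs b (hqs a) (hqc a)]
        exact hD.metric (v a) t x (coordField x₀ b x)
      rw [laplaceDefect, homInner_eq_sum g m hxs, hw, sec_sum_apply, map_sum]
      simp only [hΦ, hd]
      simp only [extendZero_val, sec_sum_apply, map_sum, sum_apply, hp, hG, hx1,
        sec_sub_apply, mulSec_apply, map_sub, map_smul, sub_apply, smul_apply, smul_eq_mul, hz, hv,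
        one_smul, one_mul, hq]
      rw [← Finset.sum_sub_distrib]
      refine Finset.sum_congr rfl fun a _ => ?_
      rw [← Finset.sum_sub_distrib]
      refine Finset.sum_congr rfl fun b _ => ?_
      ring
    · rw [laplaceDefect_eq_zero (eventually_eq_zero_of_notMem_closure hxO)]
      symm
      refine Finset.sum_eq_zero fun a _ => Finset.sum_eq_zero fun b _ => ?_
      have h1 : x.1 ∉ tsupport (p a) := by
        intro h
        obtain ⟨x', hx', h'⟩ := tsupport_extendZero_subset (hqc a) h
        exact hxO (Subtype.ext h' ▸ hqt a hx')
      rw [coordDeriv_eq_zero_of_notMem_tsupport _ _ h1, image_eq_zero_of_notMem_tsupport h1]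
      simp
  have hΦ0 : ∀ x ∉ U, Φ x = 0 := fun x hx => Finset.sum_eq_zero fun a _ =>
    Finset.sum_eq_zero fun b _ => by
      simp only [hp, extendZero_apply_of_notMem _ hx, mul_zero, zero_mul, sub_zero]
  simp only [hpoint]
  rw [integral_comap_val_eq (U := U) (riemannianVolume g) fun x => Φ x.1, extendZero_comp_val hΦ0]
  have hi1 : ∀ a b, Integrable (fun x => κ a b x * p a x) (riemannianVolume g) := fun a b =>
    Continuous.integrable_of_hasCompactSupport ((hκ a b).continuous.mul (hps a).continuous)
      (HasCompactSupport.of_compactSpace _)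
  have hi2 : ∀ a b, Integrable (fun x => extendZero U (G a b) x * coordDeriv x₀.1 b (p a) x)
      (riemannianVolume g) := fun a b =>
    Continuous.integrable_of_hasCompactSupport
      (contMDiff_mul_coordDeriv b (hhs a b) (hht a b) (hps a)).continuous
      (HasCompactSupport.of_compactSpace _)
  have hi3 : ∀ a b, Integrable (fun x => κ a b x * p a x -
      extendZero U (G a b) x * coordDeriv x₀.1 b (p a) x) (riemannianVolume g) := fun a b =>
    (hi1 a b).sub (hi2 a b)
  simp only [hΦ]
  rw [integral_finsetSum _ fun a _ => integrable_finsetSum _ fun b _ => hi3 a b]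
  refine Finset.sum_eq_zero fun a _ => ?_
  rw [integral_finsetSum _ fun b _ => hi3 a b]
  refine Finset.sum_eq_zero fun b _ => ?_
  rw [integral_sub (hi1 a b) (hi2 a b), hκi a b _ (hps a), sub_self]

theorem laplaceDefect_add (u w t t' : E.Sec) (x : U) :
    laplaceDefect g m D u w (t + t') x =
      laplaceDefect g m D u w t x + laplaceDefect g m D u w t' x := by
  rw [laplaceDefect, laplaceDefect, laplaceDefect, conn_add, homInner_add_right, sec_add_apply,
    map_add]
  ring

/-- A section which is the laplacian of `u` locally is the laplacian of `u`. -/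
theorem isLaplacianOn_univ_of_forall_exists (hD : IsMetricConnection m D) {u w : E.Sec}
    (h : ∀ x : U, ∃ O : Set U, IsOpen O ∧ x ∈ O ∧ IsLaplacianOn g m D O u w) :
    IsLaplacianOn g m D univ u w := by
  intro t htc _
  choose O hO hxO hOl using h
  set K := closure {x : U | t x ≠ 0} with hK
  have hKN : IsClosed (Subtype.val '' K : Set N) := (htc.image continuous_subtype_val).isClosed
  -- The partition of unity is taken on the compact manifold N, so only finitely many of its
  -- functions are nonzero; it sums to 1 on the support of t, which is thereby split into test
  -- sections supported in the sets O x.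
  obtain ⟨ρ, hρ⟩ := SmoothPartitionOfUnity.exists_isSubordinate (𝓡 n) hKN
    (fun x : U => Subtype.val '' O x) (fun x => U.isOpenEmbedding'.isOpenMap _ (hO x)) (by
      rintro _ ⟨x, -, rfl⟩
      exact mem_iUnion.2 ⟨x, x, hxO x, rfl⟩)
  have hρs : ∀ i, ContMDiff (𝓡 n) 𝓘(ℝ, ℝ) ∞ fun x : U => ρ i x.1 := fun i =>
    (ρ i).contMDiff.comp contMDiff_subtype_val
  have hfin : {i | (Function.support (ρ i) ∩ (univ : Set N)).Nonempty}.Finite :=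
    ρ.locallyFinite.finite_nonempty_inter_compact isCompact_univ
  have hcl : ∀ {f : U → ℝ} (hf : ContMDiff (𝓡 n) 𝓘(ℝ, ℝ) ∞ f),
      IsCompact (closure {x : U | mulSec f hf t x ≠ 0}) := fun hf =>
    htc.of_isClosed_subset isClosed_closure (closure_support_mulSec_subset _ hf t)
  have hterm : ∀ i, ∫ x : U, laplaceDefect g m D u w (mulSec _ (hρs i) t) x
      ∂((riemannianVolume g).comap Subtype.val) = 0 := by
    intro i
    refine hOl i _ (hcl (hρs i)) ((closure_support_mulSec_subset_tsupport _ (hρs i) t).trans ?_)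
    intro x hx
    have h1 : x.1 ∈ tsupport (ρ i) := by
      have h2 : tsupport (fun x : U => ρ i x.1) ⊆ Subtype.val ⁻¹' tsupport (ρ i) :=
        closure_minimal (fun y hy => subset_tsupport _ hy)
          ((isClosed_tsupport _).preimage continuous_subtype_val)
      exact h2 hx
    obtain ⟨y, hy, hyx⟩ := hρ i h1
    rwa [← Subtype.ext hyx]
  have hsum : ∀ S : Finset U, ∃ hS : ContMDiff (𝓡 n) 𝓘(ℝ, ℝ) ∞ fun x : U => ∑ i ∈ S, ρ i x.1,
      ∫ x : U, laplaceDefect g m D u w (mulSec _ hS t) x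
        ∂((riemannianVolume g).comap Subtype.val) = 0 := by
    intro S
    induction S using Finset.cons_induction with
    | empty =>
      refine ⟨by simpa using contMDiff_const, ?_⟩
      refine integral_eq_zero_of_ae (ae_of_all _ fun x => laplaceDefect_eq_zero ?_)
      exact Eventually.of_forall fun y => by simp [mulSec_apply]
    | cons i S hi ih =>
      obtain ⟨hS, hS0⟩ := ih
      have hS' : ContMDiff (𝓡 n) 𝓘(ℝ, ℝ) ∞ fun x : U => ∑ j ∈ Finset.cons i S hi, ρ j x.1 := by
        simp only [Finset.sum_cons]
        exact (hρs i).add hS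
      refine ⟨hS', ?_⟩
      have hsplit : mulSec _ hS' t = mulSec _ (hρs i) t + mulSec _ hS t := by
        ext x
        rw [sec_add_apply, mulSec_apply, mulSec_apply, mulSec_apply, Finset.sum_cons, add_smul]
      rw [hsplit]
      simp only [laplaceDefect_add]
      rw [integral_add (integrable_laplaceDefect hD u w (hcl (hρs i)))
        (integrable_laplaceDefect hD u w (hcl hS)), hterm, hS0, add_zero]
  obtain ⟨hS, hS0⟩ := hsum hfin.toFinset
  have ht : mulSec _ hS t = t := by
    ext x
    rw [mulSec_apply]
    by_cases hx : t x = 0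
    · rw [hx, smul_zero]
    · have h1 := ρ.sum_eq_one (x := x.1) ⟨x, subset_closure hx, rfl⟩
      rw [finsum_eq_sum_of_support_subset (s := hfin.toFinset) _ fun i hi =>
        Finset.mem_coe.2 (hfin.mem_toFinset.2 ⟨x.1, hi, mem_univ _⟩)] at h1
      rw [h1, one_smul]
  rwa [ht] at hS0

/-- Every section has a laplacian. -/
theorem exists_isLaplacian (hD : IsMetricConnection m D) (u : E.Sec) :
    ∃ w : E.Sec, IsLaplacian g m D u w := by
  choose W O hO hxO hW using fun x₀ : U => exists_isLaplacianOn (g := g) hD x₀ u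
  -- Uniqueness makes the local laplacians agree on overlaps, so the diagonal choice x ↦ W x x
  -- coincides near x₀ with the smooth section W x₀.
  have heq : ∀ x₀ x : U, x ∈ O x₀ → W x x = W x₀ x := fun x₀ x hx =>
    IsLaplacianOn.eqOn (g := g) hD ((hO x).inter (hO x₀)) ((hW x).mono inter_subset_left)
      ((hW x₀).mono inter_subset_right) x ⟨hxO x, hx⟩
  have hev : ∀ x₀ : U, ∀ᶠ x in 𝓝 x₀, W x x = W x₀ x := fun x₀ =>
    mem_of_superset ((hO x₀).mem_nhds (hxO x₀)) fun x hx => heq x₀ x hx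
  let w : E.Sec := ⟨fun x => W x x, fun x₀ => (W x₀).contMDiff.contMDiffAt.congr_of_eventuallyEq
    ((hev x₀).mono fun x hx => by simp only [hx])⟩
  refine ⟨w, (isLaplacian_iff hD).2 (isLaplacianOn_univ_of_forall_exists hD fun x₀ =>
    ⟨O x₀, hO x₀, hxO x₀, fun t htc htO => ?_⟩)⟩
  rw [← hW x₀ t htc htO]
  refine integral_congr_ae (ae_of_all _ fun x => ?_)
  by_cases hx : x ∈ closure {x : U | t x ≠ 0}
  · simp only [laplaceDefect]
    rw [show w x = W x₀ x from heq x₀ x (htO hx)]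
  · rw [laplaceDefect_eq_zero (eventually_eq_zero_of_notMem_closure hx),
      laplaceDefect_eq_zero (eventually_eq_zero_of_notMem_closure hx)]

theorem IsLaplacian.unique (hD : IsMetricConnection m D) {u w w' : E.Sec}
    (h : IsLaplacian g m D u w) (h' : IsLaplacian g m D u w') : w = w' := by
  ext x
  exact IsLaplacianOn.eqOn (g := g) hD isOpen_univ ((isLaplacian_iff hD).1 h)
    ((isLaplacian_iff hD).1 h') x (mem_univ x)

end Laplacian

/-! ### Restriction of sections -/

section Restriction

variable {n : ℕ} {N : Type u} [TopologicalSpace N] [ChartedSpace (Euc n) N]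
  [IsManifold (𝓡 n) ∞ N] {V : Type v} [NormedAddCommGroup V] [NormedSpace ℝ V]
  {W U : Opens N} {h : W ≤ U} {E' : VectBundle n V W} {E : VectBundle n V U}

theorem contMDiff_opens_inclusion : ContMDiff (𝓡 n) (𝓡 n) ∞ (Opens.inclusion h) :=
  contMDiff_inclusion h

theorem contMDiffOn_trivialization_coord [FiniteDimensional ℝ V]
    (e : Trivialization V (TotalSpace.proj : TotalSpace V E.Fib → U)) [MemTrivializationAtlas e]
    {O : Set W} (hO : O ⊆ Opens.inclusion h ⁻¹' e.baseSet)
    {F : ∀ x : W, E.Fib (Opens.inclusion h x)}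
    (hF : ContMDiffOn (𝓡 n) ((𝓡 n).prod 𝓘(ℝ, V)) ∞
      (fun x : W => (⟨Opens.inclusion h x, F x⟩ : TotalSpace V E.Fib)) O)
    {ι : Type*} (b : Module.Basis ι ℝ V) (i : ι) :
    ContMDiffOn (𝓡 n) 𝓘(ℝ, ℝ) ∞
      (fun x : W => b.coord i (e ⟨Opens.inclusion h x, F x⟩).2) O := by
  have h1 : ContMDiffOn (𝓡 n) ((𝓡 n).prod 𝓘(ℝ, V)) ∞
      (fun x : W => e ⟨Opens.inclusion h x, F x⟩) O :=
    (e.contMDiffOn (IB := 𝓡 n) (n := ∞)).comp hF fun x hx => e.mem_source.2 (hO hx)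
  have h2 : ContMDiffOn (𝓡 n) 𝓘(ℝ, V) ∞
      (fun x : W => (e ⟨Opens.inclusion h x, F x⟩).2) O := contMDiff_snd.comp_contMDiffOn h1
  exact (LinearMap.toContinuousLinearMap (b.coord i)).contMDiff.comp_contMDiffOn h2

/-- The restriction of a section. -/
theorem exists_restrict_sec [FiniteDimensional ℝ V] (r : RestrictionMap h E' E) (s : E.Sec) :
    ∃ s' : E'.Sec, ∀ x, r.map x (s' x) = s (Opens.inclusion h x) := by
  refine ⟨⟨fun x => (r.map x).symm (s (Opens.inclusion h x)), fun x₀ => ?_⟩,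
    fun x => (r.map x).apply_symm_apply _⟩
  set b := Module.finBasis ℝ V with hb
  set e' := trivializationAt V E'.Fib x₀ with he'
  set e := trivializationAt V E.Fib (Opens.inclusion h x₀) with he
  set O : Set W := e'.baseSet ∩ Opens.inclusion h ⁻¹' e.baseSet with hO
  have hOo : IsOpen O := e'.open_baseSet.inter
    (e.open_baseSet.preimage (contMDiff_opens_inclusion (n := n) (h := h)).continuous)
  have hx₀ : x₀ ∈ O := ⟨mem_baseSet_trivializationAt _ _ _, mem_baseSet_trivializationAt _ _ _⟩
  have hfr : ∀ j, ContMDiffOn (𝓡 n) ((𝓡 n).prod 𝓘(ℝ, V)) ∞ (fun x : W =>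
      (⟨x, e'.localFrame b j x⟩ : TotalSpace V E'.Fib)) O := fun j =>
    (e'.contMDiffOn_localFrame_baseSet (I := 𝓡 n) ∞ b j).mono inter_subset_left
  have hR : ∀ j, ContMDiffOn (𝓡 n) ((𝓡 n).prod 𝓘(ℝ, V)) ∞ (fun x : W =>
      (⟨Opens.inclusion h x, r.map x (e'.localFrame b j x)⟩ : TotalSpace V E.Fib)) O := fun j =>
    r.smooth.comp_contMDiffOn (hfr j)
  -- A `RestrictionMap` is smooth, but smoothness of its fibrewise inverse has to be proved. In
  -- local frames the map is the matrix M and the section s has the coordinates c; the preimage has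
  -- the coordinates M⁻¹ c, smooth by Cramer's rule.
  set M : W → Matrix (Fin (Module.finrank ℝ V)) (Fin (Module.finrank ℝ V)) ℝ := fun x =>
    Matrix.of fun i j => b.coord i (e ⟨Opens.inclusion h x, r.map x (e'.localFrame b j x)⟩).2
    with hM
  set c : W → Fin (Module.finrank ℝ V) → ℝ := fun x i =>
    b.coord i (e ⟨Opens.inclusion h x, s (Opens.inclusion h x)⟩).2 with hc
  have hMs : ∀ i j, ContMDiffOn (𝓡 n) 𝓘(ℝ, ℝ) ∞ (fun x => M x i j) O := fun i j =>
    contMDiffOn_trivialization_coord e inter_subset_right (hR j) b i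
  have hcs : ∀ i, ContMDiffOn (𝓡 n) 𝓘(ℝ, ℝ) ∞ (fun x => c x i) O := fun i =>
    contMDiffOn_trivialization_coord e inter_subset_right
      ((s.contMDiff.comp contMDiff_opens_inclusion).contMDiffOn) b i
  have key : ∀ x ∈ O, (M x).det ≠ 0 ∧ (r.map x).symm (s (Opens.inclusion h x)) =
      ∑ j, ((M x)⁻¹.mulVec (c x)) j • e'.localFrame b j x := by
    intro x hx
    set B₁ := e.basisAt b hx.2
    set B₂ := (e'.basisAt b hx.1).map (r.map x).toLinearEquiv with hB₂
    have hB₂a : ∀ j, B₂ j = r.map x (e'.localFrame b j x) := fun j => by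
      rw [hB₂, Module.Basis.map_apply, e'.localFrame_apply_of_mem_baseSet b hx.1]
      rfl
    have hB₁ : ∀ v i, B₁.repr v i = b.coord i (e ⟨Opens.inclusion h x, v⟩).2 := fun v i => by
      simp [B₁, Trivialization.basisAt]
    have hMB : M x = B₁.toMatrix B₂ := by
      ext i j
      rw [Module.Basis.toMatrix_apply, hB₁, hB₂a]
      rfl
    have hcB : c x = B₁.repr (s (Opens.inclusion h x)) := by
      ext i
      rw [hB₁]
    have h1 : B₁.toMatrix B₂ * B₂.toMatrix B₁ = 1 := by
      rw [Module.Basis.toMatrix_mul_toMatrix_flip]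
    have hinv : (M x)⁻¹ = B₂.toMatrix B₁ := by rw [hMB]; exact Matrix.inv_eq_right_inv h1
    refine ⟨?_, ?_⟩
    · rw [hMB]
      exact (Matrix.isUnit_iff_isUnit_det _ |>.1 (IsUnit.of_mul_eq_one _ h1)).ne_zero
    · rw [hinv, hcB, Module.Basis.toMatrix_mulVec_repr]
      rw [ContinuousLinearEquiv.symm_apply_eq, map_sum]
      conv_lhs => rw [← B₂.sum_repr (s (Opens.inclusion h x))]
      refine Finset.sum_congr rfl fun j _ => ?_
      rw [map_smul, hB₂a]
  have hd : ∀ j, ContMDiffOn (𝓡 n) 𝓘(ℝ, ℝ) ∞ (fun x => ((M x)⁻¹.mulVec (c x)) j) O := by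
    intro j
    simp only [Matrix.mulVec, dotProduct]
    exact contMDiffOn_finsetSum fun i _ =>
      (contMDiffOn_matrix_inv hMs (fun x hx => (key x hx).1) j i).mul (hcs i)
  have hsum : ContMDiffOn (𝓡 n) ((𝓡 n).prod 𝓘(ℝ, V)) ∞ (fun x : W =>
      (⟨x, ∑ j, ((M x)⁻¹.mulVec (c x)) j • e'.localFrame b j x⟩ : TotalSpace V E'.Fib)) O :=
    ContMDiffOn.sum_section (t := fun j x => ((M x)⁻¹.mulVec (c x)) j • e'.localFrame b j x)
      fun j _ => (hd j).smul_section (hfr j)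
  refine (hsum.contMDiffAt (hOo.mem_nhds hx₀)).congr_of_eventuallyEq ?_
  filter_upwards [hOo.mem_nhds hx₀] with x hx
  rw [(key x hx).2]

open scoped Classical in
/-- The extension by zero of a section with compact support. -/
theorem exists_extend_sec [T2Space N] (r : RestrictionMap h E' E) (t' : E'.Sec)
    (ht : IsCompact (closure {x : W | t' x ≠ 0})) :
    ∃ t : E.Sec, (∀ x, r.map x (t' x) = t (Opens.inclusion h x)) ∧ (∀ y ∈ closure {y : U | t y ≠ 0}, y.1 ∈ W) ∧
      IsCompact (closure {x : U | t x ≠ 0}) := by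
  set t : ∀ y : U, E.Fib y := fun y =>
    if hy : y.1 ∈ W then r.map ⟨y.1, hy⟩ (t' ⟨y.1, hy⟩) else 0 with htdef
  have htW : ∀ x : W, t (Opens.inclusion h x) = r.map x (t' x) := fun x => dif_pos x.2
  have ht0 : ∀ y : U, y.1 ∉ W → t y = 0 := fun y hy => dif_neg hy
  set K : Set U := Opens.inclusion h '' closure {x : W | t' x ≠ 0} with hK
  have hKc : IsCompact K :=
    ht.image (contMDiff_opens_inclusion (n := n) (h := h)).continuous
  have htK : ∀ y ∉ K, t y = 0 := by
    intro y hy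
    by_cases hyW : y.1 ∈ W
    · have h1 : t' ⟨y.1, hyW⟩ = 0 := by
        by_contra hne
        exact hy ⟨⟨y.1, hyW⟩, subset_closure hne, rfl⟩
      rw [show y = Opens.inclusion h ⟨y.1, hyW⟩ from rfl, htW, h1, map_zero]
    · exact ht0 y hyW
  have hcl : closure {y : U | t y ≠ 0} ⊆ K :=
    closure_minimal (fun y hy => by_contra fun hyK => hy (htK y hyK)) hKc.isClosed
  refine ⟨⟨t, fun y => ?_⟩, fun x => (htW x).symm, fun y hy => ?_,
    hKc.of_isClosed_subset isClosed_closure hcl⟩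
  swap
  · obtain ⟨x, -, rfl⟩ := hcl hy
    exact x.2
  by_cases hy : y ∈ K
  · obtain ⟨x, -, rfl⟩ := hy
    -- Smoothness at a point of W may be checked after composition with the inclusion of W, where t
    -- is the image of t'.
    refine ((contDiffWithinAt_localInvariantProp ∞).liftPropAt_iff_comp_inclusion h _ _).2 ?_
    have h1 := (r.smooth.comp t'.contMDiff) x
    refine h1.congr_of_eventuallyEq (Eventually.of_forall fun z => ?_)
    exact congrArg (TotalSpace.mk' V (E := E.Fib) (Opens.inclusion h z)) (htW z)
  · refine (contMDiff_zeroSection ℝ E.Fib y).congr_of_eventuallyEq ?_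
    filter_upwards [hKc.isClosed.isOpen_compl.mem_nhds hy] with z hz
    rw [htK z hz]
    rfl

/-- Both sides have the same image in the tangent space of N, the coordinate field of the chart of
N, and the derivative of the inclusion of U is injective. -/
theorem mfderiv_inclusion_coordField (x : W) (a : Fin n) :
    mfderiv (𝓡 n) (𝓡 n) (Opens.inclusion h) x (coordField x a x) =
      coordField (Opens.inclusion h x) a (Opens.inclusion h x) := by
  refine injective_mfderiv_val U (Opens.inclusion h x) ?_
  rw [mfderiv_val_coordField (mem_chart_source _ _)]
  have h1 := mfderiv_comp (I := 𝓡 n) (I' := 𝓡 n) (I'' := 𝓡 n) x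
    (g := (Subtype.val : U → N)) (f := Opens.inclusion h)
    (hasMFDerivAt_subtype_val _).mdifferentiableAt
    (contMDiff_opens_inclusion.mdifferentiable (by simp) x)
  have h2 := mfderiv_val_coordField (c := x) (x := x) (mem_chart_source _ _) a
  refine Eq.trans ?_ h2
  exact (congrArg (fun L : TangentSpace (𝓡 n) x →L[ℝ] Euc n => L (coordField x a x)) h1).symm

theorem homInner_restrict (g : ManifoldMetric n N) (r : RestrictionMap h E' E) {m' : E'.Metric}
    {m : E.Metric} (hm : ∀ x a b, m.inner (Opens.inclusion h x) (r.map x a) (r.map x b) =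
      m'.inner x a b) (x : W) {A' B' : TangentSpace (𝓡 n) x →L[ℝ] E'.Fib x}
    {A B : TangentSpace (𝓡 n) (Opens.inclusion h x) →L[ℝ] E.Fib (Opens.inclusion h x)}
    (hA : ∀ X, r.map x (A' X) = A (mfderiv (𝓡 n) (𝓡 n) (Opens.inclusion h) x X))
    (hB : ∀ X, r.map x (B' X) = B (mfderiv (𝓡 n) (𝓡 n) (Opens.inclusion h) x X)) :
    homInner g m' x A' B' = homInner g m (Opens.inclusion h x) A B := by
  rw [homInner_eq_sum g m' (mem_chart_source _ x),
    homInner_eq_sum g m (mem_chart_source _ (Opens.inclusion h x))]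
  refine Finset.sum_congr rfl fun a _ => Finset.sum_congr rfl fun b _ => ?_
  rw [← hm, hA, hB, mfderiv_inclusion_coordField, mfderiv_inclusion_coordField]

theorem integral_restrict_eq [MeasurableSpace N] [BorelSpace N] (μ : Measure N) {F' : W → ℝ}
    {F : U → ℝ} (hF : ∀ x, F' x = F (Opens.inclusion h x)) (h0 : ∀ y : U, y.1 ∉ W → F y = 0) :
    ∫ x : W, F' x ∂(μ.comap Subtype.val) = ∫ x : U, F x ∂(μ.comap Subtype.val) := by
  rw [integral_comap_val_eq, integral_comap_val_eq]
  congr 1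
  ext x
  by_cases hW : x ∈ W
  · rw [extendZero_apply_of_mem _ hW, extendZero_apply_of_mem _ (h hW), hF]
  · rw [extendZero_apply_of_notMem _ hW]
    by_cases hU : x ∈ U
    · rw [extendZero_apply_of_mem _ hU, h0 _ hW]
    · rw [extendZero_apply_of_notMem _ hU]

/-- The laplacian of the restriction of a section is the restriction of the laplacian. -/
theorem IsLaplacian.restrict [T2Space N] [CompactSpace N] [MeasurableSpace N] [BorelSpace N]
    {g : ManifoldMetric n N} (r : RestrictionMap h E' E) {m' : E'.Metric} {m : E.Metric}
    (hm : ∀ x a b, m.inner (Opens.inclusion h x) (r.map x a) (r.map x b) = m'.inner x a b)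
    {D' : CovariantDerivative (𝓡 n) V E'.Fib} {D : CovariantDerivative (𝓡 n) V E.Fib}
    (hD : ∀ (s : E.Sec) (t : E'.Sec), (∀ x, r.map x (t x) = s (Opens.inclusion h x)) →
      ∀ (x : W) (X : TangentSpace (𝓡 n) x), r.map x (D' t x X) =
        D s (Opens.inclusion h x) (mfderiv (𝓡 n) (𝓡 n) (Opens.inclusion h) x X))
    {u w : E.Sec} {u' w' : E'.Sec} (hu : ∀ x, r.map x (u' x) = u (Opens.inclusion h x))
    (hw : ∀ x, r.map x (w' x) = w (Opens.inclusion h x)) (hL : IsLaplacian g m D u w) :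
    IsLaplacian g m' D' u' w' := by
  intro t' ht'
  -- A test section with compact support in W extends by zero to one over U, so the weak equation
  -- over U contains the one over W.
  obtain ⟨t, ht, htW, htc⟩ := exists_extend_sec r t' ht'
  have hev : ∀ y : U, y.1 ∉ W → ∀ᶠ z in 𝓝 y, t z = 0 := fun y hy =>
    eventually_eq_zero_of_notMem_closure fun h => hy (htW y h)
  rw [integral_restrict_eq (h := h) (riemannianVolume g) (F := fun y => m.inner y (w y) (t y))
      (fun x => by rw [← hm, hw, ht]) fun y hy => by rw [(hev y hy).self_of_nhds, map_zero],
    integral_restrict_eq (h := h) (riemannianVolume g)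
      (F := fun y => homInner g m y (D u y) (D t y))
      (fun x => homInner_restrict g r hm x (hD u u' hu x) (hD t t' ht x))
      fun y hy => by rw [conn_eq_zero D (hev y hy), homInner_zero_right]]
  exact hL t htc

end Restriction


/-! ### The isomorphisms which commute with the laplacians -/

section Commute

variable {n : ℕ} {N : Type u} [TopologicalSpace N] [T2Space N] [CompactSpace N]
  [ChartedSpace (Euc n) N] [IsManifold (𝓡 n) ∞ N] [MeasurableSpace N] [BorelSpace N]
  {V : Type v} [NormedAddCommGroup V] [NormedSpace ℝ V]
  {U : Opens N} {E E' : VectBundle n V U} {g : ManifoldMetric n N} {m : E.Metric}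
  {m' : E'.Metric} {D : CovariantDerivative (𝓡 n) V E.Fib}
  {D' : CovariantDerivative (𝓡 n) V E'.Fib}

/-- The commutator of the laplacian with a function, in weak form. -/
theorem laplaceDefect_mulSec_sub (hD : IsMetricConnection m D) {f : U → ℝ}
    (hf : ContMDiff (𝓡 n) 𝓘(ℝ, ℝ) ∞ f) (u w z t : E.Sec) (x : U) :
    laplaceDefect g m D (mulSec f hf u) z t x - laplaceDefect g m D u w (mulSec f hf t) x =
      m.inner x (z x) (t x) - f x * m.inner x (w x) (t x) -
        (∑ a : Fin n, ∑ b : Fin n, (coordGram g x.1 x.1)⁻¹ a b *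
          (mvfderiv (𝓡 n) f x (coordField x a x) *
            mvfderiv (𝓡 n) (fun y => m.inner y (u y) (t y)) x (coordField x b x))) +
        2 * homInner g m x (D u x) ((mvfderiv (𝓡 n) f x).smulRight (t x)) := by
  have hx := mem_chart_source (Euc n) x
  have hS : homInner g m x ((mvfderiv (𝓡 n) f x).smulRight (u x)) (D t x) +
      homInner g m x ((mvfderiv (𝓡 n) f x).smulRight (t x)) (D u x) =
      ∑ a : Fin n, ∑ b : Fin n, (coordGram g x.1 x.1)⁻¹ a b *
        (mvfderiv (𝓡 n) f x (coordField x a x) *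
          mvfderiv (𝓡 n) (fun y => m.inner y (u y) (t y)) x (coordField x b x)) := by
    rw [homInner_eq_sum g m hx, homInner_eq_sum g m hx, ← Finset.sum_add_distrib]
    refine Finset.sum_congr rfl fun a _ => ?_
    rw [← Finset.sum_add_distrib]
    refine Finset.sum_congr rfl fun b _ => ?_
    have hd : mvfderiv (𝓡 n) (fun y => m.inner y (u y) (t y)) x (coordField x b x) = _ :=
      hD.metric u t x (coordField x b x)
    rw [hd, ContinuousLinearMap.smulRight_apply, ContinuousLinearMap.smulRight_apply,
      map_smul, map_smul]
    simp only [smul_apply, smul_eq_mul]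
    rw [m.symm x (t x) (D u x (coordField x b x))]
    ring
  rw [← hS, laplaceDefect, laplaceDefect, conn_mulSec, conn_mulSec, homInner_add, homInner_smul,
    homInner_add_right, homInner_smul_right, mulSec_apply, map_smul, smul_eq_mul,
    homInner_comm g m x (D u x) ((mvfderiv (𝓡 n) f x).smulRight (t x))]
  ring

theorem homInner_conn_smulRight (f : U → ℝ)
    (hf : ContMDiff (𝓡 n) 𝓘(ℝ, ℝ) ∞ f) (u t : E.Sec) (x : U) :
    homInner g m x (D u x) ((mvfderiv (𝓡 n) f x).smulRight (t x)) =
      homInner g m x (D u x) (D (mulSec f hf t) x) - f x * homInner g m x (D u x) (D t x) := by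
  rw [conn_mulSec, homInner_add_right, homInner_smul_right]
  ring

/-- An isometric isomorphism which commutes with the laplacians preserves the scalar product of
`∇u` with `df ⊗ t`. -/
theorem homInner_smulRight_onSec (hD : IsMetricConnection m D) (hD' : IsMetricConnection m' D')
    (φ : BundleIso E E') (hφ : ∀ x a b, m'.inner x (φ.map x a) (φ.map x b) = m.inner x a b)
    (hL : ∀ u w : E.Sec, IsLaplacian g m D u w →
      IsLaplacian g m' D' (φ.onSec u) (φ.onSec w))
    {f : U → ℝ} (hf : ContMDiff (𝓡 n) 𝓘(ℝ, ℝ) ∞ f) (u t : E.Sec) (x : U) :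
    homInner g m' x (D' (φ.onSec u) x) ((mvfderiv (𝓡 n) f x).smulRight (φ.map x (t x))) =
      homInner g m x (D u x) ((mvfderiv (𝓡 n) f x).smulRight (t x)) := by
  have hmul : ∀ (η : U → ℝ) (hη : ContMDiff (𝓡 n) 𝓘(ℝ, ℝ) ∞ η) (s : E.Sec),
      φ.onSec (mulSec η hη s) = mulSec η hη (φ.onSec s) := fun η hη s => by
    ext y
    exact map_smul (φ.map y) (η y) (s y)
  -- The commutator of Δ with f is examined: w and z are the laplacians of u and f u, and the
  -- hypothesis on φ provides those of φ u and φ (f u) = f φ u.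
  obtain ⟨w, hw⟩ := exists_isLaplacian (g := g) hD u
  obtain ⟨z, hz⟩ := exists_isLaplacian (g := g) hD (mulSec f hf u)
  have hw' := hL _ _ hw
  have hz' := hL _ _ hz
  rw [hmul] at hz'
  rw [isLaplacian_iff hD] at hw hz
  rw [isLaplacian_iff hD'] at hw' hz'
  refine sub_eq_zero.1 (eq_zero_of_forall_integral_mul_eq_zero (n := n) (riemannianVolume g)
    (F := fun x => homInner g m' x (D' (φ.onSec u) x)
      ((mvfderiv (𝓡 n) f x).smulRight (φ.onSec t x)) -
      homInner g m x (D u x) ((mvfderiv (𝓡 n) f x).smulRight (t x))) ?_ isOpen_univ ?_ x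
    (mem_univ x))
  · simp only [homInner_conn_smulRight f hf]
    exact ((continuous_gradient g m' D' hD'.smooth _ _).sub
      (hf.continuous.mul (continuous_gradient g m' D' hD'.smooth _ _))).sub
      ((continuous_gradient g m D hD.smooth _ _).sub
      (hf.continuous.mul (continuous_gradient g m D hD.smooth _ _)))
  · intro η hη hc _
    have hK : ∀ {E : VectBundle n V U} (s : E.Sec),
        IsCompact (closure {x : U | mulSec η hη s x ≠ 0}) := fun s =>
      hc.isCompact.of_isClosed_subset isClosed_closure
        (closure_support_mulSec_subset_tsupport _ _ _)
    have hK' : ∀ {E : VectBundle n V U} (s : E.Sec),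
        IsCompact (closure {x : U | mulSec f hf (mulSec η hη s) x ≠ 0}) := fun s =>
      (hK s).of_isClosed_subset isClosed_closure (closure_support_mulSec_subset _ _ _)
    have i1 := hz _ (hK t) (subset_univ _)
    have i2 := hw _ (hK' t) (subset_univ _)
    have i3 := hz' _ (hK (φ.onSec t)) (subset_univ _)
    have i4 := hw' _ (hK' (φ.onSec t)) (subset_univ _)
    have j1 := integrable_laplaceDefect (g := g) hD (mulSec f hf u) z (hK t)
    have j2 := integrable_laplaceDefect (g := g) hD u w (hK' t)
    have j3 := integrable_laplaceDefect (g := g) hD' (mulSec f hf (φ.onSec u)) (φ.onSec z)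
      (hK (φ.onSec t))
    have j4 := integrable_laplaceDefect (g := g) hD' (φ.onSec u) (φ.onSec w) (hK' (φ.onSec t))
    have e1 := integral_sub j1 j2
    have e2 := integral_sub j3 j4
    -- In the weak commutator identity every term except 2 ⟨∇u, df ⊗ η t⟩ involves only fibrewise
    -- scalar products of sections, and functions on U. The isometry φ preserves these, so
    -- subtracting the identities for E and E' isolates that term.
    have e3 := integral_sub (j3.sub j4) (j1.sub j2)
    simp only [Pi.sub_apply] at e3
    rw [e1, e2, i1, i2, i3, i4, sub_zero, sub_zero] at e3
    simp only [laplaceDefect_mulSec_sub hD, laplaceDefect_mulSec_sub hD'] at e3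
    have hin : ∀ (s s' : E.Sec) (y : U), m'.inner y (φ.onSec s y) (φ.onSec s' y) =
        m.inner y (s y) (s' y) := fun s s' y => hφ y _ _
    simp only [← hmul, hin] at e3
    have hlin : ∀ {E : VectBundle n V U} (m : E.Metric) (D : CovariantDerivative (𝓡 n) V E.Fib)
        (u t : E.Sec) (y : U),
        homInner g m y (D u y) ((mvfderiv (𝓡 n) f y).smulRight (mulSec η hη t y)) =
          η y * homInner g m y (D u y) ((mvfderiv (𝓡 n) f y).smulRight (t y)) := by
      intro E m D u t y
      rw [← homInner_smul_right, mulSec_apply]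
      refine congrArg _ (ContinuousLinearMap.ext fun X => ?_)
      exact smul_comm _ _ _
    have h2 : (2 : ℝ) * ∫ x : U, η x * (homInner g m' x (D' (φ.onSec u) x)
      ((mvfderiv (𝓡 n) f x).smulRight (φ.onSec t x)) -
      homInner g m x (D u x) ((mvfderiv (𝓡 n) f x).smulRight (t x)))
        ∂((riemannianVolume g).comap Subtype.val) = 0 := by
      rw [← integral_const_mul, ← e3]
      refine integral_congr_ae (ae_of_all _ fun y => ?_)
      beta_reduce
      rw [hmul, hlin m' D', hlin m D]
      ring
    linarith

end Commute

/-! ### The laplacian of global sections -/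

section GlobalLaplacian

variable {n : ℕ} {N : Type u} [TopologicalSpace N] [T2Space N] [CompactSpace N]
  [ChartedSpace (Euc n) N] [IsManifold (𝓡 n) ∞ N] [MeasurableSpace N] [BorelSpace N]
  {V : Type v} [NormedAddCommGroup V] [NormedSpace ℝ V]
  {C : VectorialGerbe.{u, v, w} n N V}

/-! ### Linearity of the weak laplacian -/

section Linearity

variable {U : Opens N} {E : VectBundle n V U} {g : ManifoldMetric n N} {m : E.Metric}
  {D : CovariantDerivative (𝓡 n) V E.Fib}

theorem IsLaplacian.add (hD : IsMetricConnection m D) {u u' w w' : E.Sec}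
    (h : IsLaplacian g m D u w) (h' : IsLaplacian g m D u' w') :
    IsLaplacian g m D (u + u') (w + w') := by
  rw [isLaplacian_iff hD] at *
  intro t ht hO
  have h1 := integral_add (integrable_laplaceDefect (g := g) hD u w ht)
    (integrable_laplaceDefect hD u' w' ht)
  rw [h t ht hO, h' t ht hO, add_zero] at h1
  rw [← h1]
  refine integral_congr_ae (ae_of_all _ fun x => ?_)
  simp only [laplaceDefect]
  rw [conn_add, homInner_add, sec_add_apply, map_add]
  simp only [add_apply]
  ring

theorem IsLaplacian.smul (hD : IsMetricConnection m D) (r : ℝ) {u w : E.Sec}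
    (h : IsLaplacian g m D u w) : IsLaplacian g m D (r • u) (r • w) := by
  rw [isLaplacian_iff hD] at *
  intro t ht hO
  have h1 := integral_const_mul (μ := (riemannianVolume g).comap (Subtype.val : U → N)) r
    (laplaceDefect g m D u w t)
  rw [h t ht hO, mul_zero] at h1
  rw [← h1]
  refine integral_congr_ae (ae_of_all _ fun x => ?_)
  have h2 : D ⇑(r • u) x = r • D u x :=
    D.isCovariantDerivativeOnUniv.smul_const r u.mdifferentiableAt
  have h3 : (r • w) x = r • w x := rfl
  simp only [laplaceDefect]
  rw [h2, homInner_smul, h3, map_smul]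
  simp only [smul_apply, smul_eq_mul]
  ring

end Linearity

theorem RiemannianStructure.isMetricConnection (R : RiemannianStructure C) {U : Opens N}
    (e : C.Obj U) : IsMetricConnection (R.metric e) (R.conn e) :=
  ⟨R.conn_smooth e, R.conn_metric e⟩

theorem RiemannianStructure.isLaplacian_res [FiniteDimensional ℝ V] (R : RiemannianStructure C)
    {g : ManifoldMetric n N} {W U : Opens N} (h : W ≤ U) (e : C.Obj U) {u w : (C.bundle e).Sec}
    {u' w' : (C.bundle (C.res h e)).Sec}
    (hu : ∀ x, (C.resMap h e).map x (u' x) = u (Opens.inclusion h x))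
    (hw : ∀ x, (C.resMap h e).map x (w' x) = w (Opens.inclusion h x))
    (hL : IsLaplacian g (R.metric e) (R.conn e) u w) :
    IsLaplacian g (R.metric (C.res h e)) (R.conn (C.res h e)) u' w' :=
  IsLaplacian.restrict (C.resMap h e) (R.metric_res h e) (R.conn_res h e) hu hw hL

variable {c : CechChain C}

theorem globalSections_onSec_restrict (u : globalSections c) {i j : c.ι}
    {s : (C.bundle (C.res (inf_le_right : c.U i ⊓ c.U j ≤ c.U j) (c.e j))).Sec}
    (hs : ∀ x, (C.resMap inf_le_right (c.e j)).map x (s x) =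
      u.1 j (Opens.inclusion inf_le_right x)) (x : (c.U i ⊓ c.U j : Opens N)) :
    (C.resMap inf_le_left (c.e i)).map x ((c.g i j).onSec s x) =
      u.1 i (Opens.inclusion inf_le_left x) := by
  have h := u.2 i j x.1 x.2.1 x.2.2
  refine Eq.trans ?_ h.symm
  have h2 : s x = ((C.resMap inf_le_right (c.e j)).map x).symm
      (u.1 j (Opens.inclusion inf_le_right x)) := by
    rw [← hs, ContinuousLinearEquiv.symm_apply_apply]
  change (C.resMap inf_le_left (c.e i)).map x ((c.g i j).map x (s x)) = _
  rw [h2]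
  rfl

variable [FiniteDimensional ℝ V] {g : ManifoldMetric n N} {R : RiemannianStructure C}

/-- If the arrows commute with the laplacians, then a global section has a laplacian. -/
theorem exists_globalSections_isLaplacian (hR : ArrowsCommuteWithLaplacian g R)
    (u : globalSections c) : ∃ w : globalSections c, ∀ i,
      IsLaplacian g (R.metric (c.e i)) (R.conn (c.e i)) (u.1 i) (w.1 i) := by
  choose L hL using fun i =>
    exists_isLaplacian (g := g) (R.isMetricConnection (c.e i)) (u.1 i)
  refine ⟨⟨L, fun i j y hi hj => ?_⟩, hL⟩
  set W := c.U i ⊓ c.U j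
  obtain ⟨ui, hui⟩ := exists_restrict_sec (C.resMap (inf_le_left : W ≤ _) (c.e i)) (u.1 i)
  obtain ⟨wi, hwi⟩ := exists_restrict_sec (C.resMap (inf_le_left : W ≤ _) (c.e i)) (L i)
  obtain ⟨uj, huj⟩ := exists_restrict_sec (C.resMap (inf_le_right : W ≤ _) (c.e j)) (u.1 j)
  obtain ⟨wj, hwj⟩ := exists_restrict_sec (C.resMap (inf_le_right : W ≤ _) (c.e j)) (L j)
  -- Over the overlap the restriction of u i has two laplacians, the restriction of L i and the
  -- image under g i j of the restriction of L j; uniqueness identifies them.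
  have h1 := R.isLaplacian_res _ (c.e i) hui hwi (hL i)
  have h2 := hR _ (c.g_mem i j) _ _ (R.isLaplacian_res _ (c.e j) huj hwj (hL j))
  have hu : (c.g i j).onSec uj = ui := by
    ext x
    refine ((C.resMap inf_le_left (c.e i)).map x).injective ?_
    rw [globalSections_onSec_restrict u huj, hui]
  rw [hu] at h2
  have hw := h1.unique (R.isMetricConnection _) h2
  set x : (W : Opens N) := ⟨y, hi, hj⟩ with hx
  have h3 : (C.resMap inf_le_left (c.e i)).map x (wi x) = L i ⟨y, hi⟩ := hwi x
  have h4 : wj x = ((C.resMap inf_le_right (c.e j)).map x).symm (L j ⟨y, hj⟩) := by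
    rw [← show (C.resMap inf_le_right (c.e j)).map x (wj x) = L j ⟨y, hj⟩ from hwj x,
      ContinuousLinearEquiv.symm_apply_apply]
  rw [← h3, hw]
  change (C.resMap inf_le_left (c.e i)).map x ((c.g i j).map x (wj x)) = _
  rw [h4]
  rfl

/-- The default value 0 in `laplacian` does not occur: sections w chosen for each u depend linearly
on u because laplacians are unique. -/
theorem laplacian_spec (hR : ArrowsCommuteWithLaplacian g R) (u : globalSections c) (i : c.ι) :
    IsLaplacian g (R.metric (c.e i)) (R.conn (c.e i)) (u.1 i) ((laplacian g R c u).1 i) := by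
  classical
  have hex : ∃ L : globalSections c →ₗ[ℝ] globalSections c, ∀ u i,
      IsLaplacian g (R.metric (c.e i)) (R.conn (c.e i)) (u.1 i) ((L u).1 i) := by
    choose L hL using exists_globalSections_isLaplacian (c := c) hR
    refine ⟨⟨⟨L, fun a b => ?_⟩, fun r a => ?_⟩, hL⟩
    · refine Subtype.ext (funext fun i => ?_)
      exact (hL (a + b) i).unique (R.isMetricConnection _)
        ((hL a i).add (R.isMetricConnection _) (hL b i))
    · refine Subtype.ext (funext fun i => ?_)
      exact (hL (r • a) i).unique (R.isMetricConnection _)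
        ((hL a i).smul (R.isMetricConnection _) r)
  rw [laplacian, dif_pos hex]
  exact hex.choose_spec u i

end GlobalLaplacian

/-! ### Integration by parts for global sections -/

section IntegrationByParts

variable {n : ℕ} {N : Type u} [TopologicalSpace N] [T2Space N] [CompactSpace N]
  [ChartedSpace (Euc n) N] [IsManifold (𝓡 n) ∞ N]
  {V : Type v} [NormedAddCommGroup V] [NormedSpace ℝ V]

theorem homInner_smulRight_restrict {W U : Opens N} {h : W ≤ U} {E' : VectBundle n V W}
    {E : VectBundle n V U} (g : ManifoldMetric n N) (r : RestrictionMap h E' E) {m' : E'.Metric}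
    {m : E.Metric} (hm : ∀ x a b, m.inner (Opens.inclusion h x) (r.map x a) (r.map x b) =
      m'.inner x a b)
    {D' : CovariantDerivative (𝓡 n) V E'.Fib} {D : CovariantDerivative (𝓡 n) V E.Fib}
    (hD : ∀ (s : E.Sec) (t : E'.Sec), (∀ x, r.map x (t x) = s (Opens.inclusion h x)) →
      ∀ (x : W) (X : TangentSpace (𝓡 n) x), r.map x (D' t x X) =
        D s (Opens.inclusion h x) (mfderiv (𝓡 n) (𝓡 n) (Opens.inclusion h) x X))
    {u t : E.Sec} {u' t' : E'.Sec} (hu : ∀ x, r.map x (u' x) = u (Opens.inclusion h x))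
    (ht : ∀ x, r.map x (t' x) = t (Opens.inclusion h x)) {f : N → ℝ}
    (hf : ContMDiff (𝓡 n) 𝓘(ℝ, ℝ) ∞ f) (x : W) :
    homInner g m' x (D' u' x) ((mvfderiv (𝓡 n) (fun y : W => f y.1) x).smulRight (t' x)) =
      homInner g m (Opens.inclusion h x) (D u (Opens.inclusion h x))
        ((mvfderiv (𝓡 n) (fun y : U => f y.1) (Opens.inclusion h x)).smulRight
          (t (Opens.inclusion h x))) := by
  refine homInner_restrict g r hm x (hD u u' hu x) fun X => ?_
  have hfU : ContMDiff (𝓡 n) 𝓘(ℝ, ℝ) ∞ fun y : U => f y.1 := hf.comp contMDiff_subtype_val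
  have h1 := mvfderiv_comp_apply (I := 𝓡 n) (I' := 𝓡 n) (f := Opens.inclusion h)
    (g := fun y : U => f y.1) x (hfU.mdifferentiable (by simp) _)
    (contMDiff_opens_inclusion.mdifferentiable (by simp) x) X
  have h2 : mvfderiv (𝓡 n) (fun y : W => f y.1) x X = mvfderiv (𝓡 n) (fun y : U => f y.1)
    (Opens.inclusion h x) (mfderiv (𝓡 n) (𝓡 n) (Opens.inclusion h) x X) := h1
  rw [ContinuousLinearMap.smulRight_apply, ContinuousLinearMap.smulRight_apply, map_smul, ht, h2]

theorem mvfderiv_finset_sum {M : Type*} [TopologicalSpace M] [ChartedSpace (Euc n) M]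
    {ι : Type*} (S : Finset ι) {f : ι → M → ℝ}
    (hf : ∀ i, ContMDiff (𝓡 n) 𝓘(ℝ, ℝ) ∞ (f i)) (x : M) :
    mvfderiv (𝓡 n) (fun y => ∑ i ∈ S, f i y) x = ∑ i ∈ S, mvfderiv (𝓡 n) (f i) x := by
  induction S using Finset.cons_induction with
  | empty =>
    simp only [Finset.sum_empty]
    exact mvfderiv_const 0
  | cons i S hi ih =>
    simp only [Finset.sum_cons]
    have hS : ContMDiff (𝓡 n) 𝓘(ℝ, ℝ) ∞ fun y => ∑ i ∈ S, f i y :=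
      contMDiff_finsetSum fun i _ => hf i
    rw [← ih]
    exact mvfderiv_add ((hf i).mdifferentiable (by simp) x) (hS.mdifferentiable (by simp) x)

variable [MeasurableSpace N] [BorelSpace N] {C : VectorialGerbe.{u, v, w} n N V}
  {c : CechChain C} (f : Partition c)

theorem finite_setOf_partition_ne_zero : {i | ∃ x, f.1 i x ≠ 0}.Finite :=
  (f.1.locallyFinite.finite_nonempty_inter_compact isCompact_univ).subset
    fun _ ⟨x, hx⟩ => ⟨x, hx, mem_univ x⟩

theorem finsum_glue_eq_sum (q : ∀ i, c.U i → ℝ) (x : N) :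
    ∑ᶠ i, f.1 i x • extendZero (c.U i) (q i) x =
      ∑ i ∈ (finite_setOf_partition_ne_zero f).toFinset, f.1 i x * extendZero (c.U i) (q i) x := by
  refine finsum_eq_sum_of_support_subset _ fun i hi => ?_
  refine Finset.mem_coe.2 ((finite_setOf_partition_ne_zero f).mem_toFinset.2 ⟨x, fun h => ?_⟩)
  exact hi (by simp only [h, zero_smul])

theorem contMDiff_partition_val (i : c.ι) {U : Opens N} :
    ContMDiff (𝓡 n) 𝓘(ℝ, ℝ) ∞ fun x : U => f.1 i x.1 :=
  (f.1 i).contMDiff.comp contMDiff_subtype_val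

theorem hasCompactSupport_partition_val (i : c.ι) :
    HasCompactSupport fun x : c.U i => f.1 i x.1 := by
  have h1 : IsCompact (Subtype.val ⁻¹' tsupport (f.1 i) : Set (c.U i)) := by
    refine (c.U i).isOpenEmbedding'.isInducing.isCompact_preimage' (isClosed_tsupport _).isCompact ?_
    rw [Subtype.range_coe]
    exact f.2 i
  exact h1.of_isClosed_subset isClosed_closure
    (closure_minimal (fun y hy => subset_tsupport _ hy) h1.isClosed)

variable {g : ManifoldMetric n N} {R : RiemannianStructure C} [FiniteDimensional ℝ V]

/-- The scalar product of `∇u` with `dη ⊗ v`, for global sections `u`, `v`, does not depend on the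
object in which it is computed. -/
theorem homInner_smulRight_globalSections (hR : ArrowsCommuteWithLaplacian g R)
    (u v : globalSections c) {η : N → ℝ} (hη : ContMDiff (𝓡 n) 𝓘(ℝ, ℝ) ∞ η) (i j : c.ι)
    (y : N) (hi : y ∈ c.U i) (hj : y ∈ c.U j) :
    homInner g (R.metric (c.e j)) ⟨y, hj⟩ (R.conn (c.e j) (u.1 j) ⟨y, hj⟩)
      ((mvfderiv (𝓡 n) (fun x : c.U j => η x.1) ⟨y, hj⟩).smulRight (v.1 j ⟨y, hj⟩)) =
    homInner g (R.metric (c.e i)) ⟨y, hi⟩ (R.conn (c.e i) (u.1 i) ⟨y, hi⟩)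
      ((mvfderiv (𝓡 n) (fun x : c.U i => η x.1) ⟨y, hi⟩).smulRight (v.1 i ⟨y, hi⟩)) := by
  set W := c.U i ⊓ c.U j
  obtain ⟨uj, huj⟩ := exists_restrict_sec (C.resMap (inf_le_right : W ≤ _) (c.e j)) (u.1 j)
  obtain ⟨vj, hvj⟩ := exists_restrict_sec (C.resMap (inf_le_right : W ≤ _) (c.e j)) (v.1 j)
  have hui := globalSections_onSec_restrict u huj
  have hvi := globalSections_onSec_restrict v hvj
  have h1 := homInner_smulRight_restrict g (C.resMap (inf_le_right : W ≤ _) (c.e j))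
    (R.metric_res _ (c.e j)) (R.conn_res _ (c.e j)) huj hvj hη ⟨y, hi, hj⟩
  have h2 := homInner_smulRight_restrict g (C.resMap (inf_le_left : W ≤ _) (c.e i))
    (R.metric_res _ (c.e i)) (R.conn_res _ (c.e i)) hui hvi hη ⟨y, hi, hj⟩
  have h3 := homInner_smulRight_onSec (g := g) (R.isMetricConnection _) (R.isMetricConnection _)
    (c.g i j) (R.metric_hom _ (c.g_mem i j)) (hR _ (c.g_mem i j))
    (f := fun x : W => η x.1) (hη.comp contMDiff_subtype_val) uj vj ⟨y, hi, hj⟩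
  exact h1.symm.trans (h3.symm.trans h2)

/-- All summands can be computed in one object e j around y, where they add up to ⟨∇u, d(∑ fᵢ) ⊗ v⟩,
and ∑ fᵢ = 1. -/
theorem sum_homInner_smulRight_eq_zero (hR : ArrowsCommuteWithLaplacian g R)
    (u v : globalSections c) (y : N) :
    ∑ i ∈ (finite_setOf_partition_ne_zero f).toFinset, extendZero (c.U i) (fun x =>
      homInner g (R.metric (c.e i)) x (R.conn (c.e i) (u.1 i) x)
        ((mvfderiv (𝓡 n) (fun x : c.U i => f.1 i x.1) x).smulRight (v.1 i x))) y = 0 := by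
  obtain ⟨j, hj⟩ := c.cover y
  set A := R.conn (c.e j) (u.1 j) ⟨y, hj⟩
  have h1 : ∀ i, extendZero (c.U i) (fun x =>
      homInner g (R.metric (c.e i)) x (R.conn (c.e i) (u.1 i) x)
        ((mvfderiv (𝓡 n) (fun x : c.U i => f.1 i x.1) x).smulRight (v.1 i x))) y =
      homInner g (R.metric (c.e j)) ⟨y, hj⟩ A
        ((mvfderiv (𝓡 n) (fun x : c.U j => f.1 i x.1) ⟨y, hj⟩).smulRight (v.1 j ⟨y, hj⟩)) := by
    intro i
    by_cases hi : y ∈ c.U i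
    · rw [extendZero_apply_of_mem _ hi]
      exact homInner_smulRight_globalSections hR u v (f.1 i).contMDiff j i y hj hi
    · rw [extendZero_apply_of_notMem _ hi]
      -- If y is outside U i, it is outside the closed support of f i, so the differential of f i
      -- vanishes at y and the extension by zero is consistent with the value in e j.
      have h0 : (fun x : c.U j => f.1 i x.1) =ᶠ[𝓝 ⟨y, hj⟩] fun _ => 0 := by
        have h2 : ∀ᶠ z in 𝓝 y, f.1 i z = 0 := by
          filter_upwards [(isClosed_tsupport (f.1 i)).isOpen_compl.mem_nhds
            fun h => hi (f.2 i h)] with z hz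
          exact image_eq_zero_of_notMem_tsupport hz
        exact (continuous_subtype_val.tendsto (⟨y, hj⟩ : c.U j)).eventually h2
      have h3 : mvfderiv (𝓡 n) (fun x : c.U j => f.1 i x.1) ⟨y, hj⟩ = 0 := by
        rw [mvfderiv, h0.mfderiv_eq]
        exact mvfderiv_const 0
      have h4 : (0 : TangentSpace (𝓡 n) (⟨y, hj⟩ : c.U j) →L[ℝ] ℝ).smulRight (v.1 j ⟨y, hj⟩) =
          0 := by
        ext X
        simp
      rw [h3, h4, homInner_zero_right]
  simp only [h1]
  have h5 : (∑ i ∈ (finite_setOf_partition_ne_zero f).toFinset,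
      mvfderiv (𝓡 n) (fun x : c.U j => f.1 i x.1) ⟨y, hj⟩) = 0 := by
    rw [← mvfderiv_finset_sum _ fun i => contMDiff_partition_val f i]
    have h6 : (fun x : c.U j => ∑ i ∈ (finite_setOf_partition_ne_zero f).toFinset, f.1 i x.1) =
        fun _ => 1 := by
      ext x
      rw [← f.1.sum_eq_one (mem_univ x.1)]
      refine (finsum_eq_sum_of_support_subset _ fun i hi => ?_).symm
      exact Finset.mem_coe.2 ((finite_setOf_partition_ne_zero f).mem_toFinset.2 ⟨x.1, hi⟩)
    rw [h6]
    exact mvfderiv_const 1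
  have h7 := map_sum (AddMonoidHom.mk' (homInner g (R.metric (c.e j)) ⟨y, hj⟩ A)
    (homInner_add_right g (R.metric (c.e j)) ⟨y, hj⟩ A)) (fun i =>
      (mvfderiv (𝓡 n) (fun x : c.U j => f.1 i x.1) ⟨y, hj⟩).smulRight (v.1 j ⟨y, hj⟩))
      (finite_setOf_partition_ne_zero f).toFinset
  simp only [AddMonoidHom.mk'_apply] at h7
  rw [← h7]
  have h8 : ∑ i ∈ (finite_setOf_partition_ne_zero f).toFinset,
      (mvfderiv (𝓡 n) (fun x : c.U j => f.1 i x.1) ⟨y, hj⟩).smulRight (v.1 j ⟨y, hj⟩) = 0 := by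
    ext X
    have h9 := congrArg (fun L : TangentSpace (𝓡 n) (⟨y, hj⟩ : c.U j) →L[ℝ] ℝ => L X) h5
    simp only [sum_apply, zero_apply] at h9
    simp only [sum_apply, ContinuousLinearMap.smulRight_apply, zero_apply]
    rw [← Finset.sum_smul, h9, zero_smul]
  rw [h8, homInner_zero_right]

theorem integrable_extendZero (μ : Measure N) {U : Opens N} {q : U → ℝ}
    (hq : Integrable q (μ.comap Subtype.val)) : Integrable (extendZero U q) μ := by
  have hs : Function.support (extendZero U q) ⊆ (U : Set N) := fun x hx => by
    by_contra h
    exact hx (extendZero_apply_of_notMem q h)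
  rw [← integrableOn_iff_integrable_of_support_subset hs,
    integrableOn_iff_comap_subtypeVal U.isOpen.measurableSet]
  exact hq.congr (ae_of_all _ fun x => (extendZero_val q x).symm)

/-- Integration by parts: `⟨Δu, v⟩ = ⟨∇u, ∇v⟩`. -/
theorem l2Core_inner_laplacian (hR : ArrowsCommuteWithLaplacian g R) (u v : globalSections c) :
    (l2Core g R c f).inner (laplacian g R c u) v =
      glueIntegral g f fun i x => homInner g (R.metric (c.e i)) x
        (R.conn (c.e i) (u.1 i) x) (R.conn (c.e i) (v.1 i) x) := by
  set w := laplacian g R c u with hw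
  set S := (finite_setOf_partition_ne_zero f).toFinset with hS
  -- The components v i need not have compact support in U i; multiplied by f i they become
  -- admissible test sections.
  set t : ∀ i, (C.bundle (c.e i)).Sec := fun i => mulSec _ (contMDiff_partition_val f i) (v.1 i)
  have ht : ∀ i, IsCompact (closure {x : c.U i | t i x ≠ 0}) := fun i =>
    (hasCompactSupport_partition_val f i).isCompact.of_isClosed_subset isClosed_closure
      (closure_support_mulSec_subset_tsupport _ _ _)
  set Φ : c.ι → N → ℝ := fun i => extendZero (c.U i)
    (laplaceDefect g (R.metric (c.e i)) (R.conn (c.e i)) (u.1 i) (w.1 i) (t i)) with hΦ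
  have hΦi : ∀ i, Integrable (Φ i) (riemannianVolume g) := fun i =>
    integrable_extendZero _ (integrable_laplaceDefect (R.isMetricConnection _) _ _ (ht i))
  have hΦ0 : ∀ i, ∫ x, Φ i x ∂(riemannianVolume g) = 0 := fun i => by
    rw [← integral_comap_val_eq]
    exact (isLaplacian_iff (R.isMetricConnection _)).1 (laplacian_spec hR u i) _ (ht i)
      (subset_univ _)
  set q : ∀ i, c.U i → ℝ := fun i x => (R.metric (c.e i)).inner x (w.1 i x) (v.1 i x) with hq
  set q' : ∀ i, c.U i → ℝ := fun i x => homInner g (R.metric (c.e i)) x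
    (R.conn (c.e i) (u.1 i) x) (R.conn (c.e i) (v.1 i) x) with hq'
  have hi : ∀ {q : ∀ i, c.U i → ℝ}, (∀ i, Continuous (q i)) →
      Integrable (fun x => ∑ᶠ i, f.1 i x • extendZero (c.U i) (q i) x) (riemannianVolume g) :=
    fun hq => (continuous_glue f hq).integrable_of_hasCompactSupport
      (HasCompactSupport.of_compactSpace _)
  have h1 := integral_sub (hi (q := q) fun i => continuous_metric _ _ _)
    (hi (q := q') fun i => continuous_gradient g _ _ (R.conn_smooth _) _ _)
  refine sub_eq_zero.1 (h1.symm.trans ?_)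
  -- By the Leibniz rule the two sides differ by ∑ᵢ ⟨∇uᵢ, dfᵢ ⊗ vᵢ⟩, which vanishes pointwise.
  have h2 : ∀ x, ∑ᶠ i, f.1 i x • extendZero (c.U i) (q i) x -
      ∑ᶠ i, f.1 i x • extendZero (c.U i) (q' i) x = ∑ i ∈ S, Φ i x := by
    intro x
    have h3 := sum_homInner_smulRight_eq_zero f hR u v x
    rw [← hS] at h3
    rw [finsum_glue_eq_sum, finsum_glue_eq_sum, ← hS, ← sub_zero (_ - _)]
    refine (congrArg _ h3.symm).trans ?_
    rw [← Finset.sum_sub_distrib, ← Finset.sum_sub_distrib]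
    refine Finset.sum_congr rfl fun i _ => ?_
    by_cases hx : x ∈ c.U i
    · simp only [hΦ, extendZero_apply_of_mem _ hx, laplaceDefect, t, hq, hq']
      rw [conn_mulSec, homInner_add_right, homInner_smul_right, mulSec_apply, map_smul,
        smul_eq_mul]
      ring
    · simp only [hΦ, extendZero_apply_of_notMem _ hx]
      ring
  simp only [h2]
  rw [integral_finsetSum _ fun i _ => hΦi i]
  exact Finset.sum_eq_zero fun i _ => hΦ0 i

theorem dirichletCore_inner_eq (hR : ArrowsCommuteWithLaplacian g R) (u v : globalSections c) :
    (l2Core g R c f).inner ((1 + laplacian g R c) u) v = (dirichletCore g R c f).inner u v := by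
  change (l2Core g R c f).inner (u + laplacian g R c u) v = _
  rw [(l2Core g R c f).add_left, l2Core_inner_laplacian f hR]
  rfl

end IntegrationByParts

/-! ### Pointwise estimates -/

section Estimates

variable {n : ℕ} {N : Type u} [TopologicalSpace N] [ChartedSpace (Euc n) N]
  [IsManifold (𝓡 n) ∞ N] {V : Type v} [NormedAddCommGroup V] [NormedSpace ℝ V]
  {U : Opens N} {E : VectBundle n V U}

theorem sq_metric_le (m : E.Metric) {x : U} (a b : E.Fib x) :
    m.inner x a b ^ 2 ≤ m.inner x a a * m.inner x b b := by
  have hb := metric_self_nonneg m b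
  rcases hb.eq_or_lt with h0 | hpos
  · rw [metric_self_eq_zero m h0.symm]
    simp
  · have h1 := metric_self_nonneg m (m.inner x b b • a - m.inner x a b • b)
    have h2 : m.inner x (m.inner x b b • a - m.inner x a b • b)
        (m.inner x b b • a - m.inner x a b • b) =
        m.inner x b b * (m.inner x a a * m.inner x b b - m.inner x a b ^ 2) := by
      simp only [map_sub, map_smul, sub_apply, smul_apply, smul_eq_mul, m.symm x b a]
      ring
    rw [h2] at h1
    exact sub_nonneg.1 (nonneg_of_mul_nonneg_right h1 hpos)

/-- The covector α = g(∂_b, ·) represents evaluation at ∂_b: ⟨B, α ⊗ v⟩ = ⟨B ∂_b, v⟩. With γ = g_bb,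
the inequality is the expansion of |γ A - α ⊗ A ∂_b|² ≥ 0. -/
theorem homInner_smulRight_self_le (g : ManifoldMetric n N) (m : E.Metric) {c x : U}
    (hx : x ∈ (chartAt (Euc n) c).source) (A : TangentSpace (𝓡 n) x →L[ℝ] E.Fib x) (b : Fin n) :
    m.inner x (A (coordField c b x)) (A (coordField c b x)) ≤
      coordGram g c.1 x.1 b b * homInner g m x A A := by
  have hxN : x.1 ∈ (chartAt (Euc n) c.1).source := by
    rw [chart_source_opens] at hx
    exact hx
  set α : TangentSpace (𝓡 n) x →L[ℝ] ℝ :=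
    (g.inner x.1 (coordField c.1 b x.1)).comp (mfderiv (𝓡 n) (𝓡 n) (Subtype.val : U → N) x) with hα
  have hαa : ∀ a, α (coordField c a x) = coordGram g c.1 x.1 b a := fun a => by
    rw [hα, ContinuousLinearMap.comp_apply, mfderiv_val_coordField hx]
    rfl
  have hinv : ∀ a a', ∑ d, (coordGram g c.1 x.1)⁻¹ a d * coordGram g c.1 x.1 d a' =
      if a = a' then 1 else 0 := fun a a' => by
    rw [← Matrix.mul_apply, Matrix.nonsing_inv_mul _ (posDef_coordGram g hxN).det_pos.ne'.isUnit,
      Matrix.one_apply]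
  have hsymm : ∀ a a', coordGram g c.1 x.1 a a' = coordGram g c.1 x.1 a' a := fun a a' =>
    g.symm x.1 _ _
  have key : ∀ (B : TangentSpace (𝓡 n) x →L[ℝ] E.Fib x) (v : E.Fib x),
      homInner g m x B (α.smulRight v) = m.inner x (B (coordField c b x)) v := by
    intro B v
    rw [homInner_eq_sum g m hx]
    have h1 : ∀ a, ∑ d, (coordGram g c.1 x.1)⁻¹ a d *
        m.inner x (B (coordField c a x)) ((α.smulRight v) (coordField c d x)) =
        (if a = b then 1 else 0) * m.inner x (B (coordField c a x)) v := fun a => by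
      rw [← hinv, Finset.sum_mul]
      refine Finset.sum_congr rfl fun d _ => ?_
      rw [ContinuousLinearMap.smulRight_apply, hαa, map_smul, smul_eq_mul, hsymm b d]
      ring
    simp only [h1, ite_mul, one_mul, zero_mul]
    rw [Finset.sum_ite_eq' Finset.univ b, if_pos (Finset.mem_univ b)]
  set γ := coordGram g c.1 x.1 b b with hγ
  set v := A (coordField c b x) with hv
  have hγpos : 0 < γ := (posDef_coordGram g hxN).diag_pos
  have h1 := homInner_self_nonneg g m x (γ • A + (-1 : ℝ) • α.smulRight v)
  rw [homInner_add, homInner_smul, homInner_smul, homInner_add_right, homInner_add_right,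
    homInner_smul_right, homInner_smul_right, homInner_smul_right, homInner_smul_right,
    homInner_comm g m x (α.smulRight v) A, key, key, ContinuousLinearMap.smulRight_apply, hαa,
    map_smul] at h1
  simp only [smul_apply, smul_eq_mul, ← hv, ← hγ] at h1
  have h2 : 0 ≤ γ * (γ * homInner g m x A A - m.inner x v v) := by linarith
  exact sub_nonneg.1 (nonneg_of_mul_nonneg_right h2 hγpos)

/-- Sections with compact support which control the metric near a given point. -/
theorem exists_sections_metric_le [T2Space N] [FiniteDimensional ℝ V] (m : E.Metric) (c : U)
    {T : Set U} (hT : T ∈ 𝓝 c) :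
    ∃ (r : ℕ) (s : Fin r → E.Sec) (O K : Set U) (C : ℝ), IsOpen O ∧ c ∈ O ∧ IsCompact K ∧ K ⊆ T ∧
      (∀ α, closure {x : U | s α x ≠ 0} ⊆ K) ∧ 0 ≤ C ∧
      ∀ x ∈ O, ∀ a : E.Fib x, m.inner x a a ≤ C * ∑ α, m.inner x a (s α x) ^ 2 := by
  set b := Module.finBasis ℝ V with hb
  set e := trivializationAt V E.Fib c with he
  have hce : c ∈ e.baseSet := mem_baseSet_trivializationAt _ _ _
  obtain ⟨χ, -, hχ⟩ := (SmoothBumpFunction.nhds_basis_tsupport (I := 𝓡 n) c).mem_iff.1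
    (inter_mem (e.open_baseSet.mem_nhds hce) hT)
  have hfr : ∀ j, ContMDiffOn (𝓡 n) ((𝓡 n).prod 𝓘(ℝ, V)) ∞ (fun x : U =>
      (⟨x, e.localFrame b j x⟩ : TotalSpace V E.Fib)) e.baseSet := fun j =>
    e.contMDiffOn_localFrame_baseSet (I := 𝓡 n) ∞ b j
  let s : Fin (Module.finrank ℝ V) → E.Sec := fun α => ⟨fun x => χ x • e.localFrame b α x,
    χ.contMDiff.contMDiffOn.smul_section_of_tsupport e.open_baseSet
      (fun x hx => (hχ hx).1) (hfr α)⟩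
  set M : U → Matrix (Fin (Module.finrank ℝ V)) (Fin (Module.finrank ℝ V)) ℝ := fun x =>
    Matrix.of fun i j => m.inner x (e.localFrame b i x) (e.localFrame b j x) with hM
  have hMs : ∀ i j, ContMDiffOn (𝓡 n) 𝓘(ℝ, ℝ) ∞ (fun x => M x i j) e.baseSet := by
    intro i j
    have h2 : ContMDiffOn (𝓡 n) ((𝓡 n).prod 𝓘(ℝ, ℝ)) ∞
        (fun x => TotalSpace.mk' ℝ (E := Bundle.Trivial U ℝ) x
          (m.inner x (e.localFrame b i x) (e.localFrame b j x))) e.baseSet :=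
      ContMDiffOn.clm_bundle_apply₂ (F₁ := V) (F₂ := V) m.contMDiff.contMDiffOn (hfr i) (hfr j)
    intro x hx
    have h3 := h2 x hx
    rw [contMDiffWithinAt_totalSpace] at h3
    exact h3.2
  have hbx : ∀ x (hx : x ∈ e.baseSet) j, e.basisAt b hx j = e.localFrame b j x := fun x hx j =>
    (e.localFrame_apply_of_mem_baseSet b hx).symm
  have hdet : ∀ x ∈ e.baseSet, (M x).det ≠ 0 := by
    intro x hx
    let H : LinearMap.BilinForm ℝ (E.Fib x) := LinearMap.mk₂ ℝ (fun v w => m.inner x v w)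
      (by intros; simp) (by intros; simp) (by intros; simp) (by intros; simp)
    have h1 : LinearMap.BilinForm.toMatrix (e.basisAt b hx) H = M x := by
      ext i j
      rw [LinearMap.BilinForm.toMatrix_apply, hbx, hbx]
      rfl
    rw [← h1]
    exact (posDef_toMatrix _ H (m.symm x) (m.pos x)).det_pos.ne'
  have hinv : ∀ i j, ContinuousOn (fun x => (M x)⁻¹ i j) e.baseSet := fun i j =>
    (contMDiffOn_matrix_inv hMs hdet i j).continuousOn
  -- With p_i = ⟨a, s_i⟩ one has |a|² = ∑ (M⁻¹)_ij p_i p_j ≤ S ∑ p_i², and by continuity S < S(c) +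
  -- 1 near c, which explains the constant.
  set S : U → ℝ := fun x => ∑ i, ∑ j, |(M x)⁻¹ i j| with hS
  have hSc : ContinuousAt S c := by
    have h1 : ContinuousOn S e.baseSet :=
      continuousOn_finset_sum _ fun i _ => continuousOn_finset_sum _ fun j _ => (hinv i j).abs
    exact h1.continuousAt (e.open_baseSet.mem_nhds hce)
  have hO : e.baseSet ∩ {x | χ x = 1} ∩ S ⁻¹' Iio (S c + 1) ∈ 𝓝 c :=
    inter_mem (inter_mem (e.open_baseSet.mem_nhds hce) χ.eventuallyEq_one)
      (hSc (Iio_mem_nhds (lt_add_one _)))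
  obtain ⟨O, hOs, hOo, hcO⟩ := mem_nhds_iff.1 hO
  have hS0 : ∀ x, 0 ≤ S x := fun x => Finset.sum_nonneg fun i _ => Finset.sum_nonneg fun j _ =>
    abs_nonneg _
  refine ⟨_, s, O, tsupport χ, S c + 1, hOo, hcO, χ.hasCompactSupport.isCompact,
    fun x hx => (hχ hx).2, fun α => closure_mono fun x hx h => hx ?_, by linarith [hS0 c], ?_⟩
  · change χ x • e.localFrame b α x = 0
    rw [h, zero_smul]
  · intro x hx a
    obtain ⟨⟨hxe, hx1⟩, hxS⟩ := hOs hx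
    have hs : ∀ α, s α x = e.localFrame b α x := fun α => by
      change χ x • e.localFrame b α x = _
      rw [show χ x = 1 from hx1, one_smul]
    simp only [hs]
    set p : Fin (Module.finrank ℝ V) → ℝ := fun α => m.inner x a (e.localFrame b α x) with hp
    set y : Fin (Module.finrank ℝ V) → ℝ := ⇑((e.basisAt b hxe).repr a) with hy
    have ha : a = ∑ α, y α • e.localFrame b α x := by
      conv_lhs => rw [← (e.basisAt b hxe).sum_repr a]
      simp only [hbx]
      rfl
    have hpy : p = (M x).mulVec y := by
      ext β
      simp only [hp]
      rw [m.symm]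
      conv_lhs => rw [ha]
      rw [map_sum]
      simp only [map_smul, smul_eq_mul, Matrix.mulVec, dotProduct, hM, Matrix.of_apply]
      exact Finset.sum_congr rfl fun _ _ => mul_comm _ _
    have hyp : y = (M x)⁻¹.mulVec p := by
      rw [hpy, Matrix.mulVec_mulVec, Matrix.nonsing_inv_mul _ (hdet x hxe).isUnit,
        Matrix.one_mulVec]
    have h1 : m.inner x a a = ∑ i, ∑ j, (M x)⁻¹ i j * (p i * p j) := by
      have h2 : m.inner x a a = ∑ i, y i * p i := by
        conv_lhs => rw [show m.inner x a a = m.inner x a (∑ α, y α • e.localFrame b α x) from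
          congrArg _ ha]
        rw [map_sum]
        simp only [map_smul, smul_eq_mul, hp]
      rw [h2]
      refine Finset.sum_congr rfl fun i _ => ?_
      rw [hyp, Matrix.mulVec, dotProduct, Finset.sum_mul]
      exact Finset.sum_congr rfl fun j _ => by ring
    have h3 : ∀ i j, p i * p j ≤ ∑ α, p α ^ 2 ∧ -(p i * p j) ≤ ∑ α, p α ^ 2 := by
      intro i j
      have hi := Finset.single_le_sum (f := fun α => p α ^ 2) (fun α _ => sq_nonneg _)
        (Finset.mem_univ i)
      have hj := Finset.single_le_sum (f := fun α => p α ^ 2) (fun α _ => sq_nonneg _)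
        (Finset.mem_univ j)
      constructor <;> nlinarith [sq_nonneg (p i - p j), sq_nonneg (p i + p j)]
    have hP : 0 ≤ ∑ α, p α ^ 2 := Finset.sum_nonneg fun _ _ => sq_nonneg _
    calc m.inner x a a = ∑ i, ∑ j, (M x)⁻¹ i j * (p i * p j) := h1
      _ ≤ ∑ i, ∑ j, |(M x)⁻¹ i j| * ∑ α, p α ^ 2 := by
        refine Finset.sum_le_sum fun i _ => Finset.sum_le_sum fun j _ => ?_
        refine (le_abs_self _).trans ?_
        rw [abs_mul]
        exact mul_le_mul_of_nonneg_left (abs_le.2 ⟨by linarith [(h3 i j).2], (h3 i j).1⟩)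
          (abs_nonneg _)
      _ = S x * ∑ α, p α ^ 2 := by simp only [hS, Finset.sum_mul]
      _ ≤ (S c + 1) * ∑ α, p α ^ 2 := mul_le_mul_of_nonneg_right (le_of_lt hxS) hP

end Estimates

/-! ### Quadratic forms which are small modulo functionals of finite rank -/

section SmallForms

variable {X : Type*} [AddCommGroup X] [Module ℝ X]

/-- `Q` is bounded by an arbitrarily small multiple of `P`, modulo finitely many squares of linear
functionals which are bounded with respect to `P`. -/
def IsSmallModFiniteRank (P Q : X → ℝ) : Prop :=
  ∀ ε : ℝ, 0 < ε → ∃ (κ : Type) (_ : Fintype κ) (F : κ → X →ₗ[ℝ] ℝ) (C : ℝ),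
    (∀ k u, F k u ^ 2 ≤ C * P u) ∧ ∀ u, Q u ≤ ε * P u + ∑ k, F k u ^ 2

variable {P Q Q' : X → ℝ}

theorem IsSmallModFiniteRank.mono (h : IsSmallModFiniteRank P Q) (hQ : ∀ u, Q' u ≤ Q u) :
    IsSmallModFiniteRank P Q' := fun ε hε => by
  obtain ⟨κ, hκ, F, C, hC, hF⟩ := h ε hε
  exact ⟨κ, hκ, F, C, hC, fun u => (hQ u).trans (hF u)⟩

theorem IsSmallModFiniteRank.add (hP : ∀ u, 0 ≤ P u) (h : IsSmallModFiniteRank P Q)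
    (h' : IsSmallModFiniteRank P Q') : IsSmallModFiniteRank P fun u => Q u + Q' u := by
  intro ε hε
  obtain ⟨κ, hκ, F, C, hC, hF⟩ := h (ε / 2) (half_pos hε)
  obtain ⟨κ', hκ', F', C', hC', hF'⟩ := h' (ε / 2) (half_pos hε)
  refine ⟨κ ⊕ κ', inferInstance, Sum.elim F F', max C C', ?_, fun u => ?_⟩
  · rintro (k | k) u
    · exact (hC k u).trans (mul_le_mul_of_nonneg_right (le_max_left _ _) (hP u))
    · exact (hC' k u).trans (mul_le_mul_of_nonneg_right (le_max_right _ _) (hP u))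
  · rw [Fintype.sum_sum_type]
    simp only [Sum.elim_inl, Sum.elim_inr]
    linarith [hF u, hF' u]

theorem IsSmallModFiniteRank.const_mul {C : ℝ} (hC : 0 ≤ C) (hP : ∀ u, 0 ≤ P u)
    (h : IsSmallModFiniteRank P Q) : IsSmallModFiniteRank P fun u => C * Q u := by
  intro ε hε
  -- C may be 0, hence C + 1 in the denominator; the functionals are scaled by √C since their
  -- squares enter.
  obtain ⟨κ, hκ, F, B, hB, hF⟩ := h (ε / (C + 1)) (by positivity)
  refine ⟨κ, hκ, fun k => Real.sqrt C • F k, C * B, fun k u => ?_, fun u => ?_⟩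
  · rw [LinearMap.smul_apply, smul_eq_mul, mul_pow, Real.sq_sqrt hC, mul_assoc]
    exact mul_le_mul_of_nonneg_left (hB k u) hC
  · simp only [LinearMap.smul_apply, smul_eq_mul, mul_pow, Real.sq_sqrt hC]
    rw [← Finset.mul_sum]
    have h1 : C * (ε / (C + 1)) ≤ ε := by
      rw [← mul_div_assoc, div_le_iff₀ (by positivity)]
      nlinarith
    nlinarith [mul_le_mul_of_nonneg_left (hF u) hC, mul_le_mul_of_nonneg_right h1 (hP u)]

theorem IsSmallModFiniteRank.sum (hP : ∀ u, 0 ≤ P u) {ι : Type*} (S : Finset ι)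
    {Q : ι → X → ℝ} (h : ∀ i ∈ S, IsSmallModFiniteRank P (Q i)) :
    IsSmallModFiniteRank P fun u => ∑ i ∈ S, Q i u := by
  induction S using Finset.cons_induction with
  | empty =>
    intro ε hε
    refine ⟨Empty, inferInstance, fun k => k.elim, 0, fun k => k.elim, fun u => ?_⟩
    simpa using mul_nonneg hε.le (hP u)
  | cons i S hi ih =>
    simp only [Finset.sum_cons]
    exact IsSmallModFiniteRank.add hP (h i (Finset.mem_cons_self i S))
      (ih fun j hj => h j (Finset.mem_cons_of_mem hj))

theorem IsSmallModFiniteRank.exists_fin (h : IsSmallModFiniteRank P Q) {ε : ℝ} (hε : 0 < ε) :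
    ∃ (m : ℕ) (F : X →ₗ[ℝ] (Fin m → ℝ)) (C : ℝ), (∀ u j, F u j ^ 2 ≤ C * P u) ∧
      ∀ u, Q u ≤ ε * P u + ∑ j, F u j ^ 2 := by
  obtain ⟨κ, hκ, F, C, hC, hF⟩ := h ε hε
  refine ⟨Fintype.card κ, LinearMap.pi fun j => F ((Fintype.equivFin κ).symm j), C,
    fun u j => hC _ u, fun u => (hF u).trans_eq ?_⟩
  simp only [LinearMap.pi_apply]
  rw [(Fintype.equivFin κ).symm.sum_comp fun k => F k u ^ 2]

end SmallForms

/-! ### The theorem of Rellich for global sections -/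

section Rellich

variable {n : ℕ} {N : Type u} [TopologicalSpace N] [T2Space N] [CompactSpace N]
  [ChartedSpace (Euc n) N] [IsManifold (𝓡 n) ∞ N] [MeasurableSpace N] [BorelSpace N]
  {V : Type v} [NormedAddCommGroup V] [NormedSpace ℝ V]

theorem tsupport_metric_subset {U : Opens N} {E : VectBundle n V U} (m : E.Metric) (u s : E.Sec) :
    tsupport (fun x => m.inner x (u x) (s x)) ⊆ closure {x : U | s x ≠ 0} :=
  closure_mono fun x hx h => hx (by simp only [h, map_zero])

/-- For a metric connection, ∂_b ⟨u, s⟩ = ⟨∇_b u, s⟩ + ⟨u, ∇_b s⟩, and Cauchy–Schwarz applies to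
both terms. The resulting coefficient, B in the proof, depends only on s and the metrics, so its
bound on K is uniform in u. -/
theorem exists_sq_coordDeriv_le {U : Opens N} {E : VectBundle n V U} (g : ManifoldMetric n N)
    {m : E.Metric} {D : CovariantDerivative (𝓡 n) V E.Fib} (hD : IsMetricConnection m D) {c : U}
    {K : Set U} (hK : IsCompact K) (hKc : K ⊆ (chartAt (Euc n) c).source) (s : E.Sec)
    (hs : closure {x : U | s x ≠ 0} ⊆ K) :
    ∃ M : ℝ, 0 ≤ M ∧ ∀ (u : E.Sec), ∀ x ∈ K,
      m.inner x (u x) (s x) ^ 2 ≤ M * (m.inner x (u x) (u x) + homInner g m x (D u x) (D u x)) ∧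
      ∑ b : Fin n, coordDeriv c.1 b (extendZero U fun x => m.inner x (u x) (s x)) x.1 ^ 2 ≤
        M * (m.inner x (u x) (u x) + homInner g m x (D u x) (D u x)) := by
  set B : U → ℝ := fun x => m.inner x (s x) (s x) + ∑ b : Fin n, 2 * coordGram g c.1 x.1 b b *
    (m.inner x (s x) (s x) + homInner g m x (D s x) (D s x)) with hB
  have hBc : ContinuousOn B (chartAt (Euc n) c).source := by
    refine (continuous_metric m s s).continuousOn.add (continuousOn_finset_sum _ fun b _ => ?_)
    exact (continuousOn_const.mul
      (contMDiffOn_comp_val (contMDiffOn_coordGram g c.1 b b)).continuousOn).mul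
      ((continuous_metric m s s).add (continuous_gradient g m D hD.smooth s s)).continuousOn
  obtain ⟨M, hM⟩ := hK.bddAbove_image (hBc.mono hKc)
  refine ⟨max M 0, le_max_right _ _, fun u x hx => ?_⟩
  have hxs := hKc hx
  have hxN : x.1 ∈ (chartAt (Euc n) c.1).source := by
    rw [chart_source_opens] at hxs
    exact hxs
  have hBM : B x ≤ max M 0 := (hM (mem_image_of_mem _ hx)).trans (le_max_left _ _)
  have hA := metric_self_nonneg m (u x)
  have hS := metric_self_nonneg m (s x)
  have hH := homInner_self_nonneg g m x (D u x)
  have hZ := homInner_self_nonneg g m x (D s x)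
  have hG : ∀ b, 0 < coordGram g c.1 x.1 b b := fun b => (posDef_coordGram g hxN).diag_pos
  have hterm : ∀ b, 0 ≤ 2 * coordGram g c.1 x.1 b b *
      (m.inner x (s x) (s x) + homInner g m x (D s x) (D s x)) := fun b =>
    mul_nonneg (mul_nonneg zero_le_two (hG b).le) (add_nonneg hS hZ)
  have hle := mul_le_mul_of_nonneg_right hBM (add_nonneg hA hH)
  constructor
  · refine le_trans ?_ hle
    have h1 := sq_metric_le m (u x) (s x)
    have h2 : m.inner x (s x) (s x) ≤ B x :=
      le_add_of_nonneg_right (Finset.sum_nonneg fun b _ => hterm b)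
    nlinarith
  · refine le_trans ?_ hle
    have hqs := contMDiff_metric m u s
    have hqc : HasCompactSupport fun x => m.inner x (u x) (s x) :=
      hK.of_isClosed_subset (isClosed_tsupport _)
        ((tsupport_metric_subset m u s).trans hs)
    have hd : ∀ b : Fin n,
        coordDeriv c.1 b (extendZero U fun x => m.inner x (u x) (s x)) x.1 ^ 2 ≤
        2 * coordGram g c.1 x.1 b b *
          (m.inner x (s x) (s x) + homInner g m x (D s x) (D s x)) *
          (m.inner x (u x) (u x) + homInner g m x (D u x) (D u x)) := by
      intro b
      have h0 : coordDeriv c.1 b (extendZero U fun x => m.inner x (u x) (s x)) x.1 =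
          m.inner x (D u x (coordField c b x)) (s x) +
            m.inner x (u x) (D s x (coordField c b x)) := by
        rw [coordDeriv_extendZero hxs b hqs hqc]
        exact hD.metric u s x (coordField c b x)
      rw [h0]
      have h1 := sq_metric_le m (D u x (coordField c b x)) (s x)
      have h2 := sq_metric_le m (u x) (D s x (coordField c b x))
      have h3 := mul_le_mul_of_nonneg_right (homInner_smulRight_self_le g m hxs (D u x) b) hS
      have h4 := mul_le_mul_of_nonneg_left (homInner_smulRight_self_le g m hxs (D s x) b) hA
      have h5 := mul_nonneg (hG b).le (mul_nonneg hH hZ)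
      have h6 := mul_nonneg (hG b).le (mul_nonneg hA hS)
      have h7 := sq_nonneg (m.inner x (D u x (coordField c b x)) (s x) -
        m.inner x (u x) (D s x (coordField c b x)))
      linarith
    refine (Finset.sum_le_sum fun b _ => hd b).trans ?_
    rw [← Finset.sum_mul]
    exact mul_le_mul_of_nonneg_right (le_add_of_nonneg_left hS) (add_nonneg hA hH)

variable {C : VectorialGerbe.{u, v, w} n N V} {c : CechChain C} (f : Partition c) {g : ManifoldMetric n N} {R : RiemannianStructure C}

theorem partition_smul_le_finsum {q : ∀ i, c.U i → ℝ} (hq : ∀ i x, 0 ≤ q i x) (i : c.ι)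
    (x : c.U i) :
    f.1 i x.1 * q i x ≤ ∑ᶠ i, f.1 i x.1 • extendZero (c.U i) (q i) x.1 := by
  have h := single_le_finsum i (finite_support_glue f q x.1) fun j =>
    show 0 ≤ f.1 j x.1 • extendZero (c.U j) (q j) x.1 from
      smul_nonneg (f.1.nonneg j _) (by
        by_cases h : x.1 ∈ c.U j
        · rw [extendZero_apply_of_mem _ h]
          exact hq _ _
        · rw [extendZero_apply_of_notMem _ h])
  rwa [extendZero_val, smul_eq_mul] at h

variable (g R) in
/-- The density `|u|² + |∇u|²`. -/
def energy (u : globalSections c) (i : c.ι) (x : c.U i) : ℝ :=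
  (R.metric (c.e i)).inner x (u.1 i x) (u.1 i x) + homInner g (R.metric (c.e i)) x
    (R.conn (c.e i) (u.1 i) x) (R.conn (c.e i) (u.1 i) x)

theorem energy_nonneg (u : globalSections c) (i : c.ι) (x : c.U i) : 0 ≤ energy g R u i x :=
  add_nonneg (metric_self_nonneg _ _) (homInner_self_nonneg g _ x _)

theorem continuous_energy (u : globalSections c) (i : c.ι) : Continuous (energy g R u i) :=
  (continuous_metric _ _ _).add (continuous_gradient g _ _ (R.conn_smooth _) _ _)

theorem integrable_glue {q : ∀ i, c.U i → ℝ} (hq : ∀ i, Continuous (q i)) :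
    Integrable (fun x => ∑ᶠ i, f.1 i x • extendZero (c.U i) (q i) x) (riemannianVolume g) :=
  (continuous_glue f hq).integrable_of_hasCompactSupport (HasCompactSupport.of_compactSpace _)

theorem glueIntegral_energy (u : globalSections c) :
    glueIntegral g f (energy g R u) = (dirichletCore g R c f).inner u u :=
  glueIntegral_add g f (fun i => continuous_metric _ _ _)
    fun i => continuous_gradient g _ _ (R.conn_smooth _) _ _

theorem dirichletCore_nonneg (u : globalSections c) : 0 ≤ (dirichletCore g R c f).inner u u := by
  rw [← glueIntegral_energy]
  exact glueIntegral_mono g f (energy_nonneg u)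

/-- The square integrals of a compactly supported component of global sections, in the domain of a
chart where `fᵢ` is bounded from below, are small modulo functionals of finite rank. -/
theorem isSmallModFiniteRank_component (i : c.ι) {y : c.U i} {K : Set (c.U i)} (hK : IsCompact K)
    (hKy : K ⊆ (chartAt (Euc n) y).source) {δ : ℝ} (hδ : 0 < δ) (hf : ∀ x ∈ K, δ ≤ f.1 i x.1)
    (s : (C.bundle (c.e i)).Sec) (hs : closure {x : c.U i | s x ≠ 0} ⊆ K) :
    IsSmallModFiniteRank (fun u => (dirichletCore g R c f).inner u u) fun u : globalSections c =>
      ∫ x, extendZero (c.U i) (fun x => (R.metric (c.e i)).inner x (u.1 i x) (s x)) x ^ 2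
        ∂(riemannianVolume g) := by
  set m := R.metric (c.e i) with hm
  set p : globalSections c → N → ℝ := fun u =>
    extendZero (c.U i) fun x => m.inner x (u.1 i x) (s x) with hp
  obtain ⟨M, hM0, hM⟩ := exists_sq_coordDeriv_le g (R.isMetricConnection (c.e i)) hK hKy s hs
  have hqK : ∀ u : globalSections c, tsupport (fun x => m.inner x (u.1 i x) (s x)) ⊆ K := fun u =>
    (tsupport_metric_subset m (u.1 i) s).trans hs
  have hqc : ∀ u : globalSections c, HasCompactSupport fun x => m.inner x (u.1 i x) (s x) :=
    fun u => hK.of_isClosed_subset (isClosed_tsupport _) (hqK u)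
  have hps : ∀ u, ContMDiff (𝓡 n) 𝓘(ℝ, ℝ) ∞ (p u) := fun u =>
    contMDiff_extendZero (contMDiff_metric m (u.1 i) s) (hqc u)
  have hpt : ∀ u, tsupport (p u) ⊆ Subtype.val '' K := fun u =>
    (tsupport_extendZero_subset (hqc u)).trans (image_mono (hqK u))
  have hKs : (Subtype.val '' K : Set N) ⊆ (chartAt (Euc n) y.1).source := by
    rintro _ ⟨x, hx, rfl⟩
    have := hKy hx
    rwa [chart_source_opens] at this
  -- Θ u is the density whose integral is the Dirichlet form. Where f i ≥ δ it is at least δ times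
  -- the energy density of the single component u i, so estimates in e i suffice.
  set Θ : globalSections c → N → ℝ := fun u x =>
    ∑ᶠ i, f.1 i x • extendZero (c.U i) (energy g R u i) x with hΘ
  have hΘi : ∀ u, Integrable (Θ u) (riemannianVolume g) := fun u =>
    integrable_glue f (continuous_energy u)
  have hΘd : ∀ u, ∫ x, Θ u x ∂(riemannianVolume g) = (dirichletCore g R c f).inner u u :=
    glueIntegral_energy f
  have hΘ0 : ∀ u x, 0 ≤ Θ u x := fun u x => by
    obtain ⟨j, hj⟩ := c.cover x
    exact (mul_nonneg (f.1.nonneg j x) (energy_nonneg u j ⟨x, hj⟩)).trans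
      (partition_smul_le_finsum f (energy_nonneg u) j ⟨x, hj⟩)
  have hΘK : ∀ u, ∀ x ∈ K, M * energy g R u i x ≤ M / δ * Θ u x.1 := fun u x hx => by
    have h1 : δ * energy g R u i x ≤ Θ u x.1 :=
      (mul_le_mul_of_nonneg_right (hf x hx) (energy_nonneg u i x)).trans
        (partition_smul_le_finsum f (energy_nonneg u) i x)
    calc M * energy g R u i x = M / δ * (δ * energy g R u i x) := by field_simp
      _ ≤ _ := mul_le_mul_of_nonneg_left h1 (by positivity)
  have hA0 : 0 ≤ M / δ := by positivity
  have hp2 : ∀ u x, p u x ^ 2 ≤ M / δ * Θ u x := fun u x => by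
    by_cases hx : x ∈ (Subtype.val '' K : Set N)
    · obtain ⟨x, hx, rfl⟩ := hx
      simp only [hp]
      rw [extendZero_val]
      exact ((hM (u.1 i) x hx).1).trans (hΘK u x hx)
    · rw [image_eq_zero_of_notMem_tsupport fun h => hx (hpt u h)]
      simpa using mul_nonneg hA0 (hΘ0 u x)
  have hdp : ∀ u x, ∑ b : Fin n, coordDeriv y.1 b (p u) x ^ 2 ≤ M / δ * Θ u x := fun u x => by
    by_cases hx : x ∈ (Subtype.val '' K : Set N)
    · obtain ⟨x, hx, rfl⟩ := hx
      exact ((hM (u.1 i) x hx).2).trans (hΘK u x hx)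
    · have h0 : ∀ b : Fin n, coordDeriv y.1 b (p u) x = 0 := fun b =>
        coordDeriv_eq_zero_of_notMem_tsupport _ _ fun h => hx (hpt u h)
      simpa [h0] using mul_nonneg hA0 (hΘ0 u x)
  have hp2i : ∀ u, ∫ x, p u x ^ 2 ∂(riemannianVolume g) ≤
      M / δ * (dirichletCore g R c f).inner u u := fun u => by
    rw [← hΘd, ← integral_const_mul]
    exact integral_mono_of_nonneg (ae_of_all _ fun x => sq_nonneg _) ((hΘi u).const_mul _)
      (ae_of_all _ (hp2 u))
  have hdpi : ∀ u, ∫ x, ∑ b : Fin n, coordDeriv y.1 b (p u) x ^ 2 ∂(riemannianVolume g) ≤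
      M / δ * (dirichletCore g R c f).inner u u := fun u => by
    rw [← hΘd, ← integral_const_mul]
    exact integral_mono_of_nonneg
      (ae_of_all _ fun x => Finset.sum_nonneg fun b _ => sq_nonneg _) ((hΘi u).const_mul _)
      (ae_of_all _ (hdp u))
  have hpi : ∀ u, Integrable (p u) (riemannianVolume g) := fun u =>
    (hps u).continuous.integrable_of_hasCompactSupport (HasCompactSupport.of_compactSpace _)
  have hpi2 : ∀ u, Integrable (fun x => p u x ^ 2) (riemannianVolume g) := fun u =>
    ((hps u).continuous.pow 2).integrable_of_hasCompactSupport (HasCompactSupport.of_compactSpace _)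
  intro ε hε
  -- The derivative term is at most M / δ times the Dirichlet form, hence this ε; the summand 1
  -- covers the case M = 0.
  obtain ⟨r, q, B, hqm, hqB, hq⟩ := integral_sq_le_of_tsupport_subset g y.1
    (hK.image continuous_subtype_val) hKs (ε := ε / (M / δ + 1)) (by positivity)
  have hqi : ∀ j u, Integrable (fun x => q j x * p u x) (riemannianVolume g) := fun j u =>
    (hpi u).bdd_mul (hqm j) (ae_of_all _ (hqB j))
  let F : Fin r → globalSections c →ₗ[ℝ] ℝ := fun j =>
    { toFun := fun u => ∫ x, q j x * p u x ∂(riemannianVolume g)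
      map_add' := fun u v => by
        rw [← integral_add (hqi j u) (hqi j v)]
        refine integral_congr_ae (ae_of_all _ fun x => ?_)
        by_cases hx : x ∈ c.U i
        · simp only [hp, extendZero_apply_of_mem _ hx]
          change q j x * m.inner _ (u.1 i _ + v.1 i _) _ = _
          rw [map_add, add_apply, mul_add]
        · simp [hp, extendZero_apply_of_notMem _ hx]
      map_smul' := fun t u => by
        rw [RingHom.id_apply, smul_eq_mul, ← integral_const_mul]
        refine integral_congr_ae (ae_of_all _ fun x => ?_)
        by_cases hx : x ∈ c.U i
        · simp only [hp, extendZero_apply_of_mem _ hx]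
          change q j x * m.inner _ (t • u.1 i _) _ = _
          rw [map_smul, smul_apply, smul_eq_mul]
          ring
        · simp [hp, extendZero_apply_of_notMem _ hx] }
  refine ⟨Fin r, inferInstance, F,
    (riemannianVolume g).real univ * (B ^ 2 * (M / δ)), fun j u => ?_, fun u => ?_⟩
  · have hle : ∀ x, (q j x * p u x) ^ 2 ≤ B ^ 2 * p u x ^ 2 := fun x => by
      rw [mul_pow]
      exact mul_le_mul_of_nonneg_right (sq_le_sq' (abs_le.1 (hqB j x)).1 (abs_le.1 (hqB j x)).2)
        (sq_nonneg _)
    have hi : Integrable (fun x => (q j x * p u x) ^ 2) (riemannianVolume g) :=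
      ((hpi2 u).const_mul (B ^ 2)).mono' ((hqi j u).aestronglyMeasurable.pow 2)
        (ae_of_all _ fun x => by
          rw [Real.norm_of_nonneg (sq_nonneg _)]
          exact hle x)
    refine (sq_integral_le (hqi j u) hi).trans ?_
    rw [mul_assoc, mul_assoc]
    refine mul_le_mul_of_nonneg_left ?_ measureReal_nonneg
    refine (integral_mono hi ((hpi2 u).const_mul (B ^ 2)) hle).trans ?_
    rw [integral_const_mul]
    exact mul_le_mul_of_nonneg_left (hp2i u) (sq_nonneg _)
  · refine (hq (p u) (hps u) (hpt u)).trans (add_le_add_left ?_ _)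
    have h1 : ε / (M / δ + 1) * (M / δ) ≤ ε := by
      rw [div_mul_eq_mul_div, div_le_iff₀ (by positivity)]
      nlinarith
    calc _ ≤ ε / (M / δ + 1) * (M / δ * (dirichletCore g R c f).inner u u) :=
          mul_le_mul_of_nonneg_left (hdpi u) (by positivity)
      _ = ε / (M / δ + 1) * (M / δ) * (dirichletCore g R c f).inner u u := by ring
      _ ≤ _ := mul_le_mul_of_nonneg_right h1 (dirichletCore_nonneg f u)

end Rellich

/-! ### Compactness and injectivity of the resolvent -/

section Compactness

variable {n : ℕ} {N : Type u} [TopologicalSpace N] [T2Space N] [CompactSpace N]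
  [ChartedSpace (Euc n) N] [IsManifold (𝓡 n) ∞ N] [MeasurableSpace N] [BorelSpace N]
  {V : Type v} [NormedAddCommGroup V] [NormedSpace ℝ V]
  {C : VectorialGerbe.{u, v, w} n N V} {c : CechChain C} (f : Partition c)
  {g : ManifoldMetric n N} {R : RiemannianStructure C}

theorem metric_transition (i j : c.ι) (y : N) (hi : y ∈ c.U i) (hj : y ∈ c.U j)
    (a : (C.bundle (c.e j)).Fib ⟨y, hj⟩) :
    (R.metric (c.e i)).inner ⟨y, hi⟩
      (transition (C.resMap _ (c.e i)) (C.resMap _ (c.e j)) (c.g i j) y hi hj a)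
      (transition (C.resMap _ (c.e i)) (C.resMap _ (c.e j)) (c.g i j) y hi hj a) =
    (R.metric (c.e j)).inner ⟨y, hj⟩ a a := by
  set x : (c.U i ⊓ c.U j : Opens N) := ⟨y, hi, hj⟩
  set a' := ((C.resMap inf_le_right (c.e j)).map x).symm a with ha'
  have h1 := R.metric_res inf_le_left (c.e i) x ((c.g i j).map x a') ((c.g i j).map x a')
  have h2 := R.metric_hom _ (c.g_mem i j) x a' a'
  have h3 := R.metric_res inf_le_right (c.e j) x a' a'
  have h4 : (C.resMap inf_le_right (c.e j)).map x a' = a :=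
    ContinuousLinearEquiv.apply_symm_apply _ _
  rw [h4] at h3
  exact h1.trans (h2.trans h3.symm)

/-- The density `∑ fᵢ |uᵢ|²` is `|uᵢ|²` over `Uᵢ`. -/
theorem finsum_metric_eq (u : globalSections c) (i : c.ι) (x : c.U i) :
    ∑ᶠ j, f.1 j x.1 • extendZero (c.U j)
      (fun x => (R.metric (c.e j)).inner x (u.1 j x) (u.1 j x)) x.1 =
      (R.metric (c.e i)).inner x (u.1 i x) (u.1 i x) := by
  have h1 : ∀ j, f.1 j x.1 • extendZero (c.U j)
      (fun x => (R.metric (c.e j)).inner x (u.1 j x) (u.1 j x)) x.1 =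
      f.1 j x.1 * (R.metric (c.e i)).inner x (u.1 i x) (u.1 i x) := by
    intro j
    by_cases hj : x.1 ∈ c.U j
    · rw [extendZero_apply_of_mem _ hj, smul_eq_mul, ← metric_transition (R := R) i j x.1 x.2 hj,
        ← u.2 i j x.1 x.2 hj]
    · rw [image_eq_zero_of_notMem_tsupport fun h => hj (f.2 j h), zero_smul, zero_mul]
  simp only [h1]
  rw [← finsum_mul, f.1.sum_eq_one (mem_univ x.1), one_mul]

variable [FiniteDimensional ℝ V]

/-- Some f i is positive at y, hence larger than half its value there on a neighbourhood. Inside it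
finitely many compactly supported sections s_α satisfy |u|² ≤ C ∑ ⟨u, s_α⟩² near y, and each
component ⟨u, s_α⟩ is handled by Rellich's inequality in a chart. -/
theorem exists_open_isSmallModFiniteRank (y : N) : ∃ O : Set N, IsOpen O ∧ y ∈ O ∧
    IsSmallModFiniteRank (fun u => (dirichletCore g R c f).inner u u) fun u : globalSections c =>
      ∫ x, O.indicator (fun x => ∑ᶠ i, f.1 i x • extendZero (c.U i)
        (fun x => (R.metric (c.e i)).inner x (u.1 i x) (u.1 i x)) x) x ∂(riemannianVolume g) := by
  obtain ⟨i, hi⟩ := f.1.exists_pos_of_mem (mem_univ y)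
  have hyU : y ∈ c.U i := f.2 i (subset_tsupport _ hi.ne')
  set y' : c.U i := ⟨y, hyU⟩
  have hT : (chartAt (Euc n) y').source ∩ {x : c.U i | f.1 i y / 2 < f.1 i x.1} ∈ 𝓝 y' := by
    refine inter_mem ((chartAt (Euc n) y').open_source.mem_nhds (mem_chart_source _ _)) ?_
    refine IsOpen.mem_nhds ?_ (half_lt_self hi)
    exact isOpen_lt continuous_const ((f.1 i).contMDiff.continuous.comp continuous_subtype_val)
  obtain ⟨r, s, O, K, B, hO, hyO, hK, hKT, hs, hB, hle⟩ :=
    exists_sections_metric_le (R.metric (c.e i)) y' hT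
  refine ⟨Subtype.val '' O, (c.U i).isOpenEmbedding'.isOpenMap _ hO, ⟨y', hyO, rfl⟩, ?_⟩
  have hsmall := IsSmallModFiniteRank.const_mul hB (dirichletCore_nonneg (g := g) (R := R) f)
    (IsSmallModFiniteRank.sum (dirichletCore_nonneg (g := g) (R := R) f) Finset.univ fun α _ =>
      isSmallModFiniteRank_component f i hK (fun x hx => (hKT hx).1) (half_pos hi)
        (fun x hx => (hKT hx).2.le) (s α) (hs α))
  refine hsmall.mono fun u => ?_
  have hpi : ∀ α, Integrable (fun x => extendZero (c.U i)
      (fun x => (R.metric (c.e i)).inner x (u.1 i x) (s α x)) x ^ 2) (riemannianVolume g) :=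
    fun α => ((contMDiff_extendZero (contMDiff_metric (R.metric (c.e i)) (u.1 i) (s α))
      (hK.of_isClosed_subset (isClosed_tsupport _)
        ((tsupport_metric_subset _ _ _).trans (hs α)))).continuous.pow
          2).integrable_of_hasCompactSupport (HasCompactSupport.of_compactSpace _)
  rw [← integral_finsetSum _ fun α _ => hpi α, ← integral_const_mul]
  refine integral_mono_of_nonneg (ae_of_all _ fun x => ?_)
    ((integrable_finsetSum _ fun α _ => hpi α).const_mul _) (ae_of_all _ fun x => ?_)
  · refine indicator_nonneg (fun x hx => ?_) x
    obtain ⟨x, -, rfl⟩ := hx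
    rw [finsum_metric_eq]
    exact metric_self_nonneg _ _
  · by_cases hx : x ∈ (Subtype.val '' O : Set N)
    · rw [indicator_of_mem hx]
      obtain ⟨x, hxO, rfl⟩ := hx
      rw [finsum_metric_eq]
      simp only [extendZero_val]
      exact hle x hxO _
    · rw [indicator_of_notMem hx]
      exact mul_nonneg hB (Finset.sum_nonneg fun α _ => sq_nonneg _)

/-- The density of the L² form is nonnegative, so its integral is at most the sum of its integrals
over a finite subcover of N by the local neighbourhoods. -/
theorem isSmallModFiniteRank_l2Core :
    IsSmallModFiniteRank (fun u => (dirichletCore g R c f).inner u u)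
      fun u : globalSections c => (l2Core g R c f).inner u u := by
  choose O hO hyO hsmall using exists_open_isSmallModFiniteRank (g := g) (R := R) f
  obtain ⟨S, hS⟩ := isCompact_univ.elim_finite_subcover O hO fun y _ => mem_iUnion.2 ⟨y, hyO y⟩
  refine (IsSmallModFiniteRank.sum (dirichletCore_nonneg f) S fun y _ => hsmall y).mono fun u => ?_
  have hi := integrable_glue (g := g) f
    (q := fun i x => (R.metric (c.e i)).inner x (u.1 i x) (u.1 i x))
    fun i => continuous_metric _ _ _
  have hii := fun y => hi.indicator (hO y).measurableSet
  rw [← integral_finsetSum _ fun y _ => hii y]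
  refine integral_mono hi (integrable_finsetSum _ fun y _ => hii y) fun x => ?_
  have h0 : ∀ x : N, 0 ≤ ∑ᶠ i, f.1 i x • extendZero (c.U i)
      (fun x => (R.metric (c.e i)).inner x (u.1 i x) (u.1 i x)) x := fun x => by
    obtain ⟨i, hxi⟩ := c.cover x
    rw [finsum_metric_eq f u i ⟨x, hxi⟩]
    exact metric_self_nonneg _ _
  obtain ⟨y, hyS, hxy⟩ := mem_iUnion₂.1 (hS (mem_univ x))
  have h1 := Finset.single_le_sum (s := S) (f := fun y => (O y).indicator (fun x =>
    ∑ᶠ i, f.1 i x • extendZero (c.U i)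
      (fun x => (R.metric (c.e i)).inner x (u.1 i x) (u.1 i x)) x) x)
    (fun y _ => indicator_nonneg (fun x _ => h0 x) x) hyS
  simp only [indicator_of_mem hxy] at h1
  exact h1

/-- The inclusion of the Dirichlet space in the space of square integrable sections is compact. -/
theorem isCompactOperator_dirichlet_inclusion :
    IsCompactOperator (completionMap _ _ (l2_le_dirichlet g R c f)) :=
  isCompactOperator_completionMap _ fun _ hε =>
    (isSmallModFiniteRank_l2Core f).exists_fin hε

theorem isCompactOperator_comp_adjoint {H K : Type*} [NormedAddCommGroup H]
    [InnerProductSpace ℝ H] [CompleteSpace H] [NormedAddCommGroup K] [InnerProductSpace ℝ K]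
    [CompleteSpace K] {J : H →L[ℝ] K} (hJ : IsCompactOperator J) :
    IsCompactOperator (J ∘L J.adjoint) :=
  hJ.comp_clm J.adjoint

theorem isCompactOperator_resolvent : IsCompactOperator (resolvent g R c f) := by
  unfold resolvent
  exact isCompactOperator_comp_adjoint (isCompactOperator_dirichlet_inclusion f)

theorem isSelfAdjoint_comp_adjoint {H K : Type*} [NormedAddCommGroup H] [InnerProductSpace ℝ H]
    [CompleteSpace H] [NormedAddCommGroup K] [InnerProductSpace ℝ K] [CompleteSpace K]
    (J : H →L[ℝ] K) : IsSelfAdjoint (J ∘L J.adjoint) := by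
  rw [ContinuousLinearMap.isSelfAdjoint_iff', ContinuousLinearMap.adjoint_comp,
    ContinuousLinearMap.adjoint_adjoint]

theorem isSelfAdjoint_resolvent : IsSelfAdjoint (resolvent g R c f) := by
  unfold resolvent
  exact
    isSelfAdjoint_comp_adjoint (completionMap _ _ (l2_le_dirichlet g R c f))

theorem norm_one_sub_resolvent_le : ‖1 - resolvent g R c f‖ ≤ 1 :=
  norm_one_sub_comp_adjoint_le (norm_completionMap_le (l2_le_dirichlet g R c f))

/-- J J* x = 0 implies ‖J* x‖² = ⟨J J* x, x⟩ = 0. -/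
theorem injective_comp_adjoint {H K : Type*} [NormedAddCommGroup H] [InnerProductSpace ℝ H]
    [CompleteSpace H] [NormedAddCommGroup K] [InnerProductSpace ℝ K] [CompleteSpace K]
    {J : H →L[ℝ] K} (hJ : Function.Injective J.adjoint) :
    Function.Injective (J ∘L J.adjoint) := by
  refine (injective_iff_map_eq_zero _).2 fun x hx => (injective_iff_map_eq_zero _).1 hJ x ?_
  have h1 : inner ℝ (J (J.adjoint x)) x = 0 := by
    rw [show J (J.adjoint x) = 0 from hx, inner_zero_left]
  rw [← ContinuousLinearMap.adjoint_inner_right] at h1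
  exact inner_self_eq_zero.1 h1

theorem injective_resolvent : Function.Injective (resolvent g R c f) :=
  injective_comp_adjoint (injective_adjoint_completionMap (l2_le_dirichlet g R c f))

/-- J* maps the class of (1 + Δ) u to that of u in the Dirichlet completion by the weak equation,
and J is the identity on S(g_ij). This is where the abstract resolvent meets the differential
operator. -/
theorem resolvent_toHilbert (hR : ArrowsCommuteWithLaplacian g R) (u : globalSections c) :
    resolvent g R c f (toHilbert (l2Core g R c f) ((1 + laplacian g R c) u)) =
      toHilbert (l2Core g R c f) u := by
  rw [resolvent, ContinuousLinearMap.comp_apply,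
    adjoint_completionMap_toHilbert (l2_le_dirichlet g R c f) (u := u)
      fun v => dirichletCore_inner_eq f hR u v]
  exact completionMap_toHilbert _ _

end Compactness

end GerbeRellich

end

theorem proposition5 {n : ℕ} {N : Type u} [TopologicalSpace N] [T2Space N] [CompactSpace N]
    [ChartedSpace (GerbeRellich.Euc n) N] [IsManifold (𝓡 n) ∞ N] [MeasurableSpace N] [BorelSpace N]
    {V : Type v} [NormedAddCommGroup V] [NormedSpace ℝ V] [FiniteDimensional ℝ V]
    (g : GerbeRellich.ManifoldMetric n N) (C : GerbeRellich.VectorialGerbe.{u, v, w} n N V)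
    (R : GerbeRellich.RiemannianStructure C) (hR : GerbeRellich.ArrowsCommuteWithLaplacian g R)
    (c : GerbeRellich.CechChain C) (f : GerbeRellich.Partition c) (s t : ℝ) (hts : t < s) :
    ∃ incl : GerbeRellich.SobolevSections g R c f s →L[ℝ] GerbeRellich.SobolevSections g R c f t,
      (∀ u : GerbeRellich.globalSections c,
        incl (GerbeRellich.toHilbert (GerbeRellich.sobolevCore g R c f s) u) =
          GerbeRellich.toHilbert (GerbeRellich.sobolevCore g R c f t) u) ∧
      Function.Injective incl ∧
      (∀ (h : ℕ → GerbeRellich.SobolevSections g R c f s) (L : ℝ), (∀ k, ‖h k‖ < L) →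
        ∃ (σ : ℕ → ℕ) (h' : GerbeRellich.SobolevSections g R c f t), StrictMono σ ∧
          Tendsto (fun k => incl (h (σ k))) atTop (𝓝 h')) ∧
      IsCompactOperator incl :=
  GerbeRellich.exists_compact_inclusion (GerbeRellich.toHilbert (GerbeRellich.l2Core g R c f))
    (GerbeRellich.resolvent g R c f) (GerbeRellich.norm_one_sub_resolvent_le f)
    (GerbeRellich.isSelfAdjoint_resolvent f) (GerbeRellich.isCompactOperator_resolvent f)
    (GerbeRellich.injective_resolvent f) (1 + GerbeRellich.laplacian g R c)
    (GerbeRellich.resolvent_toHilbert f hR) (GerbeRellich.besselPotential g R c f)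
    (fun _ _ => rfl) hts
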